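/- Let $G \rightrightarrows M$ be a Lie groupoid (smooth, Hausdorff, second countable, finite-dimensional manifolds) with source $s$, target $t$, composition $m$ and unit map $u$, all of whose source fibres $s^{-1}(x)$ are connected. Let $A = (\ker ds)|_M$ be its Lie algebroid and, for $\alpha\in\Gamma(A)$, let $\alpha^r$ be the associated right-invariant vector field, $\alpha^r_g = dm(\alpha_{t(g)}, 0_g)$. Let $\mathcal H\subset TG$ be a multiplicative distribution, i.e. a smooth vector subbundle of constant rank which is a subgroupoid of the tangent groupoid $TG\rightrightarrows TM$ with base $TM$. Put $\mathfrak g = (\mathcal H\cap\ker ds)|_M\subset A$ and $E = A/\mathfrak g$. Then there is exactly one operator $D:\mathfrak X(M)\times\Gamma(A)\to\Gamma(E)$ (the Spencer operator of $\mathcal H$) such that $$D_X\alpha(x) = [\tilde X,\alpha^r]_{1_x} \bmod \mathfrak g_x$$ for every vector field $\tilde X$ on $G$ that is tangent to $\mathcal H$, is $s$-projectable to $X$ and satisfies $\tilde X_{1_x} = du(X_x)$ for all $x\in M$. Let $\partial_D:\mathfrak g\to\mathrm{Hom}(TM,E)$, $\partial_D(\beta)(X) = D_X\beta$, be its symbol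 map. If $\partial_D=0$, then there is exactly one operator $\nabla^E:\mathfrak X(M)\times\Gamma(E)\to\Gamma(E)$ with $\nabla^E_X[\alpha] = D_X\alpha$ for all $\alpha\in\Gamma(A)$, and it is a linear connection on $E$. The distribution $\mathcal H$ is Frobenius involutive (the vector fields tangent to $\mathcal H$ are closed under the Lie bracket) if and only if $\partial_D = 0$ and the connection $\nabla^E$ is flat. -/

import Mathlib

open Set Manifold VectorField
open scoped ContDiff

noncomputable section

/-- Smooth vector fields on an `n`-dimensional manifold `N`. -/
@[ext]
structure VField (n : ℕ) (N : Type*) [TopologicalSpace N]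
    [ChartedSpace (EuclideanSpace ℝ (Fin n)) N] [IsManifold (𝓡 n) ∞ N] where
  val : ∀ x : N, TangentSpace (𝓡 n) x
  smooth : ContMDiff (𝓡 n) (𝓡 n).tangent ∞ (fun x => (⟨x, val x⟩ : TangentBundle (𝓡 n) N))

/-- The Lie bracket of two smooth vector fields. -/
def VField.bracket {n : ℕ} {N : Type*} [TopologicalSpace N]
    [ChartedSpace (EuclideanSpace ℝ (Fin n)) N] [IsManifold (𝓡 n) ∞ N]
    (X Y : VField n N) : VField n N where
  val := mlieBracket (𝓡 n) X.val Y.val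
  smooth := by
    have : IsManifold (𝓡 n) (((⊤ : ℕ∞) : WithTop ℕ∞) + 1) N := by
      simpa using (inferInstance : IsManifold (𝓡 n) ∞ N)
    have : IsManifold (𝓡 n) (minSmoothness ℝ 2) N :=
      IsManifold.of_le (n := ∞) (by simpa using (WithTop.coe_le_coe.mpr le_top : ((2 : ℕ∞) : WithTop ℕ∞) ≤ ((⊤ : ℕ∞) : WithTop ℕ∞)))
    exact ContDiff.mlieBracket_vectorField (m := ⊤) (n := ⊤) X.smooth Y.smooth (by simp)

/-- The derivative `X(f)` of a function `f` along a vector field `X`. -/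
def VField.lieDeriv {n : ℕ} {N : Type*} [TopologicalSpace N]
    [ChartedSpace (EuclideanSpace ℝ (Fin n)) N] [IsManifold (𝓡 n) ∞ N]
    (X : VField n N) (f : N → ℝ) (x : N) : ℝ :=
  mfderiv (𝓡 n) 𝓘(ℝ, ℝ) f x (X.val x)

/-- Transport of a tangent vector along an equality of base points. -/
def tangentCast {n : ℕ} {N : Type*} [TopologicalSpace N]
    [ChartedSpace (EuclideanSpace ℝ (Fin n)) N] {x y : N} (h : x = y)
    (v : TangentSpace (𝓡 n) x) : TangentSpace (𝓡 n) y :=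
  h ▸ v

/-- A distribution on `N`: a smooth vector subbundle of `TN`, i.e. a family of subspaces of
the tangent spaces, of constant dimension, which is locally spanned by smooth frames. -/
structure TangentDistribution (n : ℕ) (N : Type*) [TopologicalSpace N]
    [ChartedSpace (EuclideanSpace ℝ (Fin n)) N] [IsManifold (𝓡 n) ∞ N] where
  fiber : ∀ x : N, Submodule ℝ (TangentSpace (𝓡 n) x)
  rank : ℕ
  exists_frame : ∀ x₀ : N, ∃ U : Set N, IsOpen U ∧ x₀ ∈ U ∧
    ∃ ξ : Fin rank → ∀ x : N, TangentSpace (𝓡 n) x,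
      (∀ i, ContMDiffOn (𝓡 n) (𝓡 n).tangent ∞
        (fun x => (⟨x, ξ i x⟩ : TangentBundle (𝓡 n) N)) U) ∧
      ∀ x ∈ U, LinearIndependent ℝ (fun i => ξ i x) ∧
        Submodule.span ℝ (range fun i => ξ i x) = fiber x

/-- Frobenius involutivity: the vector fields tangent to `H` are closed under the bracket. -/
def TangentDistribution.IsInvolutive {n : ℕ} {N : Type*} [TopologicalSpace N]
    [ChartedSpace (EuclideanSpace ℝ (Fin n)) N] [IsManifold (𝓡 n) ∞ N]
    (H : TangentDistribution n N) : Prop :=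
  ∀ V W : VField n N, (∀ x, V.val x ∈ H.fiber x) → (∀ x, W.val x ∈ H.fiber x) →
    ∀ x, (V.bracket W).val x ∈ H.fiber x

/-- A Lie groupoid `G ⇉ M`, with `dim G = p` and `dim M = n`. The composition `mul g h = g h` is
only meaningful for composable pairs, i.e. when `src g = tgt h`: no axiom concerns its (arbitrary)
values on the other pairs. Smoothness of the composition is smoothness on the
submanifold of composable pairs of `G × G`. -/
structure LieGroupoid (p n : ℕ) (G M : Type*)
    [TopologicalSpace G] [ChartedSpace (EuclideanSpace ℝ (Fin p)) G] [IsManifold (𝓡 p) ∞ G]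
    [TopologicalSpace M] [ChartedSpace (EuclideanSpace ℝ (Fin n)) M] [IsManifold (𝓡 n) ∞ M] where
  src : G → M
  tgt : G → M
  unit : M → G
  inv : G → G
  mul : G → G → G
  src_mul : ∀ g h, src g = tgt h → src (mul g h) = src h
  tgt_mul : ∀ g h, src g = tgt h → tgt (mul g h) = tgt g
  mul_assoc : ∀ g h k, src g = tgt h → src h = tgt k → mul (mul g h) k = mul g (mul h k)
  src_unit : ∀ x, src (unit x) = x
  tgt_unit : ∀ x, tgt (unit x) = x
  mul_unit : ∀ g, mul g (unit (src g)) = g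
  unit_mul : ∀ g, mul (unit (tgt g)) g = g
  src_inv : ∀ g, src (inv g) = tgt g
  tgt_inv : ∀ g, tgt (inv g) = src g
  inv_mul : ∀ g, mul (inv g) g = unit (src g)
  mul_inv : ∀ g, mul g (inv g) = unit (tgt g)
  src_submersion : IsSubmersion (𝓡 p) (𝓡 n) ∞ src
  tgt_submersion : IsSubmersion (𝓡 p) (𝓡 n) ∞ tgt
  unit_smooth : ContMDiff (𝓡 n) (𝓡 p) ∞ unit
  inv_smooth : ContMDiff (𝓡 p) (𝓡 p) ∞ inv
  mul_smooth : ContMDiffOn ((𝓡 p).prod (𝓡 p)) (𝓡 p) ∞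
    (fun q : G × G => mul q.1 q.2) {q : G × G | src q.1 = tgt q.2}

namespace LieGroupoid

variable {p n : ℕ} {G M : Type*}
  [TopologicalSpace G] [ChartedSpace (EuclideanSpace ℝ (Fin p)) G] [IsManifold (𝓡 p) ∞ G]
  [TopologicalSpace M] [ChartedSpace (EuclideanSpace ℝ (Fin n)) M] [IsManifold (𝓡 n) ∞ M]
  (𝒢 : LieGroupoid p n G M)

/-- All the source fibres are connected. -/
def IsSourceConnected : Prop := ∀ x : M, IsConnected (𝒢.src ⁻¹' {x})

/-- The differential of the source map. -/
def dsrc (g : G) : TangentSpace (𝓡 p) g →L[ℝ] TangentSpace (𝓡 n) (𝒢.src g) :=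
  mfderiv (𝓡 p) (𝓡 n) 𝒢.src g

/-- The differential of the target map. -/
def dtgt (g : G) : TangentSpace (𝓡 p) g →L[ℝ] TangentSpace (𝓡 n) (𝒢.tgt g) :=
  mfderiv (𝓡 p) (𝓡 n) 𝒢.tgt g

/-- The differential of the unit map. -/
def dunit (x : M) : TangentSpace (𝓡 n) x →L[ℝ] TangentSpace (𝓡 p) (𝒢.unit x) :=
  mfderiv (𝓡 n) (𝓡 p) 𝒢.unit x

/-- The differential of the inversion. -/
def dinv (g : G) : TangentSpace (𝓡 p) g →L[ℝ] TangentSpace (𝓡 p) (𝒢.inv g) :=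
  mfderiv (𝓡 p) (𝓡 p) 𝒢.inv g

/-- The differential `dm (v, w)` of the composition at a composable pair `(g, h)`. It is meaningful
for `(v, w)` tangent to the submanifold of composable pairs, i.e. for `ds v = dt w`; on
these vectors any two derivatives within the submanifold agree. -/
def dmul (g h : G) (v : TangentSpace (𝓡 p) g) (w : TangentSpace (𝓡 p) h) :
    TangentSpace (𝓡 p) (𝒢.mul g h) :=
  mfderivWithin ((𝓡 p).prod (𝓡 p)) (𝓡 p) (fun q : G × G => 𝒢.mul q.1 q.2)
    {q : G × G | 𝒢.src q.1 = 𝒢.tgt q.2} (g, h)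
    ((v, w) : TangentSpace (𝓡 p) g × TangentSpace (𝓡 p) h)

/-- A multiplicative distribution: a distribution `H ⊆ TG` which is a subgroupoid, with the same
base `TM`, of the tangent groupoid `TG ⇉ TM`, whose structure maps are the
differentials of those of `G`. In the equation `ds v = dt w` both sides are tangent at the
point `src g = tgt h`. -/
structure IsMultiplicative (H : TangentDistribution p G) : Prop where
  unit_mem : ∀ (x : M) (X : TangentSpace (𝓡 n) x), 𝒢.dunit x X ∈ H.fiber (𝒢.unit x)
  mul_mem : ∀ (g h : G) (hgh : 𝒢.src g = 𝒢.tgt h),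
    ∀ v ∈ H.fiber g, ∀ w ∈ H.fiber h, tangentCast hgh (𝒢.dsrc g v) = 𝒢.dtgt h w →
      𝒢.dmul g h v w ∈ H.fiber (𝒢.mul g h)
  inv_mem : ∀ (g : G), ∀ v ∈ H.fiber g, 𝒢.dinv g v ∈ H.fiber (𝒢.inv g)

/-- The fibre at `x` of the Lie algebroid `A = (ker ds)|_M`. -/
def algFiber (x : M) : Submodule ℝ (TangentSpace (𝓡 p) (𝒢.unit x)) :=
  LinearMap.ker (𝒢.dsrc (𝒢.unit x)).toLinearMap

/-- Smooth sections of the Lie algebroid `A`, as smooth maps `M → TG` along the units. -/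
@[ext]
structure AlgSection where
  val : ∀ x : M, 𝒢.algFiber x
  smooth : ContMDiff (𝓡 n) (𝓡 p).tangent ∞
    (fun x => (⟨𝒢.unit x, (val x : TangentSpace (𝓡 p) (𝒢.unit x))⟩ : TangentBundle (𝓡 p) G))

/-- The right invariant vector field `αʳ_g = R_g (α (t g)) = dm (α (t g), 0_g)` of a section `α`
of `A`. The ambient tangent space is the one at `g`, since `1_{t(g)} g = g`. -/
def rightInv (α : 𝒢.AlgSection) (g : G) : TangentSpace (𝓡 p) g :=
  tangentCast (𝒢.unit_mul g) (𝒢.dmul (𝒢.unit (𝒢.tgt g)) g (α.val (𝒢.tgt g)) 0)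

/-- The fibre at `x` of the symbol space `𝔤 = (H ∩ ker ds)|_M`, as a subspace of `A_x`. -/
def symbolFiber (H : TangentDistribution p G) (x : M) : Submodule ℝ (𝒢.algFiber x) :=
  (H.fiber (𝒢.unit x)).comap (𝒢.algFiber x).subtype

/-- Smooth sections of the vector bundle `E = A / 𝔤`: the classes of the smooth sections of `A`. -/
@[ext]
structure QuotSection (H : TangentDistribution p G) where
  val : ∀ x : M, 𝒢.algFiber x ⧸ 𝒢.symbolFiber H x
  smooth : ∃ α : 𝒢.AlgSection, ∀ x, val x = Submodule.Quotient.mk (α.val x)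

/-- The class `[α] ∈ Γ(E)` of a section `α` of `A`. -/
def AlgSection.mod {𝒢 : LieGroupoid p n G M} (α : 𝒢.AlgSection) (H : TangentDistribution p G) :
    𝒢.QuotSection H where
  val x := Submodule.Quotient.mk (α.val x)
  smooth := ⟨α, fun _ => rfl⟩

/-- Smooth sections of the symbol space `𝔤`. -/
def SymbolSection (H : TangentDistribution p G) : Type _ :=
  {β : 𝒢.AlgSection // ∀ x, β.val x ∈ 𝒢.symbolFiber H x}

/-- `V` is a vector field tangent to `H`, `s`-projectable to `X`, which extends `u_* X`. -/
structure IsLift (H : TangentDistribution p G) (X : VField n M) (V : VField p G) : Prop where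
  tangent : ∀ g, V.val g ∈ H.fiber g
  projects : ∀ g, 𝒢.dsrc g (V.val g) = X.val (𝒢.src g)
  extends_unit : ∀ x, V.val (𝒢.unit x) = 𝒢.dunit x (X.val x)

/-- `D : 𝔛(M) × Γ(A) → Γ(E)` is the Spencer operator associated to `H`:
`D_X α (x) = [X̃, αʳ]_{1_x} mod 𝔤_x` for any vector field `X̃` tangent to `H` which
is `s`-projectable to `X` and extends `u_* X`. -/
def IsSpencerOperator (H : TangentDistribution p G)
    (D : VField n M → 𝒢.AlgSection → 𝒢.QuotSection H) : Prop :=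
  ∀ (X : VField n M) (V : VField p G), 𝒢.IsLift H X V → ∀ (α : 𝒢.AlgSection) (x : M),
    ∃ h : mlieBracket (𝓡 p) V.val (𝒢.rightInv α) (𝒢.unit x) ∈ 𝒢.algFiber x,
      (D X α).val x = Submodule.Quotient.mk
        ⟨mlieBracket (𝓡 p) V.val (𝒢.rightInv α) (𝒢.unit x), h⟩

/-- The symbol map `∂_D : 𝔤 → Hom(TM, E)`, `∂_D(β)(X) = D_X β`, on sections. -/
def symbolMap (H : TangentDistribution p G) (D : VField n M → 𝒢.AlgSection → 𝒢.QuotSection H)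
    (β : 𝒢.SymbolSection H) (X : VField n M) : 𝒢.QuotSection H :=
  D X β.1

/-- The symbol map vanishes. -/
def SymbolVanishes (H : TangentDistribution p G)
    (D : VField n M → 𝒢.AlgSection → 𝒢.QuotSection H) : Prop :=
  ∀ (β : 𝒢.SymbolSection H) (X : VField n M) (x : M), (𝒢.symbolMap H D β X).val x = 0

/-- `nab` is the operator induced by `D` on `E`, i.e. `nab_X [α] = D_X α`. As every section of `E`
is of the form `[α]`, there is at most one. -/
def IsInduced (H : TangentDistribution p G) (D : VField n M → 𝒢.AlgSection → 𝒢.QuotSection H)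
    (nab : VField n M → 𝒢.QuotSection H → 𝒢.QuotSection H) : Prop :=
  ∀ (X : VField n M) (α : 𝒢.AlgSection), nab X (α.mod H) = D X α

/-- `nab` is a linear connection on the vector bundle `E`. -/
structure IsConnection (H : TangentDistribution p G)
    (nab : VField n M → 𝒢.QuotSection H → 𝒢.QuotSection H) : Prop where
  add_field : ∀ (X Y Z : VField n M) (e : 𝒢.QuotSection H),
    (∀ x, Z.val x = X.val x + Y.val x) → ∀ x, (nab Z e).val x = (nab X e).val x + (nab Y e).val x
  smul_field : ∀ (f : M → ℝ) (X Z : VField n M) (e : 𝒢.QuotSection H),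
    ContMDiff (𝓡 n) 𝓘(ℝ, ℝ) ∞ f → (∀ x, Z.val x = f x • X.val x) →
      ∀ x, (nab Z e).val x = f x • (nab X e).val x
  add_section : ∀ (X : VField n M) (e₁ e₂ e : 𝒢.QuotSection H),
    (∀ x, e.val x = e₁.val x + e₂.val x) →
      ∀ x, (nab X e).val x = (nab X e₁).val x + (nab X e₂).val x
  leibniz : ∀ (f : M → ℝ) (X : VField n M) (e₁ e : 𝒢.QuotSection H),
    ContMDiff (𝓡 n) 𝓘(ℝ, ℝ) ∞ f → (∀ x, e.val x = f x • e₁.val x) →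
      ∀ x, (nab X e).val x = f x • (nab X e₁).val x + X.lieDeriv f x • e₁.val x

/-- Flatness: `nab_X nab_Y e - nab_Y nab_X e - nab_[X,Y] e = 0`. -/
def IsFlat (H : TangentDistribution p G)
    (nab : VField n M → 𝒢.QuotSection H → 𝒢.QuotSection H) : Prop :=
  ∀ (X Y : VField n M) (e : 𝒢.QuotSection H) (x : M),
    (nab X (nab Y e)).val x - (nab Y (nab X e)).val x - (nab (X.bracket Y) e).val x = 0

end LieGroupoid

end

open scoped Topology
set_option linter.unusedSectionVars false

/-! Everything rests on computing brackets modulo $\mathcal H$. If $Z$ is $f$-related to $A$ and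
$df(W_q)=V_{f(q)}$, then $[V,A]_{f(q)}-df[W,Z]_q$ is the derivative along $Z$ of the defect
$df\,W-V\circ f$. When $V$ is tangent to $\mathcal H$ and $df\,W$ is so along a curve tangent to
$Z$, the defect lies in $\mathcal H$ along that curve and vanishes at $q$, hence so does the
difference of brackets (`TangentDistribution.mlieBracket_sub_mem`). With $f=\mathrm{id}$ this says
that $[V,A]_x$ mod $\mathcal H$ depends only on $V_x$, so $D$ does not depend on the lift. Lifts
exist because right translation identifies the kernels of $ds|_{\mathcal H}$, which makes
$ds|_{\mathcal H}$ surjective at every arrow.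

Applied to the multiplication, the same principle gives the key formula
`mlieBracket_rightInv_sub_rightTrans_mem`: for $V$ tangent to $\mathcal H$ with $dt(V_g)=Y_{t(g)}$,
the bracket $[V,\alpha^r]_g$ is, modulo $\mathcal H$, the right translate of $D_Y\alpha(t(g))$. Thus
$D$, defined at the units only, controls the brackets with right-invariant fields on all of $G$.

The operator satisfies $D_X(\alpha+f\beta)=D_X\alpha+X(f)[\beta]+fD_X\beta$, so it descends to a
connection on $E$ when it kills $\mathfrak g$. If $\mathcal H$ is involutive, then $\partial_D=0$
because lifts and right-invariant fields of sections of $\mathfrak g$ are tangent to $\mathcal H$;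
flatness is the Jacobi identity for two lifts and $\alpha^r$, the bracket of lifts being again a
lift.

Conversely, $\partial_D=0$ gives involutivity at the units, where $\mathcal H$ is spanned by values
of lifts, whose brackets are $du[X,Y]$, and by right-invariant fields from $\mathfrak g$
(`mlieBracket_mem_unit`). To leave the units, take a local frame of $t$-projectable fields $V_i$ of
$\mathcal H$ and $t$-vertical fields $Q_b$, and let $c_{ij}^b$ be the $Q_b$-component of
$[V_i,V_j]$. The Jacobi identity for $V_i,V_j,\beta^r$, together with flatness, expresses
$\beta^r(c_{ij}^b)$ linearly in the $c$'s (`AdaptedFrame.exists_mvfderiv_curv_eq`). As the $\beta^r$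
span $\ker ds$, a Grönwall argument shows that vanishing of the curvature is a locally constant
property along source fibres. These are connected and contain units, so the curvature vanishes
everywhere. -/

theorem two_le_infty : (2 : WithTop ℕ∞) ≤ ∞ :=
  WithTop.coe_le_coe.mpr (le_top : (2 : ℕ∞) ≤ ⊤)

/-! ### Derivatives along vector fields and the bracket as a commutator. -/

section FieldCalculus

variable {E : Type*} [NormedAddCommGroup E] [NormedSpace ℝ E]
  {H : Type*} [TopologicalSpace H] {I : ModelWithCorners ℝ E H}
  {M : Type*} [TopologicalSpace M] [ChartedSpace H M]
  {E' : Type*} [NormedAddCommGroup E'] [NormedSpace ℝ E']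
  {H' : Type*} [TopologicalSpace H'] {I' : ModelWithCorners ℝ E' H'}
  {M' : Type*} [TopologicalSpace M'] [ChartedSpace H' M']
  {F : Type*} [NormedAddCommGroup F] [NormedSpace ℝ F]
  {K : Type*} [TopologicalSpace K] {J : ModelWithCorners ℝ F K}
  {N : Type*} [TopologicalSpace N] [ChartedSpace K N]

/-- Partial derivatives of a smooth map, applied to a smooth field along a smooth map, are
smooth. -/
theorem ContMDiffAt.mfderiv_apply_section [IsManifold I ∞ M] [IsManifold I' ∞ M']
    [IsManifold J ∞ N] {f : N → M → M'} {g : N → M} {v : ∀ x, TangentSpace I (g x)} {x₀ : N}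
    (hf : ContMDiffAt (J.prod I) I' ∞ (Function.uncurry f) (x₀, g x₀))
    (hv : ContMDiffAt J I.tangent ∞ (fun x => (⟨g x, v x⟩ : TangentBundle I M)) x₀) :
    ContMDiffAt J I'.tangent ∞
      (fun x => (⟨f x (g x), mfderiv I I' (f x) (g x) (v x)⟩ : TangentBundle I' M')) x₀ := by
  have : IsManifold J 1 N := IsManifold.of_le (n := ∞) (by simp)
  have : IsManifold I 1 M := IsManifold.of_le (n := ∞) (by simp)
  have : IsManifold I' 1 M' := IsManifold.of_le (n := ∞) (by simp)
  have hg : ContMDiffAt J I ∞ g x₀ := (Bundle.contMDiffAt_totalSpace.1 hv).1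
  have h1 := ContMDiffAt.mfderiv (m := ∞) (n := ∞) f g hf hg (by simp)
  exact ContMDiffAt.clm_apply_of_inCoordinates h1 hv
    (hf.comp x₀ (contMDiffAt_id.prodMk hg))

theorem ContMDiffAt.mfderiv_apply_field [IsManifold I ∞ M] [IsManifold I' ∞ M']
    [IsManifold J ∞ N] {f : M → M'} {g : N → M} {v : ∀ x, TangentSpace I (g x)} {x₀ : N}
    (hf : ContMDiffAt I I' ∞ f (g x₀))
    (hv : ContMDiffAt J I.tangent ∞ (fun x => (⟨g x, v x⟩ : TangentBundle I M)) x₀) :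
    ContMDiffAt J I'.tangent ∞
      (fun x => (⟨f (g x), mfderiv I I' f (g x) (v x)⟩ : TangentBundle I' M')) x₀ :=
  ContMDiffAt.mfderiv_apply_section (f := fun _ => f)
    (ContMDiffAt.comp (x₀, g x₀) hf contMDiffAt_snd) hv

theorem ContMDiffAt.mvfderiv_apply_field [IsManifold I ∞ M]
    [IsManifold J ∞ N] {f : M → E'} {g : N → M} {v : ∀ x, TangentSpace I (g x)} {x₀ : N}
    (hf : ContMDiffAt I 𝓘(ℝ, E') ∞ f (g x₀))
    (hv : ContMDiffAt J I.tangent ∞ (fun x => (⟨g x, v x⟩ : TangentBundle I M)) x₀) :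
    ContMDiffAt J 𝓘(ℝ, E') ∞ (fun x => mvfderiv I f (g x) (v x)) x₀ :=
  (contMDiff_snd_tangentBundle_modelSpace E' 𝓘(ℝ, E')).contMDiffAt.comp x₀
    (ContMDiffAt.mfderiv_apply_field hf hv)

/-- Read in the chart at `x`, this is the symmetry of the second derivative of `f`. Allowing vector
values lets `f` be a chart, so that the bracket itself is recovered from the formula. -/
theorem mvfderiv_mlieBracket_apply [CompleteSpace E] [I.Boundaryless] [IsManifold I ∞ M]
    {f : M → F} {V W : ∀ x : M, TangentSpace I x} {x : M}
    (hf : ContMDiffAt I 𝓘(ℝ, F) ∞ f x)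
    (hV : ContMDiffAt I I.tangent ∞ (fun x => (⟨x, V x⟩ : TangentBundle I M)) x)
    (hW : ContMDiffAt I I.tangent ∞ (fun x => (⟨x, W x⟩ : TangentBundle I M)) x) :
    mvfderiv I f x (mlieBracket I V W x) =
      mvfderiv I (fun y => mvfderiv I f y (W y)) x (V x) -
        mvfderiv I (fun y => mvfderiv I f y (V y)) x (W x) := by
  have : IsManifold I 1 M := IsManifold.of_le (n := ∞) (by simp)
  have : IsManifold I 2 M := IsManifold.of_le (n := ∞) two_le_infty
  set φ := extChartAt I x with hφ
  set g : E → F := f ∘ φ.symm with hg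
  have hxφ : φ.symm (φ x) = x := extChartAt_to_inv x
  have hgs : ContDiffAt ℝ ∞ g (φ x) := by
    rw [← contMDiffAt_iff_contDiffAt]
    have h2 : ContMDiffAt 𝓘(ℝ, E) I ∞ φ.symm (φ x) := by
      have := contMDiffOn_extChartAt_symm (I := I) (n := ∞) x
      exact this.contMDiffAt (extChartAt_target_mem_nhds x)
    exact ContMDiffAt.comp (φ x) (by rw [hxφ]; exact hf) h2
  have key : ∀ U : (∀ x : M, TangentSpace I x),
      ContMDiffAt I I.tangent ∞ (fun x => (⟨x, U x⟩ : TangentBundle I M)) x →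
      DifferentiableAt ℝ (mpullbackWithin 𝓘(ℝ, E) I φ.symm U (range I)) (φ x) ∧
      mpullbackWithin 𝓘(ℝ, E) I φ.symm U (range I) (φ x) = U x ∧
      (fun y => mvfderiv I f y (U y)) =ᶠ[𝓝 x]
        (fun z => fderiv ℝ g z (mpullbackWithin 𝓘(ℝ, E) I φ.symm U (range I) z)) ∘ φ := by
    intro U hU
    have hb : mpullbackWithin 𝓘(ℝ, E) I φ.symm U (range I) (φ x) = U x := by
      have h1 : (mfderivWithin 𝓘(ℝ, E) I φ.symm (range I) (φ x)) = ContinuousLinearMap.id ℝ E :=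
        mfderivWithin_range_extChartAt_symm
      have h2 : (U (φ.symm (φ x)) : E) = U x := by rw [hxφ]
      change (mfderivWithin 𝓘(ℝ, E) I φ.symm (range I) (φ x)).inverse (U (φ.symm (φ x))) = U x
      erw [h1, ContinuousLinearMap.inverse_id]
      exact h2
    refine ⟨?_, hb, ?_⟩
    · have := MDifferentiableWithinAt.differentiableWithinAt_mpullbackWithin_vectorField
        (I := I) (V := U) (s := univ) (x := x)
        (hU.mdifferentiableAt (by simp)).mdifferentiableWithinAt
      rw [I.range_eq_univ, preimage_univ, univ_inter] at this
      rw [I.range_eq_univ]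
      exact differentiableWithinAt_univ.1 this
    · have hf1 : ContMDiffAt I 𝓘(ℝ, F) 1 f x := hf.of_le (by simp)
      have hg1 : ContDiffAt ℝ 1 g (φ x) := hgs.of_le (by simp)
      have hg2 := (continuousAt_extChartAt (I := I) x).eventually (hg1.eventually (by simp))
      filter_upwards [extChartAt_source_mem_nhds (I := I) x,
        (contMDiffAt_iff_contMDiffAt_nhds (by simp)).1 hf1, hg2]
        with y hy hfy hgy
      have hyφ : φ.symm (φ y) = y := φ.left_inv hy
      have hyc : y ∈ (chartAt H x).source := by simpa using hy
      have hφy : MDifferentiableAt I 𝓘(ℝ, E) φ y := mdifferentiableAt_extChartAt hyc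
      have e1 : f =ᶠ[𝓝 y] g ∘ φ := by
        filter_upwards [(isOpen_extChartAt_source (I := I) x).mem_nhds hy] with z hz
        change f z = f (φ.symm (φ z))
        rw [φ.left_inv hz]
      have e2 : mpullbackWithin 𝓘(ℝ, E) I φ.symm U (range I) (φ y) =
          mfderiv I 𝓘(ℝ, E) φ y (U y) := by
        have h1 := mfderivWithin_extChartAt_symm_comp_mfderiv_extChartAt' (I := I) hy
        have h2 := mfderiv_extChartAt_comp_mfderivWithin_extChartAt_symm' (I := I) hy
        have h3 : (mfderivWithin 𝓘(ℝ, E) I φ.symm (range I) (φ y)).inverse =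
            mfderiv I 𝓘(ℝ, E) φ y := ContinuousLinearMap.inverse_eq h1 h2
        have h4 : (U (φ.symm (φ y)) : E) = U y := by rw [hyφ]
        change (mfderivWithin 𝓘(ℝ, E) I φ.symm (range I) (φ y)).inverse (U (φ.symm (φ y))) = _
        erw [h3, h4]
        rfl
      have e3 : mfderiv I 𝓘(ℝ, F) f y = (fderiv ℝ g (φ y)).comp (mfderiv I 𝓘(ℝ, E) φ y) := by
        rw [e1.mfderiv_eq]
        erw [mfderiv_comp y ((hgy.differentiableAt (by simp)).mdifferentiableAt) hφy]
        rw [mfderiv_eq_fderiv]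
        rfl
      change mfderiv I 𝓘(ℝ, F) f y (U y) = fderiv ℝ g (φ y) _
      rw [e2, e3]
      rfl
  have cg : ∀ a b : M → F, a =ᶠ[𝓝 x] b → mvfderiv I a x = mvfderiv I b x := by
    intro a b h
    ext v
    change (mfderiv I 𝓘(ℝ, F) a x v : F) = mfderiv I 𝓘(ℝ, F) b x v
    rw [h.mfderiv_eq]
    rfl
  have comp : ∀ h : E → F, DifferentiableAt ℝ h (φ x) →
      mvfderiv I (h ∘ φ) x = fderiv ℝ h (φ x) := by
    intro h hh
    ext v
    change (mfderiv I 𝓘(ℝ, F) (h ∘ φ) x v : F) = _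
    rw [mfderiv_comp x hh.mdifferentiableAt (mdifferentiableAt_extChartAt (mem_chart_source H x)),
      mfderiv_extChartAt_self, mfderiv_eq_fderiv]
    rfl
  have hfx : mvfderiv I f x = fderiv ℝ g (φ x) := by
    rw [← comp g (hgs.differentiableAt (by simp))]
    apply cg
    filter_upwards [extChartAt_source_mem_nhds (I := I) x] with z hz
    change f z = f (φ.symm (φ z))
    rw [φ.left_inv hz]
  have hd : DifferentiableAt ℝ (fderiv ℝ g) (φ x) :=
    (hgs.fderiv_right (m := 1) (by rw [one_add_one_eq_two]; exact two_le_infty)).differentiableAt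
      (by simp)
  have hsymm : IsSymmSndFDerivAt ℝ g (φ x) := hgs.isSymmSndFDerivAt (by simpa using two_le_infty)
  have hbr : mlieBracket I V W x =
      lieBracket ℝ (mpullbackWithin 𝓘(ℝ, E) I φ.symm V (range I))
        (mpullbackWithin 𝓘(ℝ, E) I φ.symm W (range I)) (φ x) := by
    rw [← mlieBracketWithin_univ, mlieBracketWithin_apply, mfderiv_extChartAt_self,
      preimage_univ, univ_inter]
    erw [ContinuousLinearMap.inverse_id]
    change lieBracketWithin ℝ (mpullbackWithin 𝓘(ℝ, E) I φ.symm V (range I))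
      (mpullbackWithin 𝓘(ℝ, E) I φ.symm W (range I)) (range I) (φ x) = _
    rw [I.range_eq_univ]
    exact congrFun (lieBracketWithin_univ (𝕜 := ℝ) (V := mpullbackWithin 𝓘(ℝ, E) I φ.symm V univ)
      (W := mpullbackWithin 𝓘(ℝ, E) I φ.symm W univ)) (φ x)
  have alg : ∀ V' W' : E → E, DifferentiableAt ℝ V' (φ x) → DifferentiableAt ℝ W' (φ x) →
      fderiv ℝ g (φ x) (lieBracket ℝ V' W' (φ x)) =
        fderiv ℝ (fun z => fderiv ℝ g z (W' z)) (φ x) (V' (φ x)) -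
          fderiv ℝ (fun z => fderiv ℝ g z (V' z)) (φ x) (W' (φ x)) := by
    intro V' W' dV dW
    have := hsymm.eq (V' (φ x)) (W' (φ x))
    rw [fderiv_clm_apply hd dW, fderiv_clm_apply hd dV]
    simp only [lieBracket, map_sub, _root_.add_apply, ContinuousLinearMap.comp_apply,
      ContinuousLinearMap.flip_apply, this]
    abel
  obtain ⟨dV, vV, kV⟩ := key V hV
  obtain ⟨dW, vW, kW⟩ := key W hW
  have cV := comp _ (hd.clm_apply dV)
  have cW := comp _ (hd.clm_apply dW)
  have := alg _ _ dV dW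
  rw [cg _ _ kV, cg _ _ kW, hbr, hfx]
  erw [cV, cW, this]
  erw [vV, vW]
  rfl

end FieldCalculus

/-! ### Brackets of (approximately) related fields, and dual coframes. -/

section RelatedFields

variable {E : Type*} [NormedAddCommGroup E] [NormedSpace ℝ E] [CompleteSpace E]
  {H : Type*} [TopologicalSpace H] {I : ModelWithCorners ℝ E H} [I.Boundaryless]
  {M : Type*} [TopologicalSpace M] [ChartedSpace H M] [IsManifold I ∞ M]
  {E' : Type*} [NormedAddCommGroup E'] [NormedSpace ℝ E'] [CompleteSpace E']
  {H' : Type*} [TopologicalSpace H'] {I' : ModelWithCorners ℝ E' H'} [I'.Boundaryless]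
  {M' : Type*} [TopologicalSpace M'] [ChartedSpace H' M'] [IsManifold I' ∞ M']

theorem mvfderiv_congr_nhds {F : Type*} [NormedAddCommGroup F] [NormedSpace ℝ F] {x : M}
    {a b : M → F} (h : a =ᶠ[𝓝 x] b) : mvfderiv I a x = mvfderiv I b x := by
  ext v
  change (mfderiv I 𝓘(ℝ, F) a x v : F) = mfderiv I 𝓘(ℝ, F) b x v
  rw [h.mfderiv_eq]
  rfl

theorem mvfderiv_comp_apply_vector {F : Type*} [NormedAddCommGroup F] [NormedSpace ℝ F]
    {g : M' → F} {f : M → M'} {x : M} (hg : MDifferentiableAt I' 𝓘(ℝ, F) g (f x))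
    (hf : MDifferentiableAt I I' f x) (v : TangentSpace I x) :
    mvfderiv I (g ∘ f) x v = mvfderiv I' g (f x) (mfderiv I I' f x v) := by
  change (mfderiv I 𝓘(ℝ, F) (g ∘ f) x v : F) = mfderiv I' 𝓘(ℝ, F) g (f x) (mfderiv I I' f x v)
  rw [mfderiv_comp x hg hf]
  rfl

theorem ContMDiffAt.mvfderiv_apply_vectorField {F : Type*} [NormedAddCommGroup F]
    [NormedSpace ℝ F] {f : M → F} {V : ∀ x : M, TangentSpace I x} {x : M}
    (hf : ContMDiffAt I 𝓘(ℝ, F) ∞ f x)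
    (hV : ContMDiffAt I I.tangent ∞ (fun x => (⟨x, V x⟩ : TangentBundle I M)) x) :
    ContMDiffAt I 𝓘(ℝ, F) ∞ (fun y => mvfderiv I f y (V y)) x :=
  ContMDiffAt.mvfderiv_apply_field (g := fun y => y) hf hV

theorem ContMDiffAt.eventually_mdifferentiableAt {f : M → M'} {x : M}
    (hf : ContMDiffAt I I' ∞ f x) : ∀ᶠ y in 𝓝 x, MDifferentiableAt I I' f y := by
  have : IsManifold I 1 M := IsManifold.of_le (n := ∞) (by simp)
  have : IsManifold I' 1 M' := IsManifold.of_le (n := ∞) (by simp)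
  filter_upwards [(contMDiffAt_iff_contMDiffAt_nhds (by simp)).1 (hf.of_le (m := 1) (by simp))]
    with y hy using hy.mdifferentiableAt (by simp)

/-- If `Z` is `f`-related to `A` and `df (W q) = V (f q)`, the defect of `f`-relatedness of the
brackets at `q` is the derivative along `Z` of the defect of `f`-relatedness of `W` and `V`. -/
theorem mlieBracket_sub_mfderiv_mlieBracket {f : M → M'} {q : M}
    {V A : ∀ y : M', TangentSpace I' y} {W Z : ∀ x : M, TangentSpace I x}
    (hf : ContMDiffAt I I' ∞ f q)
    (hV : ContMDiffAt I' I'.tangent ∞ (fun x => (⟨x, V x⟩ : TangentBundle I' M')) (f q))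
    (hA : ContMDiffAt I' I'.tangent ∞ (fun x => (⟨x, A x⟩ : TangentBundle I' M')) (f q))
    (hW : ContMDiffAt I I.tangent ∞ (fun x => (⟨x, W x⟩ : TangentBundle I M)) q)
    (hZ : ContMDiffAt I I.tangent ∞ (fun x => (⟨x, Z x⟩ : TangentBundle I M)) q)
    (hZA : ∀ᶠ x in 𝓝 q, mfderiv I I' f x (Z x) = A (f x))
    (hWV : mfderiv I I' f q (W q) = V (f q)) :
    (mlieBracket I' V A (f q) - mfderiv I I' f q (mlieBracket I W Z q) : E') =
      mvfderiv I (fun x => mvfderiv I' (extChartAt I' (f q)) (f x)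
        (mfderiv I I' f x (W x) - V (f x))) q (Z q) := by
  have : IsManifold I 1 M := IsManifold.of_le (n := ∞) (by simp)
  have : IsManifold I' 1 M' := IsManifold.of_le (n := ∞) (by simp)
  set ψ := extChartAt I' (f q) with hψ
  have hψs : ContMDiffAt I' 𝓘(ℝ, E') ∞ ψ (f q) := contMDiffAt_extChartAt
  have hψd : mvfderiv I' ψ (f q) = ContinuousLinearMap.id ℝ E' := by
    have := mfderiv_extChartAt_self (I := I') (x := f q)
    ext v
    change (mfderiv I' 𝓘(ℝ, E') ψ (f q) v : E') = v
    rw [this]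
    rfl
  have hψf : ContMDiffAt I 𝓘(ℝ, E') ∞ (ψ ∘ f) q := hψs.comp q hf
  have hdψ : ∀ᶠ x in 𝓝 q, ∀ v : TangentSpace I x,
      mvfderiv I (ψ ∘ f) x v = mvfderiv I' ψ (f x) (mfderiv I I' f x v) := by
    filter_upwards [hf.eventually_mdifferentiableAt,
      hf.continuousAt.eventually hψs.eventually_mdifferentiableAt] with x h1 h2 v
    exact mvfderiv_comp_apply_vector h2 h1 v
  have b1 := mvfderiv_mlieBracket_apply hψs hV hA
  have b2 := mvfderiv_mlieBracket_apply hψf hW hZ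
  have dA : MDifferentiableAt I' 𝓘(ℝ, E') (fun y => mvfderiv I' ψ y (A y)) (f q) :=
    (ContMDiffAt.mvfderiv_apply_vectorField hψs hA).mdifferentiableAt (by simp)
  have dV : MDifferentiableAt I' 𝓘(ℝ, E') (fun y => mvfderiv I' ψ y (V y)) (f q) :=
    (ContMDiffAt.mvfderiv_apply_vectorField hψs hV).mdifferentiableAt (by simp)
  have dW : MDifferentiableAt I 𝓘(ℝ, E') (fun y => mvfderiv I (ψ ∘ f) y (W y)) q :=
    (ContMDiffAt.mvfderiv_apply_vectorField hψf hW).mdifferentiableAt (by simp)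
  have hfq : MDifferentiableAt I I' f q := hf.mdifferentiableAt (by simp)
  -- The commutator formula is applied to the chart `ψ` at `f q` and to `ψ ∘ f` at `q`. The terms
  -- that differentiate `A` and `Z` agree, because `Z` is related to `A` near `q` and `W q` maps to
  -- `V (f q)`; only the terms that differentiate `V` and `W` survive.
  have cA : mvfderiv I (fun x => mvfderiv I (ψ ∘ f) x (Z x)) q (W q) =
      mvfderiv I' (fun y => mvfderiv I' ψ y (A y)) (f q) (V (f q)) := by
    rw [← hWV, ← mvfderiv_comp_apply_vector dA hfq]
    congr 1
    apply mvfderiv_congr_nhds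
    filter_upwards [hdψ, hZA] with x h1 h2
    rw [h1, h2]
    rfl
  have cV : mvfderiv I ((fun y => mvfderiv I' ψ y (V y)) ∘ f) q (Z q) =
      mvfderiv I' (fun y => mvfderiv I' ψ y (V y)) (f q) (A (f q)) := by
    rw [← hZA.self_of_nhds, ← mvfderiv_comp_apply_vector dV hfq]
  have hR : mvfderiv I (fun x => mvfderiv I' ψ (f x) (mfderiv I I' f x (W x) - V (f x))) q =
      mvfderiv I (fun x => mvfderiv I (ψ ∘ f) x (W x)) q -
        mvfderiv I ((fun y => mvfderiv I' ψ y (V y)) ∘ f) q := by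
    rw [← mvfderiv_sub dW (dV.comp q hfq)]
    apply mvfderiv_congr_nhds
    filter_upwards [hdψ] with x h1
    rw [map_sub, ← h1]
    rfl
  rw [hR]
  rw [hdψ.self_of_nhds] at b2
  rw [hψd] at b1 b2
  have e1 : (mlieBracket I' V A (f q) : E') = _ := b1
  have e2 : (mfderiv I I' f q (mlieBracket I W Z q) : E') = _ := b2
  erw [e1, e2, cA, ← cV]
  rw [_root_.sub_apply]
  abel

/-- Brackets of related fields are related. -/
theorem mfderiv_mlieBracket_of_related {f : M → M'} {q : M}
    {V A : ∀ y : M', TangentSpace I' y} {W Z : ∀ x : M, TangentSpace I x}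
    (hf : ContMDiffAt I I' ∞ f q)
    (hV : ContMDiffAt I' I'.tangent ∞ (fun x => (⟨x, V x⟩ : TangentBundle I' M')) (f q))
    (hA : ContMDiffAt I' I'.tangent ∞ (fun x => (⟨x, A x⟩ : TangentBundle I' M')) (f q))
    (hW : ContMDiffAt I I.tangent ∞ (fun x => (⟨x, W x⟩ : TangentBundle I M)) q)
    (hZ : ContMDiffAt I I.tangent ∞ (fun x => (⟨x, Z x⟩ : TangentBundle I M)) q)
    (hWV : ∀ᶠ x in 𝓝 q, mfderiv I I' f x (W x) = V (f x))
    (hZA : ∀ᶠ x in 𝓝 q, mfderiv I I' f x (Z x) = A (f x)) :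
    mfderiv I I' f q (mlieBracket I W Z q) = mlieBracket I' V A (f q) := by
  have h := mlieBracket_sub_mfderiv_mlieBracket hf hV hA hW hZ hZA hWV.self_of_nhds
  have h0 : (fun x => mvfderiv I' (extChartAt I' (f q)) (f x)
        (mfderiv I I' f x (W x) - V (f x))) =ᶠ[𝓝 q] fun _ => (0 : E') := by
    filter_upwards [hWV] with x hx
    rw [hx, sub_self, map_zero]
  rw [mvfderiv_congr_nhds h0, mvfderiv_const] at h
  exact (sub_eq_zero.1 (h.trans rfl)).symm

/-- Version of relatedness of brackets modulo the kernel of a continuous family `θ` of linear maps,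
read in the chart at `f q`; the field `W` only needs to be related to `V` modulo `ker θ` along a
curve tangent to `Z`. -/
theorem apply_mlieBracket_sub_eq_zero {G : Type*} [NormedAddCommGroup G] [NormedSpace ℝ G]
    {f : M → M'} {q : M}
    {V A : ∀ y : M', TangentSpace I' y} {W Z : ∀ x : M, TangentSpace I x}
    (hf : ContMDiffAt I I' ∞ f q)
    (hV : ContMDiffAt I' I'.tangent ∞ (fun x => (⟨x, V x⟩ : TangentBundle I' M')) (f q))
    (hA : ContMDiffAt I' I'.tangent ∞ (fun x => (⟨x, A x⟩ : TangentBundle I' M')) (f q))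
    (hW : ContMDiffAt I I.tangent ∞ (fun x => (⟨x, W x⟩ : TangentBundle I M)) q)
    (hZ : ContMDiffAt I I.tangent ∞ (fun x => (⟨x, Z x⟩ : TangentBundle I M)) q)
    (hZA : ∀ᶠ x in 𝓝 q, mfderiv I I' f x (Z x) = A (f x))
    (hWV : mfderiv I I' f q (W q) = V (f q))
    {c : ℝ → M} {c' : ℝ →L[ℝ] TangentSpace I (c 0)} (hc : HasMFDerivAt 𝓘(ℝ, ℝ) I c 0 c')
    (hc0 : c 0 = q) (hc1 : (c' 1 : E) = Z q)
    {θ : M' → E' →L[ℝ] G} (hθ : ContinuousAt θ (f q))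
    (h0 : ∀ᶠ t in 𝓝 (0 : ℝ), θ (f (c t)) (mvfderiv I' (extChartAt I' (f q)) (f (c t))
        (mfderiv I I' f (c t) (W (c t)) - V (f (c t)))) = 0) :
    θ (f q) (mlieBracket I' V A (f q) - mfderiv I I' f q (mlieBracket I W Z q) : E') = 0 := by
  subst hc0
  rw [mlieBracket_sub_mfderiv_mlieBracket hf hV hA hW hZ hZA hWV]
  set w : M → E' := fun x => mvfderiv I' (extChartAt I' (f (c 0))) (f x)
        (mfderiv I I' f x (W x) - V (f x)) with hw
  have hwd : MDifferentiableAt I 𝓘(ℝ, E') w (c 0) := by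
    have hψs : ContMDiffAt I' 𝓘(ℝ, E') ∞ (extChartAt I' (f (c 0))) (f (c 0)) := by
      have : IsManifold I' 1 M' := IsManifold.of_le (n := ∞) (by simp)
      exact contMDiffAt_extChartAt
    have h1 := ContMDiffAt.mvfderiv_apply_vectorField (hψs.comp (c 0) hf) hW
    have h2 := (ContMDiffAt.mvfderiv_apply_vectorField hψs hV).comp (c 0) hf
    refine ((h1.sub h2).congr_of_eventuallyEq ?_).mdifferentiableAt (by simp)
    filter_upwards [hf.eventually_mdifferentiableAt,
      hf.continuousAt.eventually hψs.eventually_mdifferentiableAt] with x h3 h4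
    simp only [hw, map_sub]
    rw [← mvfderiv_comp_apply_vector h4 h3]
    rfl
  have hw0 : w (c 0) = 0 := by
    simp only [hw]
    rw [hWV, sub_self, map_zero]
  have hd : HasDerivAt (w ∘ c) (mvfderiv I w (c 0) (Z (c 0))) 0 := by
    obtain ⟨L, hL, h1⟩ : ∃ L : ℝ →L[ℝ] E', L 1 = mvfderiv I w (c 0) (Z (c 0)) ∧
        HasFDerivAt (w ∘ c) L 0 := by
      refine ⟨(mfderiv I 𝓘(ℝ, E') w (c 0)) ∘L c', ?_,
        (hwd.hasMFDerivAt.comp 0 hc).hasFDerivAt⟩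
      rw [← hc1]
      rfl
    exact hL ▸ h1.hasDerivAt
  -- The difference quotients of the defect along the curve are killed by `θ (f (c t))`. Passing to
  -- the limit uses continuity of `θ` only, since the defect vanishes at `t = 0` and no derivative
  -- of `θ` appears.
  have hl := hd.tendsto_slope_zero
  have hcc : Filter.Tendsto (fun t => f (c t)) (𝓝[≠] 0) (𝓝 (f (c 0))) :=
    (hf.continuousAt.comp_of_eq hc.continuousAt rfl).mono_left nhdsWithin_le_nhds
  have hlim := (isBoundedBilinearMap_apply (𝕜 := ℝ)).continuous.continuousAt.tendsto.comp
    ((hθ.tendsto.comp hcc).prodMk_nhds hl)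
  refine tendsto_nhds_unique hlim (tendsto_const_nhds.congr' ?_)
  filter_upwards [h0.filter_mono nhdsWithin_le_nhds] with t ht
  simp only [Function.comp_apply, zero_add, map_smul, map_sub]
  rw [hw0, map_zero, sub_zero]
  simp only [hw]
  rw [ht, smul_zero]

/-- Smooth fields which form a basis of the tangent space at `x₀` have a smooth dual coframe near
`x₀`, here read in the chart at `x₀`. -/
theorem exists_dual_coframe [FiniteDimensional ℝ E] {ι : Type*} [Fintype ι] [DecidableEq ι]
    {Z : ι → ∀ x : M, TangentSpace I x} {x₀ : M}
    (hZ : ∀ i, ∀ᶠ x in 𝓝 x₀,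
      ContMDiffAt I I.tangent ∞ (fun x => (⟨x, Z i x⟩ : TangentBundle I M)) x)
    (hli : LinearIndependent ℝ (fun i => (Z i x₀ : E)))
    (hcard : Fintype.card ι = Module.finrank ℝ E) :
    ∃ θ : M → E →L[ℝ] (ι → ℝ), ∀ᶠ x in 𝓝 x₀,
      ContMDiffAt I 𝓘(ℝ, E →L[ℝ] (ι → ℝ)) ∞ θ x ∧
      (∀ i, θ x (mvfderiv I (extChartAt I x₀) x (Z i x)) = Pi.single i 1) ∧
      ∀ v : TangentSpace I x, v = ∑ i, θ x (mvfderiv I (extChartAt I x₀) x v) i • Z i x := by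
  have : IsManifold I 1 M := IsManifold.of_le (n := ∞) (by simp)
  set ψ := extChartAt I x₀ with hψ
  -- The coframe is the inverse of the matrix of the frame, read in the chart at `x₀`.
  set Φ : M → (ι → ℝ) →L[ℝ] E := fun x =>
    ∑ i, (ContinuousLinearMap.proj (R := ℝ) (φ := fun _ : ι => ℝ) i).smulRight
      (mvfderiv I ψ x (Z i x)) with hΦ
  have hΦa : ∀ x (a : ι → ℝ), Φ x a = ∑ i, a i • mvfderiv I ψ x (Z i x) := by
    intro x a
    simp [hΦ]
  have hψd : mvfderiv I ψ x₀ = ContinuousLinearMap.id ℝ E := by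
    have := mfderiv_extChartAt_self (I := I) (x := x₀)
    ext v
    change (mfderiv I 𝓘(ℝ, E) ψ x₀ v : E) = v
    rw [this]
    rfl
  have hinj : Function.Injective (Φ x₀) := by
    rw [injective_iff_map_eq_zero]
    intro a ha
    rw [hΦa, hψd] at ha
    exact funext (Fintype.linearIndependent_iff.1 hli a ha)
  let e : (ι → ℝ) ≃L[ℝ] E := (LinearEquiv.ofInjectiveOfFinrankEq (Φ x₀).toLinearMap hinj
    (by rw [Module.finrank_fintype_fun_eq_card, hcard])).toContinuousLinearEquiv
  have he : (e : (ι → ℝ) →L[ℝ] E) = Φ x₀ := by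
    ext; rfl
  have hsrc : ∀ᶠ x in 𝓝 x₀, x ∈ (extChartAt I x₀).source := extChartAt_source_mem_nhds x₀
  have hΦs : ∀ᶠ x in 𝓝 x₀, ContMDiffAt I 𝓘(ℝ, (ι → ℝ) →L[ℝ] E) ∞ Φ x := by
    filter_upwards [Filter.eventually_all.2 hZ, hsrc] with x hx hs
    have hψs : ContMDiffAt I 𝓘(ℝ, E) ∞ ψ x := contMDiffAt_extChartAt' (by simpa using hs)
    have : ∀ i, ContMDiffAt I 𝓘(ℝ, E) ∞ (fun y => mvfderiv I ψ y (Z i y)) x := fun i =>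
      ContMDiffAt.mvfderiv_apply_vectorField hψs (hx i)
    refine ContMDiffAt.sum fun i _ => ?_
    exact ((ContinuousLinearMap.smulRightL ℝ (ι → ℝ) E
      (ContinuousLinearMap.proj (R := ℝ) (φ := fun _ : ι => ℝ)
        i)).contDiff.contMDiff.contMDiffAt).comp
        x (this i)
  -- `inverse` is the default value `0` where `Φ x` is not invertible; invertibility is an open
  -- condition, so this does not happen near `x₀`.
  refine ⟨fun x => (Φ x).inverse, ?_⟩
  have hnear : ∀ᶠ x in 𝓝 x₀, ∃ e' : (ι → ℝ) ≃L[ℝ] E, (e' : (ι → ℝ) →L[ℝ] E) = Φ x := by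
    have := e.nhds
    rw [he] at this
    exact hΦs.self_of_nhds.continuousAt this
  filter_upwards [hΦs, hnear, hsrc] with x hx ⟨e', he'⟩ hs
  refine ⟨?_, ?_, ?_⟩
  · have := contDiffAt_map_inverse (n := ∞) e'
    rw [he'] at this
    exact this.contMDiffAt.comp x hx
  · intro i
    rw [← he', ContinuousLinearMap.inverse_equiv]
    have : mvfderiv I ψ x (Z i x) = e' (Pi.single i 1) := by
      change _ = (e' : (ι → ℝ) →L[ℝ] E) (Pi.single i 1)
      rw [he', hΦa, Finset.sum_eq_single i]
      · simp
      · intro j _ hj; simp [hj]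
      · simp
    rw [this]
    simp
  · intro v
    have hi : Function.Injective (mvfderiv I ψ x) := by
      have := isInvertible_mfderiv_extChartAt (I := I) hs
      obtain ⟨L, hL⟩ := this
      intro a b hab
      apply L.injective
      change (L : TangentSpace I x →L[ℝ] TangentSpace 𝓘(ℝ, E) (ψ x)) a =
        (L : TangentSpace I x →L[ℝ] TangentSpace 𝓘(ℝ, E) (ψ x)) b
      rw [hL]
      exact hab
    apply hi
    rw [map_sum]
    simp only [map_smul]
    rw [← hΦa, ← he', ContinuousLinearMap.inverse_equiv]
    simp

end RelatedFields

/-! ### Fibre retractions, sections and curves in the fibres of a submersion. -/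

section Submersions

variable {E : Type*} [NormedAddCommGroup E] [NormedSpace ℝ E]
  {H : Type*} [TopologicalSpace H] {I : ModelWithCorners ℝ E H} [I.Boundaryless]
  {M : Type*} [TopologicalSpace M] [ChartedSpace H M] [IsManifold I ∞ M]
  {E' : Type*} [NormedAddCommGroup E'] [NormedSpace ℝ E']
  {H' : Type*} [TopologicalSpace H'] {I' : ModelWithCorners ℝ E' H'} [I'.Boundaryless]
  {M' : Type*} [TopologicalSpace M'] [ChartedSpace H' M'] [IsManifold I' ∞ M']

/-- Near a point, a submersion `f` has a smooth family `B (y, ·)` of maps to the fibres `f = y`,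
such that `B (f x, x) = x`. -/
theorem Manifold.IsSubmersionAt.exists_fiber_retraction {f : M → M'} {x₀ : M}
    (hf : IsSubmersionAt I I' ∞ f x₀) :
    ∃ B : M' × M → M, (∀ᶠ q in 𝓝 (f x₀, x₀), ContMDiffAt (I'.prod I) I ∞ B q) ∧
      (∀ᶠ q in 𝓝 (f x₀, x₀), f (B q) = q.1) ∧ ∀ᶠ x in 𝓝 x₀, B (f x, x) = x := by
  set φ := hf.domChart.extend I with hφ
  set ψ := hf.codChart.extend I' with hψ
  set e := hf.equiv with he
  have hw := hf.writtenInCharts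
  have hfc : ContinuousAt f x₀ := hf.contMDiffAt.continuousAt
  have hφo : IsOpen φ.target := hf.domChart.isOpen_extend_target
  have hx₀ : x₀ ∈ φ.source := by simpa [hφ] using hf.mem_domChart_source
  have hfx₀ : f x₀ ∈ ψ.source := by simpa [hψ] using hf.mem_codChart_source
  have hφs : IsOpen φ.source := hf.domChart.isOpen_extend_source
  have hψs : IsOpen ψ.source := hf.codChart.isOpen_extend_source
  have hval : ∀ x ∈ φ.source, ψ (f x) = (e (φ x)).1 := by
    intro x hx
    have := hw (φ.map_source hx)
    simp only [Function.comp_apply] at this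
    rwa [φ.left_inv hx] at this
  -- In submersion charts `f` is the first projection, so replacing the first coordinate of the
  -- point by that of `q.1` moves it into the fibre over `q.1`.
  set z : M' × M → E := fun q => e.symm (ψ q.1, (e (φ q.2)).2) with hz
  have hzs : ∀ q : M' × M, q.1 ∈ ψ.source → q.2 ∈ φ.source →
      ContMDiffAt (I'.prod I) 𝓘(ℝ, E) ∞ z q := by
    intro q h1 h2
    have hψ1 : ContMDiffAt I' 𝓘(ℝ, E') ∞ ψ q.1 :=
      I'.contMDiff.contMDiffAt.comp q.1
        (contMDiffAt_of_mem_maximalAtlas hf.codChart_mem_maximalAtlas (by simpa [hψ] using h1))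
    have hφ1 : ContMDiffAt I 𝓘(ℝ, E) ∞ φ q.2 :=
      I.contMDiff.contMDiffAt.comp q.2
        (contMDiffAt_of_mem_maximalAtlas hf.domChart_mem_maximalAtlas (by simpa [hφ] using h2))
    have h3 : ContMDiffAt (I'.prod I) 𝓘(ℝ, hf.complement) ∞
        (fun q : M' × M => (e (φ q.2)).2) q := by
      have : ContDiff ℝ ∞ (fun v : E => (e v).2) := by fun_prop
      exact this.contMDiff.contMDiffAt.comp q (hφ1.comp q contMDiffAt_snd)
    have h4 := (hψ1.comp q contMDiffAt_fst).prodMk_space h3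
    exact e.symm.contDiff.contMDiff.contMDiffAt.comp q h4
  have hz0 : z (f x₀, x₀) = φ x₀ := by
    simp only [hz]
    rw [hval x₀ hx₀]
    simp
  have hsrc : ∀ᶠ q in 𝓝 (f x₀, x₀), q.1 ∈ ψ.source ∧ q.2 ∈ φ.source :=
    prod_mem_nhds (hψs.mem_nhds hfx₀) (hφs.mem_nhds hx₀)
  have htgt : ∀ᶠ q in 𝓝 (f x₀, x₀), z q ∈ φ.target := by
    have := (hzs (f x₀, x₀) hfx₀ hx₀).continuousAt.tendsto
    rw [hz0] at this
    exact this.eventually (hφo.mem_nhds (φ.map_source hx₀))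
  refine ⟨fun q => φ.symm (z q), ?_, ?_, ?_⟩
  · filter_upwards [hsrc, htgt] with q h1 h2
    have : ContMDiffAt 𝓘(ℝ, E) I ∞ φ.symm (z q) :=
      (contMDiffOn_extend_symm hf.domChart_mem_maximalAtlas).contMDiffAt
        (by
          have := hφo.mem_nhds h2
          rwa [hφ, hf.domChart.extend_target'] at this)
    exact this.comp q (hzs q h1.1 h1.2)
  · filter_upwards [hsrc, htgt] with q h1 h2
    have h3 := hval _ (φ.map_target h2)
    rw [φ.right_inv h2] at h3
    have h4 : f (φ.symm (z q)) ∈ ψ.source := by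
      have h5 : φ.symm (z q) ∈ hf.domChart.source := by
        have := φ.map_target h2
        rwa [hφ, hf.domChart.extend_source] at this
      have := hf.source_subset_preimage_source h5
      rwa [hψ, hf.codChart.extend_source]
    apply ψ.injOn h4 h1.1
    rw [h3]
    simp [hz]
  · filter_upwards [hφs.mem_nhds hx₀] with x hx
    have : z (f x, x) = φ x := by
      simp only [hz]
      rw [hval x hx]
      simp
    change φ.symm (z (f x, x)) = x
    rw [this, φ.left_inv hx]

/-- Every tangent vector is the velocity of a smooth curve. -/
theorem exists_curve_of_tangent (x : M) (v : TangentSpace I x) :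
    ∃ c : ℝ → M, c 0 = x ∧ ContMDiffAt 𝓘(ℝ, ℝ) I ∞ c 0 ∧
      (mfderiv 𝓘(ℝ, ℝ) I c 0 (1 : ℝ) : E) = v := by
  set φ := extChartAt I x with hφ
  have : IsManifold I 1 M := IsManifold.of_le (n := ∞) (by simp)
  have h0 : ContMDiffAt 𝓘(ℝ, E) I ∞ φ.symm (φ x) :=
    (contMDiffOn_extChartAt_symm (I := I) (n := ∞) x).contMDiffAt (extChartAt_target_mem_nhds x)
  obtain ⟨w, hwv⟩ : ∃ w : E, w = v := ⟨v, rfl⟩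
  set l : ℝ → E := fun t => φ x + t • w with hl
  have hld : HasFDerivAt l (ContinuousLinearMap.toSpanSingleton ℝ w) 0 := by
    have : HasDerivAt l w 0 := by
      have := ((hasDerivAt_id (0 : ℝ)).smul_const w).const_add (φ x)
      rwa [one_smul] at this
    exact this.hasFDerivAt
  have hls : ContMDiffAt 𝓘(ℝ, ℝ) 𝓘(ℝ, E) ∞ l 0 := by
    have : ContDiff ℝ ∞ l := by fun_prop
    exact this.contMDiff.contMDiffAt
  have hl0 : l 0 = φ x := by simp [hl]
  rw [← hl0] at h0
  refine ⟨φ.symm ∘ l, by simp [hφ, hl], h0.comp (0 : ℝ) hls, ?_⟩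
  have h1 : mfderiv 𝓘(ℝ, E) I φ.symm (l 0) = ContinuousLinearMap.id ℝ E := by
    have := mfderivWithin_range_extChartAt_symm (I := I) (x := x)
    rw [I.range_eq_univ, mfderivWithin_univ] at this
    rw [hl0]
    exact this
  rw [mfderiv_comp (0 : ℝ) (h0.mdifferentiableAt (by simp)) (hls.mdifferentiableAt (by simp)),
    hld.hasMFDerivAt.mfderiv, ← hwv]
  change (mfderiv 𝓘(ℝ, E) I φ.symm (l 0)) (ContinuousLinearMap.toSpanSingleton ℝ w 1) = w
  rw [h1]
  simp only [ContinuousLinearMap.toSpanSingleton_apply, one_smul]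
  rfl

/-- The chain rule for `B (f y, y) = y`. For `v` in the kernel of `df` it says that the partial
derivative of `B` along the second factor fixes `v`. -/
theorem mfderiv_fiber_retraction {f : M → M'} {x : M} {B : M' × M → M}
    (hf : MDifferentiableAt I I' f x) (hB : MDifferentiableAt (I'.prod I) I B (f x, x))
    (h : ∀ᶠ y in 𝓝 x, B (f y, y) = y) (v : TangentSpace I x) :
    (mfderiv (I'.prod I) I B (f x, x) ((mfderiv I I' f x v, v) : E' × E) : E) = v := by
  have h1 : mfderiv I I ((B ∘ fun y => (f y, id y))) x = mfderiv I I id x :=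
    Filter.EventuallyEq.mfderiv_eq h
  rw [mfderiv_comp (g := B) (f := fun y => (f y, id y)) x hB (hf.prodMk mdifferentiableAt_id),
    mfderiv_prodMk hf mdifferentiableAt_id,
    mfderiv_id] at h1
  exact congrArg (fun L : E →L[ℝ] E => L v) h1

/-- A vector in the kernel of the differential of a submersion is the velocity of a curve in
the fibre. -/
theorem Manifold.IsSubmersionAt.exists_curve_in_fiber {f : M → M'} {x : M}
    (hf : IsSubmersionAt I I' ∞ f x) {v : TangentSpace I x} (hv : mfderiv I I' f x v = 0) :
    ∃ c : ℝ → M, c 0 = x ∧ ContMDiffAt 𝓘(ℝ, ℝ) I ∞ c 0 ∧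
      (mfderiv 𝓘(ℝ, ℝ) I c 0 (1 : ℝ) : E) = v ∧ ∀ᶠ t in 𝓝 (0 : ℝ), f (c t) = f x := by
  obtain ⟨B, hBs, hBf, hBx⟩ := hf.exists_fiber_retraction
  obtain ⟨c, hc0, hcs, hc1⟩ := exists_curve_of_tangent (I := I) x v
  have hfd : MDifferentiableAt I I' f x := hf.contMDiffAt.mdifferentiableAt (by simp)
  have hBs' : ContMDiffAt (I'.prod I) I ∞ B (f x, c 0) := by rw [hc0]; exact hBs.self_of_nhds
  have hpair : ContMDiffAt 𝓘(ℝ, ℝ) (I'.prod I) ∞ (fun t => (f x, c t)) 0 :=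
    contMDiffAt_const.prodMk hcs
  -- Any curve with velocity `v` is pushed into the fibre; as `df v = 0`, its velocity becomes `dB
  -- (0, v) = dB (df v, v) = v`.
  refine ⟨fun t => B (f x, c t), ?_, hBs'.comp (0 : ℝ) hpair, ?_, ?_⟩
  · simp only [hc0]
    exact hBx.self_of_nhds
  · have h1 := mfderiv_comp (0 : ℝ) (hBs'.mdifferentiableAt (by simp))
      (hpair.mdifferentiableAt (by simp))
    have h2 := mfderiv_fiber_retraction hfd (hBs.self_of_nhds.mdifferentiableAt (by simp)) hBx v
    rw [mfderiv_prodMk mdifferentiableAt_const (hcs.mdifferentiableAt (by simp)),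
      mfderiv_const] at h1
    rw [hv] at h2
    rw [← h2]
    change (mfderiv 𝓘(ℝ, ℝ) I (B ∘ fun t => (f x, c t)) 0 (1 : ℝ) : E) = _
    rw [h1]
    change (mfderiv (I'.prod I) I B (f x, c 0)
      (((0 : ℝ →L[ℝ] E') 1, mfderiv 𝓘(ℝ, ℝ) I c 0 (1 : ℝ)) : E' × E) : E) = _
    rw [hc1, hc0]
    rfl
  · have h3 : Filter.Tendsto (fun t => (f x, c t)) (𝓝 0) (𝓝 (f x, x)) := by
      have := hpair.continuousAt.tendsto
      rwa [hc0] at this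
    exact h3.eventually hBf

/-- The map `y ↦ B (y, x)` is a local section of `f` through `x`. -/
theorem Manifold.IsSubmersionAt.mfderiv_surjective {f : M → M'} {x : M}
    (hf : IsSubmersionAt I I' ∞ f x) : Function.Surjective (mfderiv I I' f x) := by
  obtain ⟨B, hBs, hBf, hBx⟩ := hf.exists_fiber_retraction
  have hfd : MDifferentiableAt I I' f x := hf.contMDiffAt.mdifferentiableAt (by simp)
  have hBx' : B (f x, x) = x := hBx.self_of_nhds
  have hs : MDifferentiableAt I' I (fun y => B (y, x)) (f x) :=
    (hBs.self_of_nhds.mdifferentiableAt (by simp)).comp (f x)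
      (mdifferentiableAt_id.prodMk mdifferentiableAt_const)
  have h0 : f ∘ (fun y => B (y, x)) =ᶠ[𝓝 (f x)] id := by
    have h3 : Filter.Tendsto (fun y => (y, x)) (𝓝 (f x)) (𝓝 (f x, x)) := by
      have : Continuous (fun y : M' => (y, x)) := by fun_prop
      exact this.tendsto (f x)
    exact h3.eventually hBf
  have hfd' : MDifferentiableAt I I' f (B (f x, x)) := by rwa [hBx']
  have h1 := h0.mfderiv_eq (I := I') (I' := I')
  rw [mfderiv_comp (f x) hfd' hs, mfderiv_id] at h1
  intro w
  refine ⟨(mfderiv I' I (fun y => B (y, x)) (f x) w : E), ?_⟩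
  have h2 := congrArg (fun L : E' →L[ℝ] E' => L w) h1
  have h3 : (mfderiv I I' f (B (f x, x)) : E →L[ℝ] E') = mfderiv I I' f x := by rw [hBx']
  change (mfderiv I I' f (B (f x, x)) : E →L[ℝ] E')
    (mfderiv I' I (fun y => B (y, x)) (f x) w) = w at h2
  rw [h3] at h2
  exact h2

end Submersions

/-! ### Global fields with prescribed values, adapted coframes, and brackets modulo a distribution.
-/

section Distributions

variable {n : ℕ} {N : Type*} [TopologicalSpace N]
  [ChartedSpace (EuclideanSpace ℝ (Fin n)) N] [IsManifold (𝓡 n) ∞ N]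

/-- Smoothness at a point of a vector field. -/
def SmoothFieldAt (V : ∀ x : N, TangentSpace (𝓡 n) x) (x : N) : Prop :=
  ContMDiffAt (𝓡 n) (𝓡 n).tangent ∞ (fun x => (⟨x, V x⟩ : TangentBundle (𝓡 n) N)) x

theorem VField.smoothAt (V : VField n N) (x : N) : SmoothFieldAt V.val x := V.smooth x

theorem SmoothFieldAt.mdiff {V : ∀ x : N, TangentSpace (𝓡 n) x} {x : N} (h : SmoothFieldAt V x) :
    MDifferentiableAt (𝓡 n) (𝓡 n).tangent (fun x => (⟨x, V x⟩ : TangentBundle (𝓡 n) N)) x :=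
  ContMDiffAt.mdifferentiableAt h (by simp)

theorem SmoothFieldAt.add {V W : ∀ x : N, TangentSpace (𝓡 n) x} {x : N} (hV : SmoothFieldAt V x)
    (hW : SmoothFieldAt W x) : SmoothFieldAt (V + W) x :=
  ContMDiffAt.add_section hV hW

theorem SmoothFieldAt.sub {V W : ∀ x : N, TangentSpace (𝓡 n) x} {x : N} (hV : SmoothFieldAt V x)
    (hW : SmoothFieldAt W x) : SmoothFieldAt (V - W) x :=
  ContMDiffAt.sub_section hV hW

theorem SmoothFieldAt.smul {f : N → ℝ} {W : ∀ x : N, TangentSpace (𝓡 n) x} {x : N}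
    (hf : ContMDiffAt (𝓡 n) 𝓘(ℝ, ℝ) ∞ f x)
    (hW : SmoothFieldAt W x) : SmoothFieldAt (f • W) x :=
  ContMDiffAt.smul_section hf hW

theorem SmoothFieldAt.sum {ι : Type*} {s : Finset ι} {W : ι → ∀ x : N, TangentSpace (𝓡 n) x} {x : N}
    (hW : ∀ i ∈ s, SmoothFieldAt (W i) x) : SmoothFieldAt (fun y => ∑ i ∈ s, W i y) x :=
  ContMDiffAt.sum_section hW

theorem SmoothFieldAt.mlieBracket {V W : ∀ x : N, TangentSpace (𝓡 n) x} {x : N}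
    (hV : SmoothFieldAt V x) (hW : SmoothFieldAt W x) :
    SmoothFieldAt (mlieBracket (𝓡 n) V W) x := by
  have : IsManifold (𝓡 n) (((⊤ : ℕ∞) : WithTop ℕ∞) + 1) N := by
    simpa using (inferInstance : IsManifold (𝓡 n) ∞ N)
  have : IsManifold (𝓡 n) (minSmoothness ℝ 2) N :=
    IsManifold.of_le (n := ∞) (by simpa using two_le_infty)
  exact ContMDiffAt.mlieBracket_vectorField (m := ⊤) (n := ⊤) hV hW (by simp)

/-- Vector fields with values in given convex sets exist globally if they exist locally. -/
theorem VField.exists_mem_of_local [T2Space N] [SecondCountableTopology N]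
    (t : ∀ x : N, Set (TangentSpace (𝓡 n) x)) (ht : ∀ x, Convex ℝ (t x))
    (hloc : ∀ x₀ : N, ∃ s : ∀ x : N, TangentSpace (𝓡 n) x,
      ∀ᶠ x in 𝓝 x₀, SmoothFieldAt s x ∧ s x ∈ t x) :
    ∃ V : VField n N, ∀ x, V.val x ∈ t x := by
  have : LocallyCompactSpace N := Manifold.locallyCompact_of_finiteDimensional (𝓡 n)
  obtain ⟨s, hs⟩ := exists_contMDiffSection_forall_mem_convex_of_local (𝓡 n) (n := ⊤)
    (F_fiber := EuclideanSpace ℝ (Fin n)) (TangentSpace (𝓡 n) : N → Type _) t ht (by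
      intro x₀
      obtain ⟨s, hs⟩ := hloc x₀
      exact ⟨_, hs, s, fun x hx => ContMDiffAt.contMDiffWithinAt hx.1, fun x hx => hx.2⟩)
  exact ⟨⟨s, s.contMDiff⟩, hs⟩

theorem exists_smoothField_of_tangent (x : N) (v : TangentSpace (𝓡 n) x) :
    ∃ s : ∀ x : N, TangentSpace (𝓡 n) x, s x = v ∧ ∀ᶠ y in 𝓝 x, SmoothFieldAt s y := by
  obtain ⟨u, hu, hs⟩ := FiberBundle.exists_contMDiffOn_extend (k := ∞)
    (V := (TangentSpace (𝓡 n) : N → Type _)) (𝓡 n) (EuclideanSpace ℝ (Fin n)) v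
  refine ⟨FiberBundle.extend (EuclideanSpace ℝ (Fin n)) v, FiberBundle.extend_apply_self _ v, ?_⟩
  filter_upwards [eventually_mem_nhds_iff.2 hu] with y hy
  exact hs.contMDiffAt hy

theorem TangentDistribution.exists_local_section (H : TangentDistribution n N) {x : N}
    {v : TangentSpace (𝓡 n) x} (hv : v ∈ H.fiber x) :
    ∃ s : ∀ x : N, TangentSpace (𝓡 n) x, s x = v ∧
      ∀ᶠ y in 𝓝 x, SmoothFieldAt s y ∧ s y ∈ H.fiber y := by
  obtain ⟨U, hU, hx, ξ, hξ, hξs⟩ := H.exists_frame x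
  rw [← (hξs x hx).2] at hv
  obtain ⟨a, ha⟩ := (Submodule.mem_span_range_iff_exists_fun ℝ).1 hv
  refine ⟨fun y => ∑ i, a i • ξ i y, ha, ?_⟩
  filter_upwards [hU.mem_nhds hx] with y hy
  refine ⟨SmoothFieldAt.sum fun i _ => ?_, ?_⟩
  · exact SmoothFieldAt.smul (f := fun _ => a i) contMDiffAt_const
      ((hξ i).contMDiffAt (hU.mem_nhds hy))
  · rw [← (hξs y hy).2]
    exact Submodule.sum_mem _ fun i _ => Submodule.smul_mem _ _ (Submodule.subset_span ⟨i, rfl⟩)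

/-- Prescribing the value at one point replaces `t x₁` by its intersection with a singleton, which
is still convex, and changes nothing on the open complement of `x₁`. -/
theorem VField.exists_mem_of_local_of_eq [T2Space N] [SecondCountableTopology N]
    (t : ∀ x : N, Set (TangentSpace (𝓡 n) x)) (ht : ∀ x, Convex ℝ (t x))
    (hloc : ∀ x₀ : N, ∃ s : ∀ x : N, TangentSpace (𝓡 n) x,
      ∀ᶠ x in 𝓝 x₀, SmoothFieldAt s x ∧ s x ∈ t x)
    {x₁ : N} {v : TangentSpace (𝓡 n) x₁}
    (hx₁ : ∃ s : ∀ x : N, TangentSpace (𝓡 n) x, s x₁ = v ∧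
      ∀ᶠ x in 𝓝 x₁, SmoothFieldAt s x ∧ s x ∈ t x) :
    ∃ V : VField n N, V.val x₁ = v ∧ ∀ x, V.val x ∈ t x := by
  obtain ⟨V, hV⟩ := VField.exists_mem_of_local
    (fun x => t x ∩ {w | ∀ h : x = x₁, tangentCast h w = v})
    (by
      intro x
      refine (ht x).inter ?_
      by_cases h : x = x₁
      · subst h
        have : {w : TangentSpace (𝓡 n) x | ∀ h : x = x, tangentCast h w = v} = {v} := by
          ext w
          exact ⟨fun h => h rfl, fun h _ => h⟩
        rw [this]
        exact convex_singleton v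
      · have : {w : TangentSpace (𝓡 n) x | ∀ h : x = x₁, tangentCast h w = v} = univ := by
          ext w
          simp [h]
        rw [this]
        exact convex_univ)
    (by
      intro x₀
      by_cases h : x₀ = x₁
      · subst h
        obtain ⟨s, hs, hs'⟩ := hx₁
        refine ⟨s, ?_⟩
        filter_upwards [hs'] with y hy
        refine ⟨hy.1, hy.2, ?_⟩
        intro h
        subst h
        exact hs
      · obtain ⟨s, hs⟩ := hloc x₀
        refine ⟨s, ?_⟩
        filter_upwards [hs, isOpen_ne.mem_nhds h] with y hy hne
        exact ⟨hy.1, hy.2, fun h => absurd h hne⟩)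
  exact ⟨V, (hV x₁).2 rfl, fun x => (hV x).1⟩

theorem VField.exists_eq [T2Space N] [SecondCountableTopology N] (x : N)
    (v : TangentSpace (𝓡 n) x) : ∃ V : VField n N, V.val x = v := by
  obtain ⟨V, hV, -⟩ := VField.exists_mem_of_local_of_eq (fun _ => univ) (fun _ => convex_univ)
    (fun x₀ => (exists_smoothField_of_tangent x₀ 0).imp fun _ hs => hs.2.mono fun y hy =>
      ⟨hy, mem_univ _⟩)
    ((exists_smoothField_of_tangent x v).imp fun s hs => ⟨hs.1, hs.2.mono fun y hy =>
      ⟨hy, mem_univ _⟩⟩)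
  exact ⟨V, hV⟩

theorem TangentDistribution.exists_vField [T2Space N] [SecondCountableTopology N]
    (H : TangentDistribution n N) {x : N} {v : TangentSpace (𝓡 n) x} (hv : v ∈ H.fiber x) :
    ∃ V : VField n N, V.val x = v ∧ ∀ y, V.val y ∈ H.fiber y :=
  VField.exists_mem_of_local_of_eq (fun x => (H.fiber x : Set (TangentSpace (𝓡 n) x)))
    (fun x => (H.fiber x).convex)
    (fun x₀ => (H.exists_local_section (x := x₀) (Submodule.zero_mem _)).imp fun _ hs => hs.2)
    (H.exists_local_section hv)

theorem TangentDistribution.finrank_fiber (H : TangentDistribution n N) (x : N) :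
    Module.finrank ℝ (H.fiber x) = H.rank := by
  obtain ⟨U, hU, hx, ξ, hξ, hξs⟩ := H.exists_frame x
  rw [← (hξs x hx).2, finrank_span_eq_card (hξs x hx).1, Fintype.card_fin]

theorem ContMDiffAt.coframe_apply {F : Type*} [NormedAddCommGroup F] [NormedSpace ℝ F] {x₀ x : N}
    {θ : N → EuclideanSpace ℝ (Fin n) →L[ℝ] F} {V : ∀ x : N, TangentSpace (𝓡 n) x}
    (hθ : ContMDiffAt (𝓡 n) 𝓘(ℝ, EuclideanSpace ℝ (Fin n) →L[ℝ] F) ∞ θ x)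
    (hx : x ∈ (chartAt (EuclideanSpace ℝ (Fin n)) x₀).source) (hV : SmoothFieldAt V x) :
    ContMDiffAt (𝓡 n) 𝓘(ℝ, F) ∞
      (fun y => θ y (mvfderiv (𝓡 n) (extChartAt (𝓡 n) x₀) y (V y))) x :=
  hθ.clm_apply (ContMDiffAt.mvfderiv_apply_vectorField (contMDiffAt_extChartAt' hx) hV)

/-- A dual coframe adapted to a distribution. -/
theorem TangentDistribution.exists_adapted_coframe (H : TangentDistribution n N)
    {ι κ : Type*} [Fintype ι] [DecidableEq ι] [Fintype κ] [DecidableEq κ]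
    {Z : ι ⊕ κ → ∀ x : N, TangentSpace (𝓡 n) x} {x₀ : N}
    (hZ : ∀ i, ∀ᶠ x in 𝓝 x₀, SmoothFieldAt (Z i) x)
    (hZH : ∀ i, ∀ᶠ x in 𝓝 x₀, Z (Sum.inl i) x ∈ H.fiber x)
    (hli : LinearIndependent ℝ (fun i => (Z i x₀ : EuclideanSpace ℝ (Fin n))))
    (hι : Fintype.card ι = H.rank) (hcard : Fintype.card (ι ⊕ κ) = n) :
    ∃ θ : N → EuclideanSpace ℝ (Fin n) →L[ℝ] (ι ⊕ κ → ℝ), ∀ᶠ x in 𝓝 x₀,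
      ContMDiffAt (𝓡 n) 𝓘(ℝ, EuclideanSpace ℝ (Fin n) →L[ℝ] (ι ⊕ κ → ℝ)) ∞ θ x ∧
      (∀ i, θ x (mvfderiv (𝓡 n) (extChartAt (𝓡 n) x₀) x (Z i x)) = Pi.single i 1) ∧
      (∀ v : TangentSpace (𝓡 n) x,
        v = ∑ i, θ x (mvfderiv (𝓡 n) (extChartAt (𝓡 n) x₀) x v) i • Z i x) ∧
      ∀ v : TangentSpace (𝓡 n) x, v ∈ H.fiber x ↔
        ∀ b, θ x (mvfderiv (𝓡 n) (extChartAt (𝓡 n) x₀) x v) (Sum.inr b) = 0 := by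
  obtain ⟨θ, hθ⟩ := exists_dual_coframe (I := 𝓡 n) hZ hli (by rw [hcard]; simp)
  refine ⟨θ, ?_⟩
  filter_upwards [hθ, Filter.eventually_all.2 hZH] with x hx hxH
  refine ⟨hx.1, hx.2.1, hx.2.2, fun v => ⟨fun hv b => ?_, fun hv => ?_⟩⟩
  · set L : TangentSpace (𝓡 n) x →ₗ[ℝ] (ι ⊕ κ → ℝ) :=
      ((θ x).toLinearMap ∘ₗ (mvfderiv (𝓡 n) (extChartAt (𝓡 n) x₀) x).toLinearMap :
        EuclideanSpace ℝ (Fin n) →ₗ[ℝ] (ι ⊕ κ → ℝ)) with hL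
    have hLZ : ∀ i, L (Z i x) = Pi.single i 1 := hx.2.1
    have hlix : LinearIndependent ℝ (fun i => Z (Sum.inl i) x) := by
      refine LinearIndependent.of_comp L ?_
      have := (Pi.basisFun ℝ (ι ⊕ κ)).linearIndependent.comp _ Sum.inl_injective
      convert this using 1
      ext i : 1
      simp [hLZ]
    -- The fields `Z (Sum.inl i)` lie in `H` and stay independent near `x₀`, so equality of
    -- dimensions makes them a frame of `H`.
    have hspan : Submodule.span ℝ (range fun i => Z (Sum.inl i) x) = H.fiber x := by
      have : FiniteDimensional ℝ (TangentSpace (𝓡 n) x) :=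
        inferInstanceAs (FiniteDimensional ℝ (EuclideanSpace ℝ (Fin n)))
      refine Submodule.eq_of_le_of_finrank_eq ?_ ?_
      · rw [Submodule.span_le]
        rintro _ ⟨i, rfl⟩
        exact hxH i
      · rw [finrank_span_eq_card hlix, hι, H.finrank_fiber]
    rw [← hspan] at hv
    obtain ⟨a, rfl⟩ := (Submodule.mem_span_range_iff_exists_fun ℝ).1 hv
    change L (∑ i, a i • Z (Sum.inl i) x) (Sum.inr b) = 0
    rw [map_sum, Finset.sum_apply]
    refine Finset.sum_eq_zero fun i _ => ?_
    rw [map_smul, hLZ]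
    simp
  · rw [hx.2.2 v, Fintype.sum_sum_type]
    refine Submodule.add_mem _ (Submodule.sum_mem _ fun i _ => Submodule.smul_mem _ _ (hxH i))
      (Submodule.sum_mem _ fun b _ => ?_)
    rw [hv b, zero_smul]
    exact Submodule.zero_mem _

/-- The coframe components transverse to the distribution cut it out. The form acts on vectors read
in the fixed chart at `x₀`, so that it is a map into a fixed space of linear maps and its continuity
makes sense. -/
theorem TangentDistribution.exists_defining_form [T2Space N] [SecondCountableTopology N]
    (H : TangentDistribution n N) (x₀ : N) :
    ∃ (k : ℕ) (θ : N → EuclideanSpace ℝ (Fin n) →L[ℝ] (Fin k → ℝ)), ∀ᶠ x in 𝓝 x₀,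
      ContMDiffAt (𝓡 n) 𝓘(ℝ, EuclideanSpace ℝ (Fin n) →L[ℝ] (Fin k → ℝ)) ∞ θ x ∧
      ∀ v : TangentSpace (𝓡 n) x, v ∈ H.fiber x ↔
        θ x (mvfderiv (𝓡 n) (extChartAt (𝓡 n) x₀) x v) = 0 := by
  have : FiniteDimensional ℝ (TangentSpace (𝓡 n) x₀) :=
    inferInstanceAs (FiniteDimensional ℝ (EuclideanSpace ℝ (Fin n)))
  obtain ⟨C, hC⟩ := (H.fiber x₀).exists_isCompl
  set bH := Module.finBasis ℝ (H.fiber x₀)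
  set bC := Module.finBasis ℝ C
  choose ZH hZH hZH' using fun i => H.exists_vField (bH i).2
  choose ZC hZC using fun i => VField.exists_eq x₀ (bC i : TangentSpace (𝓡 n) x₀)
  set Z : _ ⊕ _ → VField n N := Sum.elim ZH ZC with hZ
  have hli : LinearIndependent ℝ (fun i => (Z i).val x₀) := by
    have h1 : LinearIndependent ℝ (fun i => (ZH i).val x₀) := by
      simp only [hZH]
      exact bH.linearIndependent.map' (H.fiber x₀).subtype (Submodule.ker_subtype _)
    have h2 : LinearIndependent ℝ (fun i => (ZC i).val x₀) := by
      simp only [hZC]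
      exact bC.linearIndependent.map' C.subtype (Submodule.ker_subtype _)
    have := h1.sum_type h2 (hC.disjoint.mono ?_ ?_)
    · have e : (fun i => (Z i).val x₀) =
          Sum.elim (fun i => (ZH i).val x₀) fun i => (ZC i).val x₀ := by
        ext1 i
        cases i <;> rfl
      rw [e]
      exact this
    · rw [Submodule.span_le]
      rintro _ ⟨i, rfl⟩
      simp only [hZH]
      exact (bH i).2
    · rw [Submodule.span_le]
      rintro _ ⟨i, rfl⟩
      simp only [hZC]
      exact (bC i).2
  obtain ⟨θ, hθ⟩ := H.exists_adapted_coframe (x₀ := x₀) (Z := fun i => (Z i).val)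
    (fun i => Filter.Eventually.of_forall fun x => (Z i).smoothAt x)
    (fun i => Filter.Eventually.of_forall fun x => hZH' i x) hli
    (by rw [Fintype.card_fin, H.finrank_fiber])
    (by
      rw [Fintype.card_sum, Fintype.card_fin, Fintype.card_fin,
        Submodule.finrank_add_eq_of_isCompl hC]
      exact finrank_euclideanSpace_fin (𝕜 := ℝ))
  set P : (Fin (Module.finrank ℝ (H.fiber x₀)) ⊕ Fin (Module.finrank ℝ C) → ℝ) →L[ℝ]
      (Fin (Module.finrank ℝ C) → ℝ) :=
    ContinuousLinearMap.pi fun b => ContinuousLinearMap.proj (Sum.inr b) with hP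
  refine ⟨_, fun x => P ∘L θ x, ?_⟩
  filter_upwards [hθ] with x hx
  refine ⟨contMDiffAt_const.clm_comp hx.1, fun v => ?_⟩
  rw [hx.2.2.2 v, funext_iff]
  rfl

variable {E' : Type*} [NormedAddCommGroup E'] [NormedSpace ℝ E'] [CompleteSpace E']
  {H' : Type*} [TopologicalSpace H'] {I' : ModelWithCorners ℝ E' H'} [I'.Boundaryless]
  {M' : Type*} [TopologicalSpace M'] [ChartedSpace H' M'] [IsManifold I' ∞ M']

/-- If `Z` is `f`-related to `A` and `df W` is, along a curve tangent to `Z`, tangent to a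
distribution to which `V` is tangent, then `[V, A] - df [W, Z]` is tangent to the distribution. -/
theorem TangentDistribution.mlieBracket_sub_mem [T2Space N] [SecondCountableTopology N]
    (H : TangentDistribution n N) {f : M' → N} {q : M'}
    {V A : ∀ y : N, TangentSpace (𝓡 n) y} {W Z : ∀ x : M', TangentSpace I' x}
    (hf : ContMDiffAt I' (𝓡 n) ∞ f q) (hV : SmoothFieldAt V (f q)) (hA : SmoothFieldAt A (f q))
    (hW : ContMDiffAt I' I'.tangent ∞ (fun x => (⟨x, W x⟩ : TangentBundle I' M')) q)
    (hZ : ContMDiffAt I' I'.tangent ∞ (fun x => (⟨x, Z x⟩ : TangentBundle I' M')) q)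
    (hZA : ∀ᶠ x in 𝓝 q, mfderiv I' (𝓡 n) f x (Z x) = A (f x))
    (hWV : mfderiv I' (𝓡 n) f q (W q) = V (f q))
    {c : ℝ → M'} {c' : ℝ →L[ℝ] TangentSpace I' (c 0)} (hc : HasMFDerivAt 𝓘(ℝ, ℝ) I' c 0 c')
    (hc0 : c 0 = q) (hc1 : (c' 1 : E') = Z q)
    (hVH : ∀ᶠ y in 𝓝 (f q), V y ∈ H.fiber y)
    (hWH : ∀ᶠ t in 𝓝 (0 : ℝ), mfderiv I' (𝓡 n) f (c t) (W (c t)) ∈ H.fiber (f (c t))) :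
    mlieBracket (𝓡 n) V A (f q) - mfderiv I' (𝓡 n) f q (mlieBracket I' W Z q) ∈
      H.fiber (f q) := by
  obtain ⟨k, θ, hθ⟩ := H.exists_defining_form (f q)
  have hψd : mvfderiv (𝓡 n) (extChartAt (𝓡 n) (f q)) (f q) =
      ContinuousLinearMap.id ℝ (EuclideanSpace ℝ (Fin n)) := by
    have := mfderiv_extChartAt_self (I := 𝓡 n) (x := f q)
    ext1 v
    change (mfderiv (𝓡 n) 𝓘(ℝ, _) (extChartAt (𝓡 n) (f q)) (f q) v : EuclideanSpace ℝ (Fin n)) = v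
    rw [this]
    rfl
  rw [hθ.self_of_nhds.2, hψd]
  refine apply_mlieBracket_sub_eq_zero hf hV hA hW hZ hZA hWV hc hc0 hc1
    hθ.self_of_nhds.1.continuousAt ?_
  have hcf : Filter.Tendsto (fun t => f (c t)) (𝓝 0) (𝓝 (f q)) := by
    have h1 : ContinuousAt c 0 := hc.1
    have h2 : ContinuousAt f (c 0) := by rw [hc0]; exact hf.continuousAt
    have := (h2.comp h1).tendsto
    rwa [Function.comp_apply, hc0] at this
  filter_upwards [hcf.eventually hθ, hcf.eventually hVH, hWH] with t h1 h2 h3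
  exact (h1.2 _).1 (Submodule.sub_mem _ h3 h2)

/-- The bracket with a vector field tangent to a distribution is, modulo the distribution,
determined by the value of the field. -/
theorem TangentDistribution.mlieBracket_sub_mlieBracket_mem [T2Space N]
    [SecondCountableTopology N] (H : TangentDistribution n N) {x : N}
    {V V' A : ∀ y : N, TangentSpace (𝓡 n) y} (hV : SmoothFieldAt V x) (hV' : SmoothFieldAt V' x)
    (hA : SmoothFieldAt A x) (hVH : ∀ᶠ y in 𝓝 x, V y ∈ H.fiber y)
    (hVH' : ∀ᶠ y in 𝓝 x, V' y ∈ H.fiber y) (hVV' : V x = V' x) :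
    mlieBracket (𝓡 n) V A x - mlieBracket (𝓡 n) V' A x ∈ H.fiber x := by
  obtain ⟨c, hc0, hcs, hc1⟩ := exists_curve_of_tangent (I := 𝓡 n) x (A x)
  have hid : ∀ y : N, mfderiv (𝓡 n) (𝓡 n) (id : N → N) y = ContinuousLinearMap.id ℝ _ :=
    fun y => mfderiv_id
  -- For the identity map the relatedness hypotheses become `V x = V' x` and tangency of `V'` along
  -- a curve with velocity `A x`.
  have h := H.mlieBracket_sub_mem (f := (id : N → N)) (q := x) (V := V) (A := A) (W := V') (Z := A)
    contMDiffAt_id hV hA hV' hA (Filter.Eventually.of_forall fun y => by rw [hid]; rfl)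
    (by rw [hid]; exact hVV'.symm) (hcs.mdifferentiableAt (by simp)).hasMFDerivAt hc0 hc1 hVH (by
      have hct : Filter.Tendsto c (𝓝 0) (𝓝 x) := hc0 ▸ hcs.continuousAt.tendsto
      filter_upwards [hct.eventually hVH'] with t ht
      rw [hid]
      exact ht)
  rw [hid] at h
  exact h

end Distributions

/-! ### Comparing tangent vectors at propositionally equal base points. -/

section Along

/-- All tangent spaces are definitionally the model space, and the transport is the identity there.
Groupoid identities such as `unit_mul` hold only propositionally, so vectors are compared in the
model space from here on. -/
theorem tangentCast_eq {n : ℕ} {N : Type*} [TopologicalSpace N]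
    [ChartedSpace (EuclideanSpace ℝ (Fin n)) N] {x y : N} (h : x = y)
    (v : TangentSpace (𝓡 n) x) :
    (tangentCast h v : EuclideanSpace ℝ (Fin n)) = v := by
  subst h
  rfl

theorem TangentDistribution.mem_fiber_of_eq {n : ℕ} {N : Type*} [TopologicalSpace N]
    [ChartedSpace (EuclideanSpace ℝ (Fin n)) N] [IsManifold (𝓡 n) ∞ N]
    (H : TangentDistribution n N) {x y : N} (h : x = y) {v : EuclideanSpace ℝ (Fin n)}
    (hv : (v : TangentSpace (𝓡 n) x) ∈ H.fiber x) : (v : TangentSpace (𝓡 n) y) ∈ H.fiber y := by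
  subst h
  exact hv

theorem totalSpace_mk_eq {n : ℕ} {N : Type*} [TopologicalSpace N]
    [ChartedSpace (EuclideanSpace ℝ (Fin n)) N] {x y : N} (h : x = y)
    (v : EuclideanSpace ℝ (Fin n)) :
    (⟨x, v⟩ : TangentBundle (𝓡 n) N) = ⟨y, v⟩ := by
  subst h
  rfl

theorem mfderiv_congr_point_vec {E : Type*} [NormedAddCommGroup E] [NormedSpace ℝ E]
    {H : Type*} [TopologicalSpace H] {I : ModelWithCorners ℝ E H}
    {M : Type*} [TopologicalSpace M] [ChartedSpace H M]
    {E' : Type*} [NormedAddCommGroup E'] [NormedSpace ℝ E']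
    {H' : Type*} [TopologicalSpace H'] {I' : ModelWithCorners ℝ E' H'}
    {M' : Type*} [TopologicalSpace M'] [ChartedSpace H' M'] (f : M → M') {x y : M} (h : x = y)
    (v : E) : (mfderiv I I' f x v : E') = mfderiv I I' f y v := by
  subst h
  rfl

/-- Smoothness of linear combinations of smooth fields along a map. -/
theorem ContMDiffAt.add_smul_along {F : Type*} [NormedAddCommGroup F] [NormedSpace ℝ F]
    {K : Type*} [TopologicalSpace K] {J : ModelWithCorners ℝ F K}
    {P : Type*} [TopologicalSpace P] [ChartedSpace K P] [IsManifold J ∞ P]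
    {n : ℕ} {N : Type*} [TopologicalSpace N]
    [ChartedSpace (EuclideanSpace ℝ (Fin n)) N] [IsManifold (𝓡 n) ∞ N]
    {g : P → N} {v w : ∀ x, TangentSpace (𝓡 n) (g x)} {f : P → ℝ} {x₀ : P}
    (hv : ContMDiffAt J (𝓡 n).tangent ∞ (fun x => (⟨g x, v x⟩ : TangentBundle (𝓡 n) N)) x₀)
    (hw : ContMDiffAt J (𝓡 n).tangent ∞ (fun x => (⟨g x, w x⟩ : TangentBundle (𝓡 n) N)) x₀)
    (hf : ContMDiffAt J 𝓘(ℝ, ℝ) ∞ f x₀) :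
    ContMDiffAt J (𝓡 n).tangent ∞
      (fun x => (⟨g x, v x + f x • w x⟩ : TangentBundle (𝓡 n) N)) x₀ := by
  rw [Bundle.contMDiffAt_totalSpace] at hv hw ⊢
  refine ⟨hv.1, ?_⟩
  refine (hv.2.add (hf.smul hw.2)).congr_of_eventuallyEq ?_
  set e := trivializationAt (EuclideanSpace ℝ (Fin n)) (TangentSpace (𝓡 n)) (g x₀) with he
  have hgc : ContinuousAt g x₀ := hv.1.continuousAt
  filter_upwards [hgc.preimage_mem_nhds (e.open_baseSet.mem_nhds
    (FiberBundle.mem_baseSet_trivializationAt' (g x₀)))] with x hx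
  have h1 := e.linear ℝ hx
  change (e ⟨g x, v x + f x • w x⟩).2 = _
  rw [h1.map_add, h1.map_smul]
  rfl

end Along

/-! ### Differentials of the structure maps of the groupoid. -/

namespace LieGroupoid

variable {p n : ℕ} {G M : Type*}
  [TopologicalSpace G] [ChartedSpace (EuclideanSpace ℝ (Fin p)) G] [IsManifold (𝓡 p) ∞ G]
  [TopologicalSpace M] [ChartedSpace (EuclideanSpace ℝ (Fin n)) M] [IsManifold (𝓡 n) ∞ M]
  (𝒢 : LieGroupoid p n G M)

theorem src_smooth : ContMDiff (𝓡 p) (𝓡 n) ∞ 𝒢.src := fun g =>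
  (𝒢.src_submersion.isSubmersionAt g).contMDiffAt

theorem tgt_smooth : ContMDiff (𝓡 p) (𝓡 n) ∞ 𝒢.tgt := fun g =>
  (𝒢.tgt_submersion.isSubmersionAt g).contMDiffAt

theorem mdiff_src (g : G) : MDifferentiableAt (𝓡 p) (𝓡 n) 𝒢.src g :=
  (𝒢.src_smooth g).mdifferentiableAt (by simp)

theorem mdiff_tgt (g : G) : MDifferentiableAt (𝓡 p) (𝓡 n) 𝒢.tgt g :=
  (𝒢.tgt_smooth g).mdifferentiableAt (by simp)

theorem mdiff_unit (x : M) : MDifferentiableAt (𝓡 n) (𝓡 p) 𝒢.unit x :=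
  (𝒢.unit_smooth x).mdifferentiableAt (by simp)

theorem mdiff_inv (g : G) : MDifferentiableAt (𝓡 p) (𝓡 p) 𝒢.inv g :=
  (𝒢.inv_smooth g).mdifferentiableAt (by simp)

theorem dsrc_dunit (x : M) (X : TangentSpace (𝓡 n) x) :
    (𝒢.dsrc (𝒢.unit x) (𝒢.dunit x X) : EuclideanSpace ℝ (Fin n)) = X := by
  have h : 𝒢.src ∘ 𝒢.unit = id := funext 𝒢.src_unit
  have h1 := mfderiv_comp x (𝒢.mdiff_src (𝒢.unit x)) (𝒢.mdiff_unit x)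
  rw [h, mfderiv_id] at h1
  exact (congrArg (fun L : EuclideanSpace ℝ (Fin n) →L[ℝ] EuclideanSpace ℝ (Fin n) => L X) h1).symm

theorem dtgt_dunit (x : M) (X : TangentSpace (𝓡 n) x) :
    (𝒢.dtgt (𝒢.unit x) (𝒢.dunit x X) : EuclideanSpace ℝ (Fin n)) = X := by
  have h : 𝒢.tgt ∘ 𝒢.unit = id := funext 𝒢.tgt_unit
  have h1 := mfderiv_comp x (𝒢.mdiff_tgt (𝒢.unit x)) (𝒢.mdiff_unit x)
  rw [h, mfderiv_id] at h1
  exact (congrArg (fun L : EuclideanSpace ℝ (Fin n) →L[ℝ] EuclideanSpace ℝ (Fin n) => L X) h1).symm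

theorem dtgt_dinv (g : G) (v : TangentSpace (𝓡 p) g) :
    (𝒢.dtgt (𝒢.inv g) (𝒢.dinv g v) : EuclideanSpace ℝ (Fin n)) = 𝒢.dsrc g v := by
  have h : 𝒢.tgt ∘ 𝒢.inv = 𝒢.src := funext 𝒢.tgt_inv
  have h1 := mfderiv_comp g (𝒢.mdiff_tgt (𝒢.inv g)) (𝒢.mdiff_inv g)
  rw [h] at h1
  exact (congrArg (fun L : EuclideanSpace ℝ (Fin p) →L[ℝ] EuclideanSpace ℝ (Fin n) => L v) h1).symm

theorem inv_inv (g : G) : 𝒢.inv (𝒢.inv g) = g := by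
  have h1 := 𝒢.mul_assoc (𝒢.inv (𝒢.inv g)) (𝒢.inv g) g
    (by rw [𝒢.src_inv]) (𝒢.src_inv g)
  rw [𝒢.inv_mul, 𝒢.inv_mul, 𝒢.src_inv] at h1
  rw [𝒢.unit_mul] at h1
  have h2 := 𝒢.mul_unit (𝒢.inv (𝒢.inv g))
  rw [𝒢.src_inv, 𝒢.tgt_inv] at h2
  rw [← h2, ← h1]

theorem dinv_dinv (g : G) (v : TangentSpace (𝓡 p) g) :
    (𝒢.dinv (𝒢.inv g) (𝒢.dinv g v) : EuclideanSpace ℝ (Fin p)) = v := by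
  have h : 𝒢.inv ∘ 𝒢.inv = id := funext 𝒢.inv_inv
  have h1 := mfderiv_comp g (𝒢.mdiff_inv (𝒢.inv g)) (𝒢.mdiff_inv g)
  rw [h, mfderiv_id] at h1
  exact (congrArg (fun L : EuclideanSpace ℝ (Fin p) →L[ℝ] EuclideanSpace ℝ (Fin p) => L v) h1).symm

/-! ### Derivatives of the composition along composable maps. -/

section Mul

variable {F : Type*} [NormedAddCommGroup F] [NormedSpace ℝ F]
  {K : Type*} [TopologicalSpace K] {J : ModelWithCorners ℝ F K}
  {P : Type*} [TopologicalSpace P] [ChartedSpace K P]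

theorem contMDiffAt_mul {f k : P → G} {q : P} (hf : ContMDiffAt J (𝓡 p) ∞ f q)
    (hk : ContMDiffAt J (𝓡 p) ∞ k q) (h : ∀ᶠ x in 𝓝 q, 𝒢.src (f x) = 𝒢.tgt (k x)) :
    ContMDiffAt J (𝓡 p) ∞ (fun x => 𝒢.mul (f x) (k x)) q :=
  (ContMDiffWithinAt.comp (g := fun q : G × G => 𝒢.mul q.1 q.2) (f := fun x => (f x, k x))
    (s := {x | 𝒢.src (f x) = 𝒢.tgt (k x)}) (t := {q : G × G | 𝒢.src q.1 = 𝒢.tgt q.2}) q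
    (𝒢.mul_smooth (f q, k q) h.self_of_nhds)
    (hf.prodMk hk).contMDiffWithinAt (fun x (hx : 𝒢.src (f x) = 𝒢.tgt (k x)) => hx)).contMDiffAt h

/-- The composable pairs need not be a set of unique differentiability in `G × G`, so `dmul`
involves a choice of derivative. The chain rule within the set holds for any such choice, and yields
a genuine derivative because the pair `(f, k)` stays composable near `q`. -/
theorem hasMFDerivAt_mul {f k : P → G} {q : P} (hf : MDifferentiableAt J (𝓡 p) f q)
    (hk : MDifferentiableAt J (𝓡 p) k q) (h : ∀ᶠ x in 𝓝 q, 𝒢.src (f x) = 𝒢.tgt (k x)) :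
    ∃ L : F →L[ℝ] EuclideanSpace ℝ (Fin p),
      HasMFDerivAt J (𝓡 p) (fun x => 𝒢.mul (f x) (k x)) q L ∧
      ∀ v : TangentSpace J q, L v = 𝒢.dmul (f q) (k q) (mfderiv J (𝓡 p) f q v)
        (mfderiv J (𝓡 p) k q v) := by
  have hm := ((𝒢.mul_smooth (f q, k q) h.self_of_nhds).mdifferentiableWithinAt
    (by simp)).hasMFDerivWithinAt
  have hfk := (hf.hasMFDerivAt.prodMk hk.hasMFDerivAt).hasMFDerivWithinAt
    (s := {x | 𝒢.src (f x) = 𝒢.tgt (k x)})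
  exact ⟨_, (HasMFDerivWithinAt.comp q (g := fun q : G × G => 𝒢.mul q.1 q.2)
    (f := fun x => (f x, k x)) (u := {q : G × G | 𝒢.src q.1 = 𝒢.tgt q.2}) hm hfk
    (fun x (hx : 𝒢.src (f x) = 𝒢.tgt (k x)) => hx)).hasMFDerivAt h, fun v => rfl⟩

theorem mfderiv_mul {f k : P → G} {q : P} (hf : MDifferentiableAt J (𝓡 p) f q)
    (hk : MDifferentiableAt J (𝓡 p) k q) (h : ∀ᶠ x in 𝓝 q, 𝒢.src (f x) = 𝒢.tgt (k x))
    (v : TangentSpace J q) :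
    (mfderiv J (𝓡 p) (fun x => 𝒢.mul (f x) (k x)) q v : EuclideanSpace ℝ (Fin p)) =
      𝒢.dmul (f q) (k q) (mfderiv J (𝓡 p) f q v) (mfderiv J (𝓡 p) k q v) := by
  obtain ⟨L, hL, hLv⟩ := 𝒢.hasMFDerivAt_mul hf hk h
  rw [hL.mfderiv]
  exact hLv v

theorem dmul_congr {g g' h h' : G} (hg : g = g') (hh : h = h') (v w : EuclideanSpace ℝ (Fin p)) :
    (𝒢.dmul g h v w : EuclideanSpace ℝ (Fin p)) = 𝒢.dmul g' h' v w := by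
  subst hg hh
  rfl

/-- `dm (v, 0_h)` is the derivative of the right translation by `h`, along curves in the
source fibre. -/
theorem exists_curve_dmul {g h : G} (hgh : 𝒢.src g = 𝒢.tgt h) {v : TangentSpace (𝓡 p) g}
    (hv : 𝒢.dsrc g v = 0) :
    ∃ c : ℝ → G, c 0 = g ∧ ContMDiffAt 𝓘(ℝ, ℝ) (𝓡 p) ∞ c 0 ∧
      (mfderiv 𝓘(ℝ, ℝ) (𝓡 p) c 0 (1 : ℝ) : EuclideanSpace ℝ (Fin p)) = v ∧
      (∀ᶠ t in 𝓝 (0 : ℝ), 𝒢.src (c t) = 𝒢.tgt h) ∧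
      MDifferentiableAt 𝓘(ℝ, ℝ) (𝓡 p) (fun t => 𝒢.mul (c t) h) 0 ∧
      (mfderiv 𝓘(ℝ, ℝ) (𝓡 p) (fun t => 𝒢.mul (c t) h) 0 (1 : ℝ) : EuclideanSpace ℝ (Fin p)) =
        𝒢.dmul g h v 0 := by
  obtain ⟨c, hc0, hcs, hc1, hcf⟩ := (𝒢.src_submersion.isSubmersionAt g).exists_curve_in_fiber hv
  have hcomp : ∀ᶠ t in 𝓝 (0 : ℝ), 𝒢.src (c t) = 𝒢.tgt h := by
    filter_upwards [hcf] with t ht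
    rw [ht, hgh]
  refine ⟨c, hc0, hcs, hc1, hcomp, ?_, ?_⟩
  · obtain ⟨L, hL, -⟩ := 𝒢.hasMFDerivAt_mul (hcs.mdifferentiableAt (by simp))
      (mdifferentiableAt_const (c := h)) hcomp
    exact hL.mdifferentiableAt
  · have h1 := 𝒢.mfderiv_mul (hcs.mdifferentiableAt (by simp))
      (mdifferentiableAt_const (c := h)) hcomp (1 : ℝ)
    rw [mfderiv_const] at h1
    refine h1.trans (Eq.trans ?_ (𝒢.dmul_congr hc0 (rfl : h = h) v 0))
    rw [← hc1]
    rfl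

theorem dsrc_dmul {g h : G} (hgh : 𝒢.src g = 𝒢.tgt h) {v : TangentSpace (𝓡 p) g}
    (hv : 𝒢.dsrc g v = 0) : 𝒢.dsrc (𝒢.mul g h) (𝒢.dmul g h v 0) = 0 := by
  obtain ⟨c, hc0, hcs, hc1, hcf, hd, hm⟩ := 𝒢.exists_curve_dmul hgh hv
  have h1 := mfderiv_comp (0 : ℝ) (𝒢.mdiff_src (𝒢.mul (c 0) h)) hd
  have h2 : 𝒢.src ∘ (fun t => 𝒢.mul (c t) h) =ᶠ[𝓝 0] fun _ => 𝒢.src h := by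
    filter_upwards [hcf] with t ht
    exact 𝒢.src_mul _ _ ht
  rw [h2.mfderiv_eq, mfderiv_const] at h1
  have h3 := congrArg (fun L : ℝ →L[ℝ] EuclideanSpace ℝ (Fin n) => L 1) h1
  change (0 : EuclideanSpace ℝ (Fin n)) = mfderiv (𝓡 p) (𝓡 n) 𝒢.src (𝒢.mul (c 0) h)
    (mfderiv 𝓘(ℝ, ℝ) (𝓡 p) (fun t => 𝒢.mul (c t) h) 0 (1 : ℝ) : EuclideanSpace ℝ (Fin p)) at h3
  rw [hm] at h3
  exact (h3.trans (mfderiv_congr_point_vec (I := 𝓡 p) (I' := 𝓡 n) 𝒢.src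
    (congrArg (fun g => 𝒢.mul g h) hc0) (𝒢.dmul g h v 0))).symm

/-- Associativity differentiated along a curve in the source fibre of `g` with velocity `v`. -/
theorem dmul_dmul {g h k : G} (hgh : 𝒢.src g = 𝒢.tgt h) (hhk : 𝒢.src h = 𝒢.tgt k)
    {v : TangentSpace (𝓡 p) g} (hv : 𝒢.dsrc g v = 0) :
    (𝒢.dmul (𝒢.mul g h) k (𝒢.dmul g h v 0) 0 : EuclideanSpace ℝ (Fin p)) =
      𝒢.dmul g (𝒢.mul h k) v 0 := by
  obtain ⟨c, hc0, hcs, hc1, hcf, hd, hm⟩ := 𝒢.exists_curve_dmul hgh hv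
  have h1 := 𝒢.mfderiv_mul hd (mdifferentiableAt_const (c := k)) (by
    filter_upwards [hcf] with t ht
    rw [𝒢.src_mul _ _ ht, hhk]) (1 : ℝ)
  have h2 := 𝒢.mfderiv_mul (hcs.mdifferentiableAt (by simp))
    (mdifferentiableAt_const (c := 𝒢.mul h k)) (by
    filter_upwards [hcf] with t ht
    rw [𝒢.tgt_mul _ _ hhk, ht]) (1 : ℝ)
  have h3 : (fun t => 𝒢.mul (𝒢.mul (c t) h) k) =ᶠ[𝓝 0] fun t => 𝒢.mul (c t) (𝒢.mul h k) := by
    filter_upwards [hcf] with t ht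
    exact 𝒢.mul_assoc _ _ _ ht hhk
  rw [h3.mfderiv_eq, mfderiv_const] at h1
  rw [mfderiv_const] at h2
  have h4 := h1.symm.trans h2
  have e1 := 𝒢.dmul_congr (congrArg (fun g => 𝒢.mul g h) hc0) (rfl : k = k) (𝒢.dmul g h v 0) 0
  have e2 := 𝒢.dmul_congr hc0 (rfl : 𝒢.mul h k = 𝒢.mul h k) v 0
  refine e1.symm.trans (Eq.trans ?_ e2)
  rw [← hm, ← hc1]
  exact h4

theorem dmul_unit {g : G} {v : TangentSpace (𝓡 p) g} (hv : 𝒢.dsrc g v = 0) :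
    (𝒢.dmul g (𝒢.unit (𝒢.src g)) v 0 : EuclideanSpace ℝ (Fin p)) = v := by
  obtain ⟨c, hc0, hcs, hc1, hcf, hd, hm⟩ :=
    𝒢.exists_curve_dmul (h := 𝒢.unit (𝒢.src g)) (𝒢.tgt_unit _).symm hv
  have h3 : (fun t => 𝒢.mul (c t) (𝒢.unit (𝒢.src g))) =ᶠ[𝓝 0] c := by
    filter_upwards [hcf] with t ht
    rw [𝒢.tgt_unit] at ht
    rw [← ht, 𝒢.mul_unit]
  rw [← hm, h3.mfderiv_eq]
  exact hc1

end Mul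

/-- Right translation `A_{t g} → T_g G`, defined on the whole tangent space at the unit. -/
noncomputable def rightTrans (g : G) :
    TangentSpace (𝓡 p) (𝒢.unit (𝒢.tgt g)) →L[ℝ] TangentSpace (𝓡 p) g :=
  ((mfderivWithin ((𝓡 p).prod (𝓡 p)) (𝓡 p) (fun q : G × G => 𝒢.mul q.1 q.2)
    {q : G × G | 𝒢.src q.1 = 𝒢.tgt q.2} (𝒢.unit (𝒢.tgt g), g) :
      EuclideanSpace ℝ (Fin p) × EuclideanSpace ℝ (Fin p) →L[ℝ] EuclideanSpace ℝ (Fin p)) ∘L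
    ContinuousLinearMap.inl ℝ (EuclideanSpace ℝ (Fin p)) (EuclideanSpace ℝ (Fin p)))

theorem rightTrans_eq_dmul (g : G) (a : TangentSpace (𝓡 p) (𝒢.unit (𝒢.tgt g))) :
    (𝒢.rightTrans g a : EuclideanSpace ℝ (Fin p)) = 𝒢.dmul (𝒢.unit (𝒢.tgt g)) g a 0 :=
  rfl

theorem rightInv_eq (α : 𝒢.AlgSection) (g : G) :
    𝒢.rightInv α g = 𝒢.rightTrans g (α.val (𝒢.tgt g)) :=
  tangentCast_eq _ _

theorem mem_algFiber {x : M} {a : TangentSpace (𝓡 p) (𝒢.unit x)} :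
    a ∈ 𝒢.algFiber x ↔ 𝒢.dsrc (𝒢.unit x) a = 0 :=
  Iff.rfl

theorem dsrc_rightTrans {g : G} {a : TangentSpace (𝓡 p) (𝒢.unit (𝒢.tgt g))}
    (ha : a ∈ 𝒢.algFiber (𝒢.tgt g)) : 𝒢.dsrc g (𝒢.rightTrans g a) = 0 := by
  have h := 𝒢.dsrc_dmul (𝒢.src_unit (𝒢.tgt g)) ha
  have e : (_ : EuclideanSpace ℝ (Fin n)) = _ :=
    mfderiv_congr_point_vec (I := 𝓡 p) (I' := 𝓡 n) 𝒢.src (𝒢.unit_mul g)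
    (𝒢.dmul (𝒢.unit (𝒢.tgt g)) g a 0)
  exact e.symm.trans h

theorem rightTrans_unit {x : M} {a : TangentSpace (𝓡 p) (𝒢.unit x)} (ha : a ∈ 𝒢.algFiber x) :
    (𝒢.rightTrans (𝒢.unit x) (a : EuclideanSpace ℝ (Fin p)) : EuclideanSpace ℝ (Fin p)) = a := by
  have h := 𝒢.dmul_unit ha
  have e := 𝒢.dmul_congr (congrArg 𝒢.unit (𝒢.tgt_unit x))
    (congrArg 𝒢.unit (𝒢.src_unit x)).symm a 0
  exact e.trans h

/-- Right translation by `g⁻¹` undoes right translation by `g`; with the next lemma, right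
translation is a bijection from `A` at `t g` onto `ker ds` at `g`. -/
theorem dmul_inv_rightTrans {g : G} {a : TangentSpace (𝓡 p) (𝒢.unit (𝒢.tgt g))}
    (ha : a ∈ 𝒢.algFiber (𝒢.tgt g)) :
    (𝒢.dmul g (𝒢.inv g) (𝒢.rightTrans g a) 0 : EuclideanSpace ℝ (Fin p)) = a := by
  have h1 := 𝒢.dmul_dmul (h := g) (k := 𝒢.inv g) (𝒢.src_unit (𝒢.tgt g)) (𝒢.tgt_inv g).symm ha
  have h2 := 𝒢.dmul_unit ha
  have e1 := 𝒢.dmul_congr (𝒢.unit_mul g) (rfl : 𝒢.inv g = 𝒢.inv g)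
    (𝒢.dmul (𝒢.unit (𝒢.tgt g)) g a 0) 0
  have e2 := 𝒢.dmul_congr (rfl : 𝒢.unit (𝒢.tgt g) = 𝒢.unit (𝒢.tgt g))
    ((𝒢.mul_inv g).trans (congrArg 𝒢.unit (𝒢.src_unit (𝒢.tgt g)).symm)) a 0
  exact e1.symm.trans (h1.trans (e2.trans h2))

theorem exists_rightTrans_eq {g : G} {v : TangentSpace (𝓡 p) g} (hv : 𝒢.dsrc g v = 0) :
    ∃ a ∈ 𝒢.algFiber (𝒢.tgt g), 𝒢.rightTrans g a = v := by
  refine ⟨(𝒢.dmul g (𝒢.inv g) v 0 : EuclideanSpace ℝ (Fin p)), ?_, ?_⟩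
  · have h := 𝒢.dsrc_dmul (𝒢.tgt_inv g).symm hv
    have e : (_ : EuclideanSpace ℝ (Fin n)) = _ :=
      mfderiv_congr_point_vec (I := 𝓡 p) (I' := 𝓡 n) 𝒢.src (𝒢.mul_inv g)
      (𝒢.dmul g (𝒢.inv g) v 0)
    exact e.symm.trans h
  · have h1 := 𝒢.dmul_dmul (k := g) (𝒢.tgt_inv g).symm (𝒢.src_inv g) hv
    have e1 := 𝒢.dmul_congr (𝒢.mul_inv g) (rfl : g = g) (𝒢.dmul g (𝒢.inv g) v 0) 0
    have e2 := 𝒢.dmul_congr (rfl : g = g) (𝒢.inv_mul g) v 0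
    exact e1.symm.trans (h1.trans (e2.trans (𝒢.dmul_unit hv)))

variable {𝒢} {H : TangentDistribution p G}

/-- Zero vectors belong to `H`, so composing with `0_g` or with the zero vector at `g⁻¹` preserves
`H`: the intersection of `H` with `ker ds` is right-invariant, determined by the symbol space. -/
theorem IsMultiplicative.rightTrans_mem_iff (hH : 𝒢.IsMultiplicative H) {g : G}
    {a : TangentSpace (𝓡 p) (𝒢.unit (𝒢.tgt g))} (ha : a ∈ 𝒢.algFiber (𝒢.tgt g)) :
    𝒢.rightTrans g a ∈ H.fiber g ↔ a ∈ H.fiber (𝒢.unit (𝒢.tgt g)) := by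
  constructor
  · intro h
    have h1 := hH.mul_mem g (𝒢.inv g) (𝒢.tgt_inv g).symm _ h 0 (Submodule.zero_mem _) (by
      rw [map_zero, 𝒢.dsrc_rightTrans ha]
      exact tangentCast_eq _ _)
    rw [← 𝒢.dmul_inv_rightTrans ha]
    exact H.mem_fiber_of_eq (𝒢.mul_inv g) h1
  · intro h
    exact H.mem_fiber_of_eq (𝒢.unit_mul g)
      (hH.mul_mem _ g (𝒢.src_unit _) _ h 0 (Submodule.zero_mem _) (by
        rw [map_zero, 𝒢.mem_algFiber.1 ha]
        exact tangentCast_eq _ _))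

/-- The source map restricts to a fibrewise surjection on a multiplicative distribution. -/
theorem IsMultiplicative.exists_dsrc_eq (hH : 𝒢.IsMultiplicative H) (g : G)
    (X : TangentSpace (𝓡 n) (𝒢.src g)) : ∃ v ∈ H.fiber g, 𝒢.dsrc g v = X := by
  have hfd : ∀ g : G, FiniteDimensional ℝ (TangentSpace (𝓡 p) g) := fun g =>
    inferInstanceAs (FiniteDimensional ℝ (EuclideanSpace ℝ (Fin p)))
  have hfd' : ∀ x : M, FiniteDimensional ℝ (TangentSpace (𝓡 n) x) := fun x =>
    inferInstanceAs (FiniteDimensional ℝ (EuclideanSpace ℝ (Fin n)))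
  have hdim : ∀ x : M, Module.finrank ℝ (TangentSpace (𝓡 n) x) = n := fun x =>
    finrank_euclideanSpace_fin (𝕜 := ℝ)
  set L : ∀ g : G, H.fiber g →ₗ[ℝ] TangentSpace (𝓡 n) (𝒢.src g) := fun g =>
    (𝒢.dsrc g).toLinearMap.domRestrict (H.fiber g) with hL
  have hrn : ∀ g, Module.finrank ℝ (LinearMap.range (L g)) +
      Module.finrank ℝ (LinearMap.ker (L g)) = H.rank := by
    intro g
    rw [LinearMap.finrank_range_add_finrank_ker, H.finrank_fiber]
  have hunit : ∀ x, LinearMap.range (L (𝒢.unit x)) = ⊤ := by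
    intro x
    rw [LinearMap.range_eq_top]
    intro X
    obtain ⟨Y, hY⟩ : ∃ Y : TangentSpace (𝓡 n) x, (Y : EuclideanSpace ℝ (Fin n)) = X := ⟨_, rfl⟩
    exact ⟨⟨𝒢.dunit x Y, hH.unit_mem x Y⟩, (𝒢.dsrc_dunit x Y).trans hY⟩
  -- The kernel of `ds` on `H` has the same dimension at `g` as at the unit of `t g`, by right
  -- translation. Since `H` has constant rank, rank-nullity carries surjectivity from the unit,
  -- where `du` splits `ds`, to `g`.
  have hker : Module.finrank ℝ (LinearMap.ker (L (𝒢.unit (𝒢.tgt g)))) =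
      Module.finrank ℝ (LinearMap.ker (L g)) := by
    let T : LinearMap.ker (L (𝒢.unit (𝒢.tgt g))) →ₗ[ℝ] LinearMap.ker (L g) :=
      { toFun := fun a => ⟨⟨𝒢.rightTrans g a.1.1, (hH.rightTrans_mem_iff a.2).2 a.1.2⟩,
          𝒢.dsrc_rightTrans a.2⟩
        map_add' := fun a b => Subtype.ext (Subtype.ext (map_add (𝒢.rightTrans g) _ _))
        map_smul' := fun r a => Subtype.ext (Subtype.ext (map_smul (𝒢.rightTrans g) _ _)) }
    refine (LinearEquiv.ofBijective T ⟨?_, ?_⟩).finrank_eq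
    · intro a b hab
      have h1 : 𝒢.rightTrans g a.1.1 = 𝒢.rightTrans g b.1.1 :=
        congrArg (fun z : LinearMap.ker (L g) => z.1.1) hab
      refine Subtype.ext (Subtype.ext ?_)
      have h2 := 𝒢.dmul_inv_rightTrans (a := a.1.1) a.2
      rw [h1] at h2
      exact h2.symm.trans (𝒢.dmul_inv_rightTrans (a := b.1.1) b.2)
    · rintro ⟨⟨v, hv⟩, hv'⟩
      obtain ⟨a, ha, rfl⟩ := 𝒢.exists_rightTrans_eq hv'
      exact ⟨⟨⟨a, (hH.rightTrans_mem_iff ha).1 hv⟩, ha⟩, rfl⟩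
  have htop : LinearMap.range (L g) = ⊤ := by
    apply Submodule.eq_top_of_finrank_eq
    have h1 := hrn (𝒢.unit (𝒢.tgt g))
    have h2 := hrn g
    rw [hunit, finrank_top, hdim, hker] at h1
    rw [hdim]
    omega
  obtain ⟨v, hv⟩ := LinearMap.range_eq_top.1 htop X
  exact ⟨v.1, v.2, hv⟩

end LieGroupoid

/-! ### Right-invariant vector fields and sections of the algebroid. -/

namespace LieGroupoid

variable {p n : ℕ} {G M : Type*}
  [TopologicalSpace G] [ChartedSpace (EuclideanSpace ℝ (Fin p)) G] [IsManifold (𝓡 p) ∞ G]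
  [TopologicalSpace M] [ChartedSpace (EuclideanSpace ℝ (Fin n)) M] [IsManifold (𝓡 n) ∞ M]
  {𝒢 : LieGroupoid p n G M} {H : TangentDistribution p G}

/-- The composition is smooth on composable pairs only, so the first factor is first retracted onto
the right source fibre. The resulting map is smooth near a point of the full product, and its
partial derivative along the section gives the right-invariant field. -/
theorem smooth_rightInv (α : 𝒢.AlgSection) (g₀ : G) : SmoothFieldAt (𝒢.rightInv α) g₀ := by
  obtain ⟨C, hCs, hCf, hCx⟩ :=
    (𝒢.src_submersion.isSubmersionAt (𝒢.unit (𝒢.tgt g₀))).exists_fiber_retraction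
  rw [𝒢.src_unit] at hCs hCf
  set f : G → G → G := fun g a => 𝒢.mul (C (𝒢.tgt g, a)) g with hf
  have hp : ContMDiffAt ((𝓡 p).prod (𝓡 p)) ((𝓡 n).prod (𝓡 p)) ∞
      (fun q : G × G => (𝒢.tgt q.1, q.2)) (g₀, 𝒢.unit (𝒢.tgt g₀)) :=
    ((𝒢.tgt_smooth g₀).comp (g₀, 𝒢.unit (𝒢.tgt g₀)) contMDiffAt_fst).prodMk contMDiffAt_snd
  have hfs : ContMDiffAt ((𝓡 p).prod (𝓡 p)) (𝓡 p) ∞ (Function.uncurry f)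
      (g₀, 𝒢.unit (𝒢.tgt g₀)) := by
    refine 𝒢.contMDiffAt_mul (f := fun q : G × G => C (𝒢.tgt q.1, q.2)) (k := Prod.fst) ?_
      contMDiffAt_fst ?_
    · exact ContMDiffAt.comp (g := C) (f := fun q : G × G => (𝒢.tgt q.1, q.2)) _
        hCs.self_of_nhds hp
    · exact hp.continuousAt.eventually hCf
  have hus : ContMDiffAt (𝓡 p) (𝓡 p) ∞ (fun g => 𝒢.unit (𝒢.tgt g)) g₀ :=
    (𝒢.unit_smooth _).comp g₀ (𝒢.tgt_smooth g₀)
  have hα : ContMDiffAt (𝓡 p) (𝓡 p).tangent ∞ (fun g => (⟨𝒢.unit (𝒢.tgt g),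
      (α.val (𝒢.tgt g) : TangentSpace (𝓡 p) (𝒢.unit (𝒢.tgt g)))⟩ : TangentBundle (𝓡 p) G)) g₀ :=
    (α.smooth _).comp g₀ (𝒢.tgt_smooth g₀)
  refine (ContMDiffAt.mfderiv_apply_section hfs hα).congr_of_eventuallyEq ?_
  have hpair : Filter.Tendsto (fun g => (𝒢.tgt g, 𝒢.unit (𝒢.tgt g))) (𝓝 g₀)
      (𝓝 (𝒢.tgt g₀, 𝒢.unit (𝒢.tgt g₀))) :=
    ((𝒢.tgt_smooth g₀).continuousAt.prodMk hus.continuousAt).tendsto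
  filter_upwards [hpair.eventually (hCs.and hCf).eventually_nhds,
    hus.continuousAt.eventually hCx.eventually_nhds] with g h1 h2
  have e0 : C (𝒢.tgt g, 𝒢.unit (𝒢.tgt g)) = 𝒢.unit (𝒢.tgt g) := by
    have := h2.self_of_nhds
    rwa [𝒢.src_unit] at this
  have e1 : f g (𝒢.unit (𝒢.tgt g)) = g := by
    simp only [hf]
    rw [e0, 𝒢.unit_mul]
  have hslice : Filter.Tendsto (fun a : G => (𝒢.tgt g, a)) (𝓝 (𝒢.unit (𝒢.tgt g)))
      (𝓝 (𝒢.tgt g, 𝒢.unit (𝒢.tgt g))) := by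
    have : Continuous (fun a : G => (𝒢.tgt g, a)) := by fun_prop
    exact this.tendsto _
  have hCd : MDifferentiableAt ((𝓡 n).prod (𝓡 p)) (𝓡 p) C (𝒢.tgt g, 𝒢.unit (𝒢.tgt g)) :=
    h1.self_of_nhds.1.mdifferentiableAt (by simp)
  have hsd : MDifferentiableAt (𝓡 p) (𝓡 p) (fun a => C (𝒢.tgt g, a)) (𝒢.unit (𝒢.tgt g)) :=
    MDifferentiableAt.comp (𝒢.unit (𝒢.tgt g)) hCd
      (mdifferentiableAt_const.prodMk mdifferentiableAt_id)
  have e2 := 𝒢.mfderiv_mul hsd (mdifferentiableAt_const (c := g))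
    ((hslice.eventually h1).mono fun a ha => ha.2) (α.val (𝒢.tgt g) : TangentSpace (𝓡 p) _)
  have hav : mfderiv (𝓡 p) (𝓡 n) 𝒢.src (𝒢.unit (𝒢.tgt g))
      (α.val (𝒢.tgt g) : TangentSpace (𝓡 p) _) = 0 := (α.val (𝒢.tgt g)).2
  have e3 := mfderiv_fiber_retraction (𝒢.mdiff_src _) (by rw [𝒢.src_unit]; exact hCd) h2
    (α.val (𝒢.tgt g) : TangentSpace (𝓡 p) _)
  have e4 := mfderiv_comp (𝒢.unit (𝒢.tgt g)) (g := C) (f := fun a => (𝒢.tgt g, id a)) hCd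
    (mdifferentiableAt_const.prodMk mdifferentiableAt_id)
  rw [mfderiv_prodMk mdifferentiableAt_const mdifferentiableAt_id, mfderiv_const, mfderiv_id] at e4
  rw [hav] at e3
  have e5 : (mfderiv (𝓡 p) (𝓡 p) (fun a => C (𝒢.tgt g, a)) (𝒢.unit (𝒢.tgt g))
      (α.val (𝒢.tgt g) : TangentSpace (𝓡 p) _) : EuclideanSpace ℝ (Fin p)) =
      (α.val (𝒢.tgt g) : TangentSpace (𝓡 p) (𝒢.unit (𝒢.tgt g))) := by
    refine (congrArg (fun L : EuclideanSpace ℝ (Fin p) →L[ℝ] EuclideanSpace ℝ (Fin p) =>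
      L (α.val (𝒢.tgt g)).1) e4).trans (Eq.trans ?_ e3)
    exact mfderiv_congr_point_vec (I := (𝓡 n).prod (𝓡 p)) (I' := 𝓡 p) C
      (show (𝒢.tgt g, 𝒢.unit (𝒢.tgt g)) = (𝒢.src (𝒢.unit (𝒢.tgt g)), 𝒢.unit (𝒢.tgt g)) by
        rw [𝒢.src_unit]) _
  rw [mfderiv_const] at e2
  refine Eq.trans ?_ (totalSpace_mk_eq e1 _).symm
  refine congrArg (fun w : EuclideanSpace ℝ (Fin p) => (⟨g, w⟩ : TangentBundle (𝓡 p) G)) ?_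
  refine Eq.trans ?_ e2.symm
  rw [e5, 𝒢.rightInv_eq, 𝒢.rightTrans_eq_dmul]
  exact 𝒢.dmul_congr e0.symm rfl _ _

/-- The right-invariant vector field of a section of the Lie algebroid. -/
noncomputable def AlgSection.rightField (α : 𝒢.AlgSection) : VField p G where
  val := 𝒢.rightInv α
  smooth := smooth_rightInv α

theorem dsrc_rightInv (α : 𝒢.AlgSection) (g : G) : 𝒢.dsrc g (𝒢.rightInv α g) = 0 := by
  rw [𝒢.rightInv_eq]
  exact 𝒢.dsrc_rightTrans (α.val _).2

theorem rightInv_unit (α : 𝒢.AlgSection) (x : M) :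
    𝒢.rightInv α (𝒢.unit x) = α.val x := by
  rw [𝒢.rightInv_eq]
  have h : ∀ y : M, y = x → ((α.val y : TangentSpace (𝓡 p) (𝒢.unit y)) : EuclideanSpace ℝ (Fin p)) =
      (α.val x : TangentSpace (𝓡 p) (𝒢.unit x)) := by
    rintro y rfl
    rfl
  refine Eq.trans ?_ (𝒢.rightTrans_unit (α.val x).2)
  exact congrArg (𝒢.rightTrans (𝒢.unit x)) (h _ (𝒢.tgt_unit x))

/-- The restriction to the units of a vector field with values in the algebroid. -/
noncomputable def AlgSection.ofField (Z : VField p G) (hZ : ∀ x, Z.val (𝒢.unit x) ∈ 𝒢.algFiber x) :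
    𝒢.AlgSection where
  val x := ⟨Z.val (𝒢.unit x), hZ x⟩
  smooth := fun x => (Z.smooth _).comp x (𝒢.unit_smooth x)

/-- The section `α + f β`. -/
noncomputable def AlgSection.addSMul (α β : 𝒢.AlgSection) (f : M → ℝ)
    (hf : ContMDiff (𝓡 n) 𝓘(ℝ, ℝ) ∞ f) :
    𝒢.AlgSection where
  val x := α.val x + f x • β.val x
  smooth := fun x => (α.smooth x).add_smul_along (β.smooth x) (hf x)

/-- A vector field on `G` minus its `ds`-component, along the units. -/
noncomputable def AlgSection.project (Z : VField p G) : 𝒢.AlgSection where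
  val x := ⟨Z.val (𝒢.unit x) + (-1 : ℝ) • 𝒢.dunit x (𝒢.dsrc (𝒢.unit x) (Z.val (𝒢.unit x)) :
      EuclideanSpace ℝ (Fin n)), by
    rw [𝒢.mem_algFiber, map_add, map_smul]
    have h := 𝒢.dsrc_dunit x (𝒢.dsrc (𝒢.unit x) (Z.val (𝒢.unit x)) : EuclideanSpace ℝ (Fin n))
    refine (congrArg (fun w : EuclideanSpace ℝ (Fin n) =>
      (show EuclideanSpace ℝ (Fin n) from 𝒢.dsrc (𝒢.unit x) (Z.val (𝒢.unit x))) +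
        (-1 : ℝ) • w) h).trans ?_
    have h0 : ∀ w : EuclideanSpace ℝ (Fin n), w + (-1 : ℝ) • w = 0 := fun w => by
      rw [neg_one_smul, add_neg_cancel]
    exact h0 _⟩
  smooth := fun x => by
    have h1 : ContMDiffAt (𝓡 n) (𝓡 p).tangent ∞
        (fun x => (⟨𝒢.unit x, Z.val (𝒢.unit x)⟩ : TangentBundle (𝓡 p) G)) x :=
      (Z.smooth _).comp x (𝒢.unit_smooth x)
    have h2 := ContMDiffAt.mfderiv_apply_field (𝒢.src_smooth (𝒢.unit x)) h1
    have h3 : ContMDiffAt (𝓡 n) (𝓡 n).tangent ∞ (fun x => (⟨x,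
        (𝒢.dsrc (𝒢.unit x) (Z.val (𝒢.unit x)) : EuclideanSpace ℝ (Fin n))⟩ :
        TangentBundle (𝓡 n) M)) x := by
      refine h2.congr_of_eventuallyEq (Filter.Eventually.of_forall fun y => ?_)
      exact (totalSpace_mk_eq (𝒢.src_unit y) _).symm
    have h4 := ContMDiffAt.mfderiv_apply_field (g := id) (𝒢.unit_smooth x) h3
    exact h1.add_smul_along h4 contMDiffAt_const

theorem AlgSection.project_val_of_mem (Z : VField p G) {x : M}
    (h : Z.val (𝒢.unit x) ∈ 𝒢.algFiber x) :
    (((AlgSection.project (𝒢 := 𝒢) Z).val x : TangentSpace (𝓡 p) (𝒢.unit x))) =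
      Z.val (𝒢.unit x) := by
  change Z.val (𝒢.unit x) + (-1 : ℝ) • 𝒢.dunit x (𝒢.dsrc (𝒢.unit x) (Z.val (𝒢.unit x)) :
      EuclideanSpace ℝ (Fin n)) = _
  rw [𝒢.mem_algFiber.1 h]
  have : 𝒢.dunit x ((0 : TangentSpace (𝓡 n) (𝒢.src (𝒢.unit x))) : EuclideanSpace ℝ (Fin n)) = 0 :=
    map_zero (𝒢.dunit x)
  rw [this, smul_zero, add_zero]

theorem AlgSection.exists_eq [T2Space G] [SecondCountableTopology G] {x : M}
    (a : 𝒢.algFiber x) : ∃ α : 𝒢.AlgSection, α.val x = a := by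
  obtain ⟨Z, hZ⟩ := VField.exists_eq (𝒢.unit x) (a : TangentSpace (𝓡 p) (𝒢.unit x))
  refine ⟨AlgSection.project Z, Subtype.ext ?_⟩
  rw [AlgSection.project_val_of_mem Z (by rw [hZ]; exact a.2), hZ]

/-- Removing the unit component from a field tangent to `H` stays in `H`, because `H` contains the
image of `du`. This produces sections of the symbol space through any value. -/
theorem IsMultiplicative.exists_symbolSection_eq [T2Space G] [SecondCountableTopology G]
    (hH : 𝒢.IsMultiplicative H) {x : M} {a : 𝒢.algFiber x} (ha : a ∈ 𝒢.symbolFiber H x) :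
    ∃ β : 𝒢.SymbolSection H, β.1.val x = a := by
  obtain ⟨Z, hZ, hZH⟩ := H.exists_vField (x := 𝒢.unit x) (v := a) ha
  refine ⟨⟨AlgSection.project Z, fun y => ?_⟩, Subtype.ext ?_⟩
  · exact Submodule.add_mem _ (hZH _) (Submodule.smul_mem _ _ (hH.unit_mem y _))
  · rw [AlgSection.project_val_of_mem Z (by rw [hZ]; exact a.2), hZ]

theorem IsMultiplicative.rightInv_mem (hH : 𝒢.IsMultiplicative H) {α : 𝒢.AlgSection} {g : G} :
    𝒢.rightInv α g ∈ H.fiber g ↔ α.val (𝒢.tgt g) ∈ 𝒢.symbolFiber H (𝒢.tgt g) := by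
  rw [𝒢.rightInv_eq, hH.rightTrans_mem_iff (α.val _).2]
  rfl

end LieGroupoid

/-! ### Existence of lifts tangent to the distribution. -/

namespace LieGroupoid

variable {p n : ℕ} {G M : Type*}
  [TopologicalSpace G] [ChartedSpace (EuclideanSpace ℝ (Fin p)) G] [IsManifold (𝓡 p) ∞ G]
  [TopologicalSpace M] [ChartedSpace (EuclideanSpace ℝ (Fin n)) M] [IsManifold (𝓡 n) ∞ M]
  {𝒢 : LieGroupoid p n G M} {H : TangentDistribution p G}

/-- Vector fields on the base lift locally along the source map. -/
theorem exists_local_projectable (X : VField n M) (g₀ : G) :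
    ∃ s : ∀ g : G, TangentSpace (𝓡 p) g,
      ∀ᶠ g in 𝓝 g₀, SmoothFieldAt s g ∧ 𝒢.dsrc g (s g) = X.val (𝒢.src g) := by
  obtain ⟨B, hBs, hBf, hBx⟩ := (𝒢.src_submersion.isSubmersionAt g₀).exists_fiber_retraction
  -- The map `y ↦ B (y, g)` is a local section of the source through `g`; the lift at `g` is the
  -- image of `X` under its differential.
  set s : ∀ g : G, TangentSpace (𝓡 p) g := fun g =>
    (mfderiv (𝓡 n) (𝓡 p) (fun y => B (y, g)) (𝒢.src g) (X.val (𝒢.src g)) :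
      EuclideanSpace ℝ (Fin p)) with hs
  refine ⟨s, ?_⟩
  have hpair : Filter.Tendsto (fun g => (𝒢.src g, g)) (𝓝 g₀) (𝓝 (𝒢.src g₀, g₀)) :=
    ((𝒢.src_smooth g₀).continuousAt.prodMk continuousAt_id).tendsto
  filter_upwards [hpair.eventually (hBs.and hBf).eventually_nhds, hBx.eventually_nhds] with g h1 h2
  constructor
  · have hf : ContMDiffAt ((𝓡 p).prod (𝓡 n)) (𝓡 p) ∞ (Function.uncurry fun g y => B (y, g))
        (g, 𝒢.src g) :=
      ContMDiffAt.comp (g := B) (f := fun q : G × M => (q.2, q.1)) _ h1.self_of_nhds.1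
        (contMDiffAt_snd.prodMk contMDiffAt_fst)
    have hX : ContMDiffAt (𝓡 p) (𝓡 n).tangent ∞
        (fun g => (⟨𝒢.src g, X.val (𝒢.src g)⟩ : TangentBundle (𝓡 n) M)) g :=
      (X.smooth _).comp g (𝒢.src_smooth g)
    refine (ContMDiffAt.mfderiv_apply_section hf hX).congr_of_eventuallyEq ?_
    filter_upwards [h2] with k hk
    exact (totalSpace_mk_eq hk _).symm
  · have hslice : Filter.Tendsto (fun y : M => (y, g)) (𝓝 (𝒢.src g)) (𝓝 (𝒢.src g, g)) := by
      have : Continuous (fun y : M => (y, g)) := by fun_prop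
      exact this.tendsto _
    have hd : MDifferentiableAt (𝓡 n) (𝓡 p) (fun y => B (y, g)) (𝒢.src g) :=
      MDifferentiableAt.comp (𝒢.src g) (h1.self_of_nhds.1.mdifferentiableAt (by simp))
        (mdifferentiableAt_id.prodMk mdifferentiableAt_const)
    have h3 := mfderiv_comp (𝒢.src g) (𝒢.mdiff_src (B (𝒢.src g, g))) hd
    have h4 : 𝒢.src ∘ (fun y => B (y, g)) =ᶠ[𝓝 (𝒢.src g)] id :=
      (hslice.eventually h1).mono fun y hy => hy.2
    rw [h4.mfderiv_eq, mfderiv_id] at h3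
    have h5 := congrArg (fun L : EuclideanSpace ℝ (Fin n) →L[ℝ] EuclideanSpace ℝ (Fin n) =>
      L (X.val (𝒢.src g))) h3
    exact (mfderiv_congr_point_vec (I := 𝓡 p) (I' := 𝓡 n) 𝒢.src h2.self_of_nhds (s g)).symm.trans
      h5.symm

/-- Right-invariant vector fields through a vector tangent to the source fibre. -/
theorem exists_rightInv_eq [T2Space G] [SecondCountableTopology G] {g : G}
    {v : TangentSpace (𝓡 p) g} (hv : 𝒢.dsrc g v = 0) :
    ∃ α : 𝒢.AlgSection, 𝒢.rightInv α g = v := by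
  obtain ⟨a, ha, hav⟩ := 𝒢.exists_rightTrans_eq hv
  obtain ⟨α, hα⟩ := AlgSection.exists_eq (𝒢 := 𝒢) ⟨a, ha⟩
  exact ⟨α, by rw [𝒢.rightInv_eq, hα, ← hav]⟩

theorem IsMultiplicative.exists_symbolSection_rightInv_eq [T2Space G] [SecondCountableTopology G]
    (hH : 𝒢.IsMultiplicative H) {g : G}
    {v : TangentSpace (𝓡 p) g} (hv : 𝒢.dsrc g v = 0) (hvH : v ∈ H.fiber g) :
    ∃ β : 𝒢.SymbolSection H, 𝒢.rightInv β.1 g = v := by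
  obtain ⟨a, ha, rfl⟩ := 𝒢.exists_rightTrans_eq hv
  obtain ⟨β, hβ⟩ := hH.exists_symbolSection_eq (x := 𝒢.tgt g) (a := ⟨a, ha⟩)
    ((hH.rightTrans_mem_iff ha).1 hvH)
  exact ⟨β, by rw [𝒢.rightInv_eq, hβ]⟩

theorem finiteDimensional_tangentSpace (g : G) : FiniteDimensional ℝ (TangentSpace (𝓡 p) g) :=
  inferInstanceAs (FiniteDimensional ℝ (EuclideanSpace ℝ (Fin p)))

theorem finrank_tangentSpace (g : G) : Module.finrank ℝ (TangentSpace (𝓡 p) g) = p :=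
  finrank_euclideanSpace_fin (𝕜 := ℝ)

theorem finrank_ker_dsrc (g : G) :
    n + Module.finrank ℝ (LinearMap.ker (𝒢.dsrc g).toLinearMap) = p := by
  have := finiteDimensional_tangentSpace (p := p) g
  have h := LinearMap.finrank_range_add_finrank_ker (𝒢.dsrc g).toLinearMap
  have hr : LinearMap.range (𝒢.dsrc g).toLinearMap = ⊤ :=
    LinearMap.range_eq_top.2 (𝒢.src_submersion.isSubmersionAt g).mfderiv_surjective
  rw [hr, finrank_top] at h
  exact (congrArg (· + _) (finrank_tangentSpace (p := n) (𝒢.src g))).symm.trans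
    (h.trans (finrank_tangentSpace g))

/-- A local source lift of `X` is expanded in a frame made of fields tangent to `H`, whose images
under `ds` form a basis at `g₀`, and of right-invariant fields. The latter are vertical for the
source, so dropping them leaves a lift tangent to `H`. -/
theorem IsMultiplicative.exists_local_projectable_mem [T2Space G] [SecondCountableTopology G]
    (hH : 𝒢.IsMultiplicative H) (X : VField n M) (g₀ : G) :
    ∃ s : ∀ g : G, TangentSpace (𝓡 p) g, ∀ᶠ g in 𝓝 g₀, SmoothFieldAt s g ∧
      s g ∈ H.fiber g ∧ 𝒢.dsrc g (s g) = X.val (𝒢.src g) := by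
  have := finiteDimensional_tangentSpace (p := p) g₀
  have := finiteDimensional_tangentSpace (p := n) (𝒢.src g₀)
  obtain ⟨s, hs⟩ := exists_local_projectable (𝒢 := 𝒢) X g₀
  set bM := Module.finBasis ℝ (TangentSpace (𝓡 n) (𝒢.src g₀))
  set bK := Module.finBasis ℝ (LinearMap.ker (𝒢.dsrc g₀).toLinearMap)
  choose w hwH hw using fun i => hH.exists_dsrc_eq g₀ (bM i)
  choose Z hZ hZH using fun i => H.exists_vField (hwH i)
  choose α hα using fun i => exists_rightInv_eq (𝒢 := 𝒢) (g := g₀) (bK i).2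
  set Y : _ ⊕ _ → VField p G := Sum.elim Z (fun i => (α i).rightField) with hY
  have hli : LinearIndependent ℝ (fun i => (Y i).val g₀) := by
    have h1 : LinearIndependent ℝ ((𝒢.dsrc g₀).toLinearMap ∘ fun i => (Z i).val g₀) := by
      have : ((𝒢.dsrc g₀).toLinearMap ∘ fun i => (Z i).val g₀) = bM := by
        funext i
        change 𝒢.dsrc g₀ ((Z i).val g₀) = _
        rw [hZ, hw]
      rw [this]
      exact bM.linearIndependent
    have h2 : LinearIndependent ℝ (fun i => (α i).rightField.val g₀) := by
      have : (fun i => (α i).rightField.val g₀) = fun i => (bK i : TangentSpace (𝓡 p) g₀) :=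
        funext hα
      rw [this]
      exact bK.linearIndependent.map' (Submodule.subtype _) (Submodule.ker_subtype _)
    have h3 := (LinearIndependent.of_comp _ h1).sum_type h2
      ((Submodule.range_ker_disjoint h1).mono_right (by
        rw [Submodule.span_le]
        rintro _ ⟨i, rfl⟩
        exact dsrc_rightInv (α i) g₀))
    have e : (fun i => (Y i).val g₀) =
        Sum.elim (fun i => (Z i).val g₀) fun i => (α i).rightField.val g₀ := by
      ext1 i
      cases i <;> rfl
    rw [e]
    exact h3
  obtain ⟨θ, hθ⟩ := exists_dual_coframe (I := 𝓡 p) (Z := fun i => (Y i).val)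
    (fun i => Filter.Eventually.of_forall fun x => (Y i).smooth x) hli (by
      rw [Fintype.card_sum, Fintype.card_fin, Fintype.card_fin,
        finrank_tangentSpace (p := n) (𝒢.src g₀), finrank_ker_dsrc]
      exact (finrank_tangentSpace g₀).symm)
  refine ⟨fun g => ∑ i, θ g (mvfderiv (𝓡 p) (extChartAt (𝓡 p) g₀) g (s g)) (Sum.inl i) •
    (Z i).val g, ?_⟩
  filter_upwards [hθ, hs, (chartAt (EuclideanSpace ℝ (Fin p)) g₀).open_source.mem_nhds
    (mem_chart_source _ g₀)] with g h1 h2 h3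
  refine ⟨SmoothFieldAt.sum fun i _ => SmoothFieldAt.smul ?_ ((Z i).smoothAt g),
    Submodule.sum_mem _ fun i _ => Submodule.smul_mem _ _ (hZH i g), ?_⟩
  · exact contMDiffAt_pi_space.1 (h1.1.coframe_apply h3 h2.1) (Sum.inl i)
  · have h4 : 𝒢.dsrc g (∑ i, θ g (mvfderiv (𝓡 p) (extChartAt (𝓡 p) g₀) g (s g)) (Sum.inr i) •
        (Y (Sum.inr i)).val g) = 0 := by
      rw [map_sum]
      refine Finset.sum_eq_zero fun i _ => ?_
      rw [map_smul]
      have : 𝒢.dsrc g ((Y (Sum.inr i)).val g) = 0 := dsrc_rightInv (α i) g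
      rw [this, smul_zero]
    have h5 := congrArg (𝒢.dsrc g) (h1.2.2 (s g))
    rw [Fintype.sum_sum_type, map_add, h4, add_zero] at h5
    exact h5.symm.trans h2.2

/-- Both conditions are affine on each tangent space, hence convex, so local solutions can be glued.
-/
theorem IsMultiplicative.exists_projectable [T2Space G] [SecondCountableTopology G]
    (hH : 𝒢.IsMultiplicative H) (X : VField n M) :
    ∃ V : VField p G, ∀ g, V.val g ∈ H.fiber g ∧ 𝒢.dsrc g (V.val g) = X.val (𝒢.src g) := by
  refine VField.exists_mem_of_local
    (fun g => {w | w ∈ H.fiber g ∧ 𝒢.dsrc g w = X.val (𝒢.src g)}) (fun g => ?_)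
    (fun g₀ => hH.exists_local_projectable_mem X g₀)
  intro v hv w hw a b _ _ hab
  refine ⟨Submodule.add_mem _ (Submodule.smul_mem _ _ hv.1) (Submodule.smul_mem _ _ hw.1), ?_⟩
  rw [map_add, map_smul, map_smul, hv.2, hw.2, ← add_smul, hab, one_smul]

theorem IsMultiplicative.exists_isLift [T2Space G] [SecondCountableTopology G]
    (hH : 𝒢.IsMultiplicative H) (X : VField n M) : ∃ V : VField p G, 𝒢.IsLift H X V := by
  obtain ⟨V, hV⟩ := hH.exists_projectable X
  have hker : ∀ x, 𝒢.dunit x (X.val x) + (-1 : ℝ) • V.val (𝒢.unit x) ∈ 𝒢.algFiber x := by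
    intro x
    rw [𝒢.mem_algFiber, map_add, map_smul, (hV _).2]
    have h1 := 𝒢.dsrc_dunit x (X.val x)
    have h2 : ∀ y, y = x → (X.val y : EuclideanSpace ℝ (Fin n)) = X.val x := by
      rintro y rfl
      rfl
    have h0 : ∀ w w' : EuclideanSpace ℝ (Fin n), w = w' → w + (-1 : ℝ) • w' = 0 := by
      rintro w _ rfl
      rw [neg_one_smul, add_neg_cancel]
    exact h0 _ _ (h1.trans (h2 _ (𝒢.src_unit x)).symm)
  -- The error of `V` along the units is vertical for the source and lies in `H`, so it is a section
  -- of the symbol space. Adding its right-invariant extension corrects `V` on the units without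
  -- leaving `H` or changing its projection.
  let γ : 𝒢.AlgSection :=
    { val := fun x => ⟨𝒢.dunit x (X.val x) + (-1 : ℝ) • V.val (𝒢.unit x), hker x⟩
      smooth := fun x => (ContMDiffAt.mfderiv_apply_field (g := id) (𝒢.unit_smooth x)
        (X.smooth x)).add_smul_along ((V.smooth _).comp x (𝒢.unit_smooth x)) contMDiffAt_const }
  refine ⟨⟨V.val + γ.rightField.val, fun g => (V.smoothAt g).add (γ.rightField.smoothAt g)⟩,
    fun g => ?_, fun g => ?_, fun x => ?_⟩
  · refine Submodule.add_mem _ (hV g).1 (hH.rightInv_mem.2 ?_)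
    exact Submodule.add_mem _ (hH.unit_mem _ _) (Submodule.smul_mem _ _ (hV _).1)
  · change 𝒢.dsrc g (V.val g + 𝒢.rightInv γ g) = _
    rw [map_add, dsrc_rightInv, add_zero, (hV g).2]
  · change V.val (𝒢.unit x) + 𝒢.rightInv γ (𝒢.unit x) = _
    rw [rightInv_unit]
    change V.val (𝒢.unit x) + (𝒢.dunit x (X.val x) + (-1 : ℝ) • V.val (𝒢.unit x)) = _
    rw [neg_one_smul]
    abel

end LieGroupoid

/-! ### Brackets with right-invariant fields as right translates of brackets at the units. -/

namespace LieGroupoid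

variable {p n : ℕ} {G M : Type*}
  [TopologicalSpace G] [ChartedSpace (EuclideanSpace ℝ (Fin p)) G] [IsManifold (𝓡 p) ∞ G]
  [TopologicalSpace M] [ChartedSpace (EuclideanSpace ℝ (Fin n)) M] [IsManifold (𝓡 n) ∞ M]
  {𝒢 : LieGroupoid p n G M} {H : TangentDistribution p G}

theorem field_eq_of_eq {m : ℕ} {N : Type*} [TopologicalSpace N]
    [ChartedSpace (EuclideanSpace ℝ (Fin m)) N] (V : ∀ x : N, TangentSpace (𝓡 m) x) {x y : N}
    (h : x = y) : (V x : EuclideanSpace ℝ (Fin m)) = V y := by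
  subst h
  rfl

/-- Associativity, with `t (a b) = t a`: right translation by `b` carries the right-invariant field
to itself. -/
theorem rightInv_mul (α : 𝒢.AlgSection) {a b : G} (hab : 𝒢.src a = 𝒢.tgt b) :
    (𝒢.dmul a b (𝒢.rightInv α a) 0 : EuclideanSpace ℝ (Fin p)) = 𝒢.rightInv α (𝒢.mul a b) := by
  rw [𝒢.rightInv_eq, 𝒢.rightInv_eq, 𝒢.rightTrans_eq_dmul]
  have h1 := 𝒢.dmul_dmul (k := b) (𝒢.src_unit (𝒢.tgt a)) hab (α.val (𝒢.tgt a)).2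
  have h2 := 𝒢.dmul_congr (𝒢.unit_mul a) (rfl : b = b) (𝒢.dmul (𝒢.unit (𝒢.tgt a)) a
    (α.val (𝒢.tgt a)).1 0) 0
  refine h2.symm.trans (h1.trans ?_)
  have h3 : ∀ y, y = 𝒢.tgt a → (𝒢.dmul (𝒢.unit (𝒢.tgt a)) (𝒢.mul a b) (α.val (𝒢.tgt a)).1 0 :
      EuclideanSpace ℝ (Fin p)) = 𝒢.dmul (𝒢.unit y) (𝒢.mul a b) (α.val y).1 0 := by
    rintro _ rfl
    rfl
  exact h3 _ (𝒢.tgt_mul a b hab)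

theorem dmul_dunit_dtgt (g : G) (v : TangentSpace (𝓡 p) g) :
    (𝒢.dmul (𝒢.unit (𝒢.tgt g)) g (𝒢.dunit (𝒢.tgt g) (𝒢.dtgt g v)) v :
      EuclideanSpace ℝ (Fin p)) = v := by
  have hd : MDifferentiableAt (𝓡 p) (𝓡 p) (𝒢.unit ∘ 𝒢.tgt) g :=
    (𝒢.mdiff_unit _).comp g (𝒢.mdiff_tgt g)
  have h1 := 𝒢.mfderiv_mul hd mdifferentiableAt_id
    (Filter.Eventually.of_forall fun k => 𝒢.src_unit (𝒢.tgt k)) v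
  have h2 : (fun k => 𝒢.mul ((𝒢.unit ∘ 𝒢.tgt) k) (id k)) = id := funext 𝒢.unit_mul
  rw [h2, mfderiv_id, mfderiv_comp g (𝒢.mdiff_unit _) (𝒢.mdiff_tgt g)] at h1
  exact h1.symm

/-- Vector fields tangent to the distribution are invariant under right translations, modulo the
distribution, in the sense that their brackets with right-invariant vector fields are
right translates of the brackets of lifts at the units. -/
theorem IsMultiplicative.mlieBracket_rightInv_sub_rightTrans_mem [T2Space G]
    [SecondCountableTopology G] (hH : 𝒢.IsMultiplicative H) {g : G}
    {V : ∀ g : G, TangentSpace (𝓡 p) g} (hV : SmoothFieldAt V g)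
    (hVH : ∀ᶠ k in 𝓝 g, V k ∈ H.fiber k) (α : 𝒢.AlgSection) {Y : VField n M} {Y' : VField p G}
    (hY : 𝒢.IsLift H Y Y') (hYV : 𝒢.dtgt g (V g) = Y.val (𝒢.tgt g)) :
    mlieBracket (𝓡 p) V (𝒢.rightInv α) g -
      𝒢.rightTrans g (mlieBracket (𝓡 p) Y'.val (𝒢.rightInv α) (𝒢.unit (𝒢.tgt g))) ∈
      H.fiber g := by
  obtain ⟨B, hBs, hBf, hBx⟩ := (𝒢.tgt_submersion.isSubmersionAt g).exists_fiber_retraction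
  set q : G × G := (𝒢.unit (𝒢.tgt g), g) with hq
  -- The second factor is retracted to the target fibre over the source of the first, so the
  -- composition `F` is smooth near `q` in the full product `G × G`. When the first factor already
  -- has source `t g`, the retraction fixes `g`.
  set K : G × G → G := fun x => B (𝒢.src x.1, x.2) with hK
  set F : G × G → G := fun x => 𝒢.mul x.1 (K x) with hF
  have hsq : (𝒢.src q.1, q.2) = (𝒢.tgt g, g) := by
    rw [hq, 𝒢.src_unit]
  have hBg : B (𝒢.tgt g, g) = g := hBx.self_of_nhds
  have hKq : K q = g := by
    change B (𝒢.src q.1, q.2) = g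
    rw [hsq, hBg]
  have hFq : F q = g := by
    change 𝒢.mul q.1 (K q) = g
    rw [hKq, 𝒢.unit_mul]
  have hps : ∀ x : G × G, ContMDiffAt ((𝓡 p).prod (𝓡 p)) ((𝓡 n).prod (𝓡 p)) ∞
      (fun x : G × G => (𝒢.src x.1, x.2)) x := fun x =>
    ((𝒢.src_smooth x.1).comp x contMDiffAt_fst).prodMk contMDiffAt_snd
  have hpt : Filter.Tendsto (fun x : G × G => (𝒢.src x.1, x.2)) (𝓝 q) (𝓝 (𝒢.tgt g, g)) := by
    rw [← hsq]
    exact (hps q).continuousAt.tendsto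
  have hKs : ∀ᶠ x in 𝓝 q, ContMDiffAt ((𝓡 p).prod (𝓡 p)) (𝓡 p) ∞ K x := by
    filter_upwards [hpt.eventually hBs] with x hx
    exact ContMDiffAt.comp x (g := B) (f := fun x : G × G => (𝒢.src x.1, x.2)) hx (hps x)
  have hcomp : ∀ᶠ x in 𝓝 q, 𝒢.src x.1 = 𝒢.tgt (K x) := by
    filter_upwards [hpt.eventually hBf] with x hx using hx.symm
  have hFs : ContMDiffAt ((𝓡 p).prod (𝓡 p)) (𝓡 p) ∞ F q :=
    𝒢.contMDiffAt_mul contMDiffAt_fst hKs.self_of_nhds hcomp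
  have hdF : ∀ᶠ x in 𝓝 q, ∀ v w : EuclideanSpace ℝ (Fin p),
      (mfderiv ((𝓡 p).prod (𝓡 p)) (𝓡 p) F x
        ((v, w) : EuclideanSpace ℝ (Fin p) × EuclideanSpace ℝ (Fin p)) :
        EuclideanSpace ℝ (Fin p)) =
      𝒢.dmul x.1 (K x) v (mfderiv ((𝓡 n).prod (𝓡 p)) (𝓡 p) B (𝒢.src x.1, x.2)
        ((𝒢.dsrc x.1 v, w) : EuclideanSpace ℝ (Fin n) × EuclideanSpace ℝ (Fin p))) := by
    filter_upwards [hpt.eventually hBs, hKs, hcomp.eventually_nhds] with x h1 h2 h3 v w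
    have e1 := 𝒢.mfderiv_mul (mdifferentiableAt_fst (I := 𝓡 p) (I' := 𝓡 p))
      (h2.mdifferentiableAt (by simp)) h3
      ((v, w) : EuclideanSpace ℝ (Fin p) × EuclideanSpace ℝ (Fin p))
    have hsd : MDifferentiableAt ((𝓡 p).prod (𝓡 p)) (𝓡 n) (fun x : G × G => 𝒢.src x.1) x :=
      (𝒢.mdiff_src x.1).comp x mdifferentiableAt_fst
    have e2 := mfderiv_comp x (g := B) (f := fun x : G × G => (𝒢.src x.1, x.2))
      (h1.mdifferentiableAt (by simp)) (hsd.prodMk mdifferentiableAt_snd)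
    have e3 := mfderiv_comp x (g := 𝒢.src) (f := (Prod.fst : G × G → G)) (𝒢.mdiff_src x.1)
      (mdifferentiableAt_fst (I := 𝓡 p) (I' := 𝓡 p))
    rw [mfderiv_prodMk hsd mdifferentiableAt_snd, mfderiv_snd] at e2
    rw [mfderiv_fst] at e1 e3
    refine e1.trans ?_
    have e4 : (mfderiv ((𝓡 p).prod (𝓡 p)) (𝓡 n) (fun x : G × G => 𝒢.src x.1) x
        ((v, w) : EuclideanSpace ℝ (Fin p) × EuclideanSpace ℝ (Fin p)) :
        EuclideanSpace ℝ (Fin n)) = 𝒢.dsrc x.1 v :=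
      congrArg (fun L : EuclideanSpace ℝ (Fin p) × EuclideanSpace ℝ (Fin p) →L[ℝ]
        EuclideanSpace ℝ (Fin n) => L (v, w)) e3
    have e5 : (mfderiv ((𝓡 p).prod (𝓡 p)) (𝓡 p) K x
        ((v, w) : EuclideanSpace ℝ (Fin p) × EuclideanSpace ℝ (Fin p)) :
        EuclideanSpace ℝ (Fin p)) =
        mfderiv ((𝓡 n).prod (𝓡 p)) (𝓡 p) B (𝒢.src x.1, x.2)
          ((mfderiv ((𝓡 p).prod (𝓡 p)) (𝓡 n) (fun x : G × G => 𝒢.src x.1) x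
        ((v, w) : EuclideanSpace ℝ (Fin p) × EuclideanSpace ℝ (Fin p)), w) :
          EuclideanSpace ℝ (Fin n) × EuclideanSpace ℝ (Fin p)) :=
      congrArg (fun L : EuclideanSpace ℝ (Fin p) × EuclideanSpace ℝ (Fin p) →L[ℝ]
        EuclideanSpace ℝ (Fin p) => L (v, w)) e2
    rw [e4] at e5
    exact congrArg (fun z : EuclideanSpace ℝ (Fin p) => 𝒢.dmul x.1 (K x) v z) e5
  -- The bracket comparison is applied to `F` with `W = (Y', V)` and `Z = (αʳ, 0)`. Right invariance
  -- makes `Z` related to `αʳ`, and `dF W` at `q` is `V g` because `Y'` extends `u_* Y`.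
  set W : ∀ x : G × G, TangentSpace ((𝓡 p).prod (𝓡 p)) x := fun x =>
    ((Y'.val x.1, V x.2) : EuclideanSpace ℝ (Fin p) × EuclideanSpace ℝ (Fin p)) with hW
  set Z : ∀ x : G × G, TangentSpace ((𝓡 p).prod (𝓡 p)) x := fun x =>
    ((𝒢.rightInv α x.1, 0) : EuclideanSpace ℝ (Fin p) × EuclideanSpace ℝ (Fin p)) with hZ
  have hprod : ∀ (A B : ∀ g : G, TangentSpace (𝓡 p) g), SmoothFieldAt A q.1 →
      SmoothFieldAt B q.2 → ContMDiffAt ((𝓡 p).prod (𝓡 p)) ((𝓡 p).prod (𝓡 p)).tangent ∞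
        (fun x : G × G => (⟨x, ((A x.1, B x.2) :
          EuclideanSpace ℝ (Fin p) × EuclideanSpace ℝ (Fin p))⟩ :
          TangentBundle ((𝓡 p).prod (𝓡 p)) (G × G))) q := by
    intro A B hA hB
    have : IsManifold (𝓡 p) 1 G := IsManifold.of_le (n := ∞) (by simp)
    have h1 : ContMDiffAt ((𝓡 p).prod (𝓡 p)) ((𝓡 p).tangent.prod (𝓡 p).tangent) ∞
        (fun x : G × G => ((⟨x.1, A x.1⟩, ⟨x.2, B x.2⟩) :
          TangentBundle (𝓡 p) G × TangentBundle (𝓡 p) G)) q :=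
      (ContMDiffAt.comp q (g := fun g => (⟨g, A g⟩ : TangentBundle (𝓡 p) G)) hA
        contMDiffAt_fst).prodMk
        (ContMDiffAt.comp q (g := fun g => (⟨g, B g⟩ : TangentBundle (𝓡 p) G)) hB contMDiffAt_snd)
    exact ContMDiffAt.comp q (contMDiff_equivTangentBundleProd_symm (n := ∞) (I := 𝓡 p) (M := G)
      (I' := 𝓡 p) (M' := G)).contMDiffAt h1
  have h0 : SmoothFieldAt (fun g : G => (0 : TangentSpace (𝓡 p) g)) g := by
    exact SmoothFieldAt.sum (s := (∅ : Finset ℕ)) (W := fun _ g => 0) (x := g) (by simp)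
  have hWs := hprod Y'.val V (Y'.smoothAt _) hV
  have hZs := hprod (𝒢.rightInv α) (fun g : G => (0 : TangentSpace (𝓡 p) g))
    (α.rightField.smoothAt _) h0
  have hBr : mlieBracket ((𝓡 p).prod (𝓡 p)) W Z q =
      ((mlieBracket (𝓡 p) Y'.val (𝒢.rightInv α) (𝒢.unit (𝒢.tgt g)), 0) :
        EuclideanSpace ℝ (Fin p) × EuclideanSpace ℝ (Fin p)) := by
    have h1 := mfderiv_mlieBracket_of_related (f := (Prod.fst : G × G → G)) (q := q)
      (V := Y'.val) (A := 𝒢.rightInv α) contMDiffAt_fst (Y'.smooth _) (α.rightField.smooth _)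
      hWs hZs (Filter.Eventually.of_forall fun x => by rw [mfderiv_fst]; rfl)
      (Filter.Eventually.of_forall fun x => by rw [mfderiv_fst]; rfl)
    have h2 := mfderiv_mlieBracket_of_related (f := (Prod.snd : G × G → G)) (q := q)
      (V := V) (A := fun g : G => (0 : TangentSpace (𝓡 p) g)) contMDiffAt_snd hV h0
      hWs hZs (Filter.Eventually.of_forall fun x => by rw [mfderiv_snd]; rfl)
      (Filter.Eventually.of_forall fun x => by rw [mfderiv_snd]; rfl)
    rw [mfderiv_fst] at h1
    rw [mfderiv_snd] at h2
    have h3 : mlieBracket (𝓡 p) V (fun g : G => (0 : TangentSpace (𝓡 p) g)) q.2 = 0 :=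
      congrFun (mlieBracket_zero_right (I := 𝓡 p) (W := V)) q.2
    rw [h3] at h2
    exact Prod.ext h1 h2
  -- Along the curve `(c t, g)`, tangent to `Z`, all pairs are composable and `dF W = dm (Y', V g)`.
  -- This lies in `H` by multiplicativity, since `Y'` projects to `Y` at `t g`, which is `dt (V g)`.
  obtain ⟨c, hc0, hcs, hc1, hcf⟩ := (𝒢.src_submersion.isSubmersionAt
    (𝒢.unit (𝒢.tgt g))).exists_curve_in_fiber (v := (α.val (𝒢.tgt g)).1) (α.val (𝒢.tgt g)).2
  have hcd : MDifferentiableAt 𝓘(ℝ, ℝ) (𝓡 p) c 0 := hcs.mdifferentiableAt (by simp)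
  have hct : Filter.Tendsto (fun t => (c t, g)) (𝓝 0) (𝓝 q) := by
    have : ContinuousAt (fun t => (c t, g)) 0 := hcs.continuousAt.prodMk continuousAt_const
    have := this.tendsto
    rwa [hc0] at this
  have hdBV : (mfderiv ((𝓡 n).prod (𝓡 p)) (𝓡 p) B (𝒢.tgt g, g)
      ((Y.val (𝒢.tgt g), V g) : EuclideanSpace ℝ (Fin n) × EuclideanSpace ℝ (Fin p)) :
      EuclideanSpace ℝ (Fin p)) = V g := by
    rw [← hYV]
    exact mfderiv_fiber_retraction (𝒢.mdiff_tgt g) (hBs.self_of_nhds.mdifferentiableAt (by simp))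
      hBx (V g)
  have hBcongr : ∀ {x y : M × G}, x = y → ∀ {v w : EuclideanSpace ℝ (Fin n)}, v = w →
      (mfderiv ((𝓡 n).prod (𝓡 p)) (𝓡 p) B x
        ((v, V g) : EuclideanSpace ℝ (Fin n) × EuclideanSpace ℝ (Fin p)) :
        EuclideanSpace ℝ (Fin p)) = mfderiv ((𝓡 n).prod (𝓡 p)) (𝓡 p) B y
        ((w, V g) : EuclideanSpace ℝ (Fin n) × EuclideanSpace ℝ (Fin p)) := by
    rintro x _ rfl v _ rfl
    rfl
  have key := H.mlieBracket_sub_mem (I' := (𝓡 p).prod (𝓡 p)) (f := F) (q := q) (V := V)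
    (A := 𝒢.rightInv α) (W := W) (Z := Z) hFs (by rw [hFq]; exact hV)
    (α.rightField.smoothAt _) hWs hZs (by
      filter_upwards [hdF, hcomp] with x h1 h2
      refine (h1 _ _).trans ?_
      rw [dsrc_rightInv]
      have e : (mfderiv ((𝓡 n).prod (𝓡 p)) (𝓡 p) B (𝒢.src x.1, x.2)
        ((0, 0) : EuclideanSpace ℝ (Fin n) × EuclideanSpace ℝ (Fin p)) :
        EuclideanSpace ℝ (Fin p)) = 0 := map_zero (mfderiv ((𝓡 n).prod (𝓡 p)) (𝓡 p) B _)
      refine (congrArg (fun z : EuclideanSpace ℝ (Fin p) =>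
        𝒢.dmul x.1 (K x) (𝒢.rightInv α x.1) z) e).trans ?_
      exact rightInv_mul α h2)
    (by
      refine (hdF.self_of_nhds _ _).trans ?_
      have e1 : (𝒢.dsrc q.1 (Y'.val q.1) : EuclideanSpace ℝ (Fin n)) = Y.val (𝒢.tgt g) :=
        (hY.projects _).trans (field_eq_of_eq Y.val (𝒢.src_unit _))
      have e2 := (hBcongr hsq e1).trans hdBV
      have e3 : (Y'.val q.1 : EuclideanSpace ℝ (Fin p)) =
          𝒢.dunit (𝒢.tgt g) (𝒢.dtgt g (V g)) := by
        rw [hYV]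
        exact hY.extends_unit _
      refine (congrArg (fun z : EuclideanSpace ℝ (Fin p) =>
        𝒢.dmul q.1 (K q) (Y'.val q.1) z) e2).trans ?_
      refine (congrArg (fun z : EuclideanSpace ℝ (Fin p) =>
        (𝒢.dmul q.1 (K q) z (V g) : EuclideanSpace ℝ (Fin p))) e3).trans ?_
      refine (𝒢.dmul_congr (rfl : q.1 = q.1) hKq _ _).trans ?_
      exact (dmul_dunit_dtgt g (V g)).trans (field_eq_of_eq V hFq.symm))
    (c := fun t => (c t, g))
    (hcd.prodMk mdifferentiableAt_const).hasMFDerivAt (by rw [hc0])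
    (by
      rw [mfderiv_prodMk hcd mdifferentiableAt_const, mfderiv_const]
      refine Prod.ext ?_ rfl
      exact hc1.trans (rightInv_unit α _).symm)
    (by rw [hFq]; exact hVH)
    (by
      filter_upwards [hct.eventually hdF, hcf] with t h1 h2
      have hst : 𝒢.src (c t) = 𝒢.tgt g := h2.trans (𝒢.src_unit _)
      have hKt : K (c t, g) = g := by
        change B (𝒢.src (c t), g) = g
        rw [hst, hBg]
      have e1 : (𝒢.dsrc (c t) (Y'.val (c t)) : EuclideanSpace ℝ (Fin n)) = Y.val (𝒢.tgt g) :=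
        (hY.projects _).trans (field_eq_of_eq Y.val hst)
      have e2 := (hBcongr (show (𝒢.src (c t), g) = (𝒢.tgt g, g) by rw [hst]) e1).trans hdBV
      have e3 : (mfderiv ((𝓡 p).prod (𝓡 p)) (𝓡 p) F (c t, g) (W (c t, g)) :
          EuclideanSpace ℝ (Fin p)) = 𝒢.dmul (c t) g (Y'.val (c t)) (V g) := by
        refine (h1 _ _).trans ?_
        refine (congrArg (fun z : EuclideanSpace ℝ (Fin p) =>
          𝒢.dmul (c t) (K (c t, g)) (Y'.val (c t)) z) e2).trans ?_
        exact 𝒢.dmul_congr (rfl : c t = c t) hKt _ _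
      rw [e3]
      refine H.mem_fiber_of_eq (congrArg (𝒢.mul (c t)) hKt.symm)
        (hH.mul_mem _ g hst _ (hY.tangent _) _ hVH.self_of_nhds ?_)
      rw [hYV]
      exact (tangentCast_eq hst (𝒢.dsrc (c t) (Y'.val (c t)))).trans e1)
  have e1 : (mfderiv ((𝓡 p).prod (𝓡 p)) (𝓡 p) F q (mlieBracket ((𝓡 p).prod (𝓡 p)) W Z q) :
      EuclideanSpace ℝ (Fin p)) =
      𝒢.rightTrans g (mlieBracket (𝓡 p) Y'.val (𝒢.rightInv α) (𝒢.unit (𝒢.tgt g))) := by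
    rw [hBr]
    refine (hdF.self_of_nhds _ _).trans ?_
    -- The bracket of a projectable field with a field vertical for the source is again vertical, so
    -- the retraction contributes nothing and `dF [W, Z]` is a pure right translate.
    have hds : 𝒢.dsrc q.1 (mlieBracket (𝓡 p) Y'.val (𝒢.rightInv α) q.1) = 0 := by
      have := mfderiv_mlieBracket_of_related (f := 𝒢.src) (q := q.1) (V := Y.val)
        (A := fun x : M => (0 : TangentSpace (𝓡 n) x)) (W := Y'.val) (Z := 𝒢.rightInv α)
        (𝒢.src_smooth _) (Y.smooth _) (SmoothFieldAt.sum (s := (∅ : Finset ℕ))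
          (W := fun _ g => 0) (by simp)) (Y'.smooth _) (α.rightField.smooth _)
        (Filter.Eventually.of_forall hY.projects)
        (Filter.Eventually.of_forall fun x => dsrc_rightInv α x)
      refine this.trans ?_
      exact congrFun (mlieBracket_zero_right (I := 𝓡 n) (W := Y.val)) _
    have e : (mfderiv ((𝓡 n).prod (𝓡 p)) (𝓡 p) B (𝒢.src q.1, q.2)
        ((𝒢.dsrc q.1 (mlieBracket (𝓡 p) Y'.val (𝒢.rightInv α) q.1), 0) :
          EuclideanSpace ℝ (Fin n) × EuclideanSpace ℝ (Fin p)) :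
        EuclideanSpace ℝ (Fin p)) = 0 := by
      rw [hds]
      exact map_zero (mfderiv ((𝓡 n).prod (𝓡 p)) (𝓡 p) B _)
    refine (congrArg (fun z : EuclideanSpace ℝ (Fin p) => 𝒢.dmul q.1 (K q)
      (mlieBracket (𝓡 p) Y'.val (𝒢.rightInv α) q.1) z) e).trans ?_
    exact 𝒢.dmul_congr (rfl : q.1 = q.1) hKq _ _
  have e2 : (mlieBracket (𝓡 p) V (𝒢.rightInv α) (F q) : EuclideanSpace ℝ (Fin p)) =
      mlieBracket (𝓡 p) V (𝒢.rightInv α) g := field_eq_of_eq _ hFq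
  have e3 : (mlieBracket (𝓡 p) V (𝒢.rightInv α) (F q) -
      mfderiv ((𝓡 p).prod (𝓡 p)) (𝓡 p) F q (mlieBracket ((𝓡 p).prod (𝓡 p)) W Z q) :
      EuclideanSpace ℝ (Fin p)) = (mlieBracket (𝓡 p) V (𝒢.rightInv α) g -
      𝒢.rightTrans g (mlieBracket (𝓡 p) Y'.val (𝒢.rightInv α) (𝒢.unit (𝒢.tgt g))) :
      EuclideanSpace ℝ (Fin p)) := congrArg₂ (fun a b : EuclideanSpace ℝ (Fin p) => a - b) e2 e1
  exact H.mem_fiber_of_eq hFq (e3 ▸ key)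

end LieGroupoid

/-! ### Algebraic rules for brackets of smooth fields. -/

section Brackets

variable {n : ℕ} {N : Type*} [TopologicalSpace N]
  [ChartedSpace (EuclideanSpace ℝ (Fin n)) N] [IsManifold (𝓡 n) ∞ N]
  {U V W : ∀ x : N, TangentSpace (𝓡 n) x} {f : N → ℝ} {x : N}

theorem SmoothFieldAt.mlieBracket_add_left (hU : SmoothFieldAt U x) (hV : SmoothFieldAt V x) :
    VectorField.mlieBracket (𝓡 n) (U + V) W x =
      VectorField.mlieBracket (𝓡 n) U W x + VectorField.mlieBracket (𝓡 n) V W x :=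
  VectorField.mlieBracket_add_left hU.mdiff hV.mdiff

theorem SmoothFieldAt.mlieBracket_add_right (hV : SmoothFieldAt V x) (hW : SmoothFieldAt W x) :
    VectorField.mlieBracket (𝓡 n) U (V + W) x =
      VectorField.mlieBracket (𝓡 n) U V x + VectorField.mlieBracket (𝓡 n) U W x :=
  VectorField.mlieBracket_add_right hV.mdiff hW.mdiff

theorem SmoothFieldAt.mlieBracket_sub_right (hV : SmoothFieldAt V x) (hW : SmoothFieldAt W x) :
    VectorField.mlieBracket (𝓡 n) U (V - W) x =
      VectorField.mlieBracket (𝓡 n) U V x - VectorField.mlieBracket (𝓡 n) U W x := by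
  rw [eq_sub_iff_add_eq, ← (hV.sub hW).mlieBracket_add_right hW, sub_add_cancel]

theorem SmoothFieldAt.mlieBracket_smul_right (hf : ContMDiffAt (𝓡 n) 𝓘(ℝ, ℝ) ∞ f x)
    (hW : SmoothFieldAt W x) :
    VectorField.mlieBracket (𝓡 n) V (f • W) x =
      mvfderiv (𝓡 n) f x (V x) • W x + f x • VectorField.mlieBracket (𝓡 n) V W x :=
  VectorField.mlieBracket_smul_right (hf.mdifferentiableAt (by simp)) hW.mdiff

theorem SmoothFieldAt.mlieBracket_smul_left (hf : ContMDiffAt (𝓡 n) 𝓘(ℝ, ℝ) ∞ f x)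
    (hV : SmoothFieldAt V x) :
    VectorField.mlieBracket (𝓡 n) (f • V) W x =
      - mvfderiv (𝓡 n) f x (W x) • V x + f x • VectorField.mlieBracket (𝓡 n) V W x :=
  VectorField.mlieBracket_smul_left (hf.mdifferentiableAt (by simp)) hV.mdiff

theorem SmoothFieldAt.leibniz_mlieBracket (hU : SmoothFieldAt U x) (hV : SmoothFieldAt V x)
    (hW : SmoothFieldAt W x) :
    VectorField.mlieBracket (𝓡 n) U (VectorField.mlieBracket (𝓡 n) V W) x =
      VectorField.mlieBracket (𝓡 n) (VectorField.mlieBracket (𝓡 n) U V) W x +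
        VectorField.mlieBracket (𝓡 n) V (VectorField.mlieBracket (𝓡 n) U W) x := by
  have : IsManifold (𝓡 n) (minSmoothness ℝ 3) N :=
    IsManifold.of_le (n := ∞)
      (by simpa using WithTop.coe_le_coe.mpr (le_top : (3 : ℕ∞) ≤ ⊤))
  have h2 : minSmoothness ℝ 2 ≤ ∞ := by simpa using two_le_infty
  exact leibniz_identity_mlieBracket_apply (hU.of_le h2) (hV.of_le h2) (hW.of_le h2)

theorem smoothFieldAt_zero : SmoothFieldAt (fun x : N => (0 : TangentSpace (𝓡 n) x)) x :=
  SmoothFieldAt.sum (s := (∅ : Finset ℕ)) (W := fun _ _ => 0) (by simp)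

theorem mlieBracket_zero_field : VectorField.mlieBracket (𝓡 n) V
    (fun x : N => (0 : TangentSpace (𝓡 n) x)) x = 0 :=
  congrFun (mlieBracket_zero_right (I := 𝓡 n) (W := V)) x

end Brackets

/-! ### Brackets of lifts. -/

namespace LieGroupoid

variable {p n : ℕ} {G M : Type*}
  [TopologicalSpace G] [ChartedSpace (EuclideanSpace ℝ (Fin p)) G] [IsManifold (𝓡 p) ∞ G]
  [TopologicalSpace M] [ChartedSpace (EuclideanSpace ℝ (Fin n)) M] [IsManifold (𝓡 n) ∞ M]
  {𝒢 : LieGroupoid p n G M} {H : TangentDistribution p G}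

theorem dsrc_mlieBracket {V W : ∀ g : G, TangentSpace (𝓡 p) g} {g : G} (hV : SmoothFieldAt V g)
    (hW : SmoothFieldAt W g) {X Y : VField n M}
    (hX : ∀ᶠ k in 𝓝 g, 𝒢.dsrc k (V k) = X.val (𝒢.src k))
    (hY : ∀ᶠ k in 𝓝 g, 𝒢.dsrc k (W k) = Y.val (𝒢.src k)) :
    𝒢.dsrc g (mlieBracket (𝓡 p) V W g) = mlieBracket (𝓡 n) X.val Y.val (𝒢.src g) :=
  mfderiv_mlieBracket_of_related (𝒢.src_smooth g) (X.smooth _) (Y.smooth _) hV hW hX hY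

theorem dtgt_mlieBracket {V W : ∀ g : G, TangentSpace (𝓡 p) g} {g : G} (hV : SmoothFieldAt V g)
    (hW : SmoothFieldAt W g) {X Y : VField n M}
    (hX : ∀ᶠ k in 𝓝 g, 𝒢.dtgt k (V k) = X.val (𝒢.tgt k))
    (hY : ∀ᶠ k in 𝓝 g, 𝒢.dtgt k (W k) = Y.val (𝒢.tgt k)) :
    𝒢.dtgt g (mlieBracket (𝓡 p) V W g) = mlieBracket (𝓡 n) X.val Y.val (𝒢.tgt g) :=
  mfderiv_mlieBracket_of_related (𝒢.tgt_smooth g) (X.smooth _) (Y.smooth _) hV hW hX hY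

theorem dsrc_mlieBracket_rightInv {V : ∀ g : G, TangentSpace (𝓡 p) g} {g : G}
    (hV : SmoothFieldAt V g) {X : VField n M}
    (hX : ∀ᶠ k in 𝓝 g, 𝒢.dsrc k (V k) = X.val (𝒢.src k)) (α : 𝒢.AlgSection) :
    𝒢.dsrc g (mlieBracket (𝓡 p) V (𝒢.rightInv α) g) = 0 := by
  have := mfderiv_mlieBracket_of_related (f := 𝒢.src) (q := g) (V := X.val)
    (A := fun x : M => (0 : TangentSpace (𝓡 n) x)) (W := V) (Z := 𝒢.rightInv α)
    (𝒢.src_smooth _) (X.smooth _) smoothFieldAt_zero hV (α.rightField.smooth _)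
    hX (Filter.Eventually.of_forall fun x => dsrc_rightInv α x)
  exact this.trans mlieBracket_zero_field

namespace IsLift

variable {X Y : VField n M} {V W : VField p G}

/-- The bracket of a lift with a right-invariant vector field, restricted to the units. -/
noncomputable def bracketSection (hV : 𝒢.IsLift H X V) (α : 𝒢.AlgSection) : 𝒢.AlgSection :=
  AlgSection.ofField (V.bracket α.rightField) fun _ =>
    dsrc_mlieBracket_rightInv (V.smoothAt _) (Filter.Eventually.of_forall hV.projects) α

/-- Lifts are related by the unit map to the fields they lift, so their bracket at a unit is always
tangent to the units; no involutivity is needed. -/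
theorem mlieBracket_unit (hV : 𝒢.IsLift H X V) (hW : 𝒢.IsLift H Y W) (x : M) :
    mlieBracket (𝓡 p) V.val W.val (𝒢.unit x) = 𝒢.dunit x (mlieBracket (𝓡 n) X.val Y.val x) :=
  (mfderiv_mlieBracket_of_related (f := 𝒢.unit) (q := x) (𝒢.unit_smooth x) (V.smooth _)
    (W.smooth _) (X.smooth _) (Y.smooth _)
    (Filter.Eventually.of_forall fun y => (hV.extends_unit y).symm)
    (Filter.Eventually.of_forall fun y => (hW.extends_unit y).symm)).symm

/-- The bracket of a lift with a vector field vanishing on the units vanishes on the units. -/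
theorem mlieBracket_unit_eq_zero (hV : 𝒢.IsLift H X V) {Z : ∀ g : G, TangentSpace (𝓡 p) g} {x : M}
    (hZ : SmoothFieldAt Z (𝒢.unit x)) (h : ∀ y, Z (𝒢.unit y) = 0) :
    mlieBracket (𝓡 p) V.val Z (𝒢.unit x) = 0 := by
  have := mfderiv_mlieBracket_of_related (f := 𝒢.unit) (q := x) (V := V.val) (A := Z)
    (W := X.val) (Z := fun y : M => (0 : TangentSpace (𝓡 n) y))
    (𝒢.unit_smooth x) (V.smooth _)
    hZ (X.smooth _) smoothFieldAt_zero
    (Filter.Eventually.of_forall fun y => (hV.extends_unit y).symm)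
    (Filter.Eventually.of_forall fun y => by rw [h, map_zero])
  rw [mlieBracket_zero_field, map_zero] at this
  exact this.symm

theorem bracket (hV : 𝒢.IsLift H X V) (hW : 𝒢.IsLift H Y W)
    (h : ∀ g, mlieBracket (𝓡 p) V.val W.val g ∈ H.fiber g) :
    𝒢.IsLift H (X.bracket Y) (V.bracket W) where
  tangent := h
  projects g := dsrc_mlieBracket (V.smoothAt g) (W.smoothAt g)
    (Filter.Eventually.of_forall hV.projects) (Filter.Eventually.of_forall hW.projects)
  extends_unit := hV.mlieBracket_unit hW

/-- Independence of the choice of lift: two lifts of `X` agree at the units, and the bracket modulo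
`H` sees only the value there. -/
theorem mlieBracket_sub_mem [T2Space G] [SecondCountableTopology G] (hV : 𝒢.IsLift H X V)
    (hW : 𝒢.IsLift H X W) (α : 𝒢.AlgSection) (x : M) :
    mlieBracket (𝓡 p) V.val (𝒢.rightInv α) (𝒢.unit x) -
      mlieBracket (𝓡 p) W.val (𝒢.rightInv α) (𝒢.unit x) ∈ H.fiber (𝒢.unit x) :=
  H.mlieBracket_sub_mlieBracket_mem (V.smoothAt _) (W.smoothAt _) (smooth_rightInv α _)
    (Filter.Eventually.of_forall hV.tangent) (Filter.Eventually.of_forall hW.tangent)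
    ((hV.extends_unit x).trans (hW.extends_unit x).symm)

theorem add {Z : VField n M} (hV : 𝒢.IsLift H X V) (hW : 𝒢.IsLift H Y W)
    (hZ : ∀ x, Z.val x = X.val x + Y.val x) :
    𝒢.IsLift H Z ⟨V.val + W.val, fun g => (V.smoothAt g).add (W.smoothAt g)⟩ where
  tangent g := Submodule.add_mem _ (hV.tangent g) (hW.tangent g)
  projects g := by
    change 𝒢.dsrc g (V.val g + W.val g) = _
    rw [map_add, hV.projects, hW.projects, hZ]
  extends_unit x := by
    change V.val _ + W.val _ = _
    rw [hV.extends_unit, hW.extends_unit, hZ, map_add]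

/-- The multiplier is pulled back by the source. Right-invariant fields do not differentiate it,
which is why the Spencer operator is tensorial in `X`. -/
theorem smul {Z : VField n M} {f : M → ℝ} (hf : ContMDiff (𝓡 n) 𝓘(ℝ, ℝ) ∞ f)
    (hV : 𝒢.IsLift H X V) (hZ : ∀ x, Z.val x = f x • X.val x) :
    𝒢.IsLift H Z ⟨(f ∘ 𝒢.src) • V.val, fun g =>
      SmoothFieldAt.smul ((hf _).comp g (𝒢.src_smooth g)) (V.smoothAt g)⟩ where
  tangent g := Submodule.smul_mem _ _ (hV.tangent g)
  projects g := by
    change 𝒢.dsrc g (f (𝒢.src g) • V.val g) = _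
    rw [map_smul, hV.projects, hZ]
  extends_unit x := by
    change f (𝒢.src (𝒢.unit x)) • V.val _ = _
    rw [hV.extends_unit, hZ, map_smul, 𝒢.src_unit]

end IsLift

theorem AlgSection.rightInv_addSMul (α β : 𝒢.AlgSection) {f : M → ℝ}
    (hf : ContMDiff (𝓡 n) 𝓘(ℝ, ℝ) ∞ f) :
    𝒢.rightInv (α.addSMul β f hf) = 𝒢.rightInv α + (f ∘ 𝒢.tgt) • 𝒢.rightInv β := by
  funext g
  change _ = 𝒢.rightInv α g + f (𝒢.tgt g) • 𝒢.rightInv β g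
  rw [𝒢.rightInv_eq, 𝒢.rightInv_eq, 𝒢.rightInv_eq, ← map_smul, ← map_add]
  rfl

theorem AlgSection.mlieBracket_rightInv_addSMul (α β : 𝒢.AlgSection) {f : M → ℝ}
    (hf : ContMDiff (𝓡 n) 𝓘(ℝ, ℝ) ∞ f) (V : ∀ g : G, TangentSpace (𝓡 p) g) (g : G) :
    mlieBracket (𝓡 p) V (𝒢.rightInv (α.addSMul β f hf)) g =
      mlieBracket (𝓡 p) V (𝒢.rightInv α) g +
      (mvfderiv (𝓡 p) (f ∘ 𝒢.tgt) g (V g) • 𝒢.rightInv β g +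
        f (𝒢.tgt g) • mlieBracket (𝓡 p) V (𝒢.rightInv β) g) := by
  have hft : ContMDiffAt (𝓡 p) 𝓘(ℝ, ℝ) ∞ (f ∘ 𝒢.tgt) g := (hf _).comp g (𝒢.tgt_smooth g)
  rw [AlgSection.rightInv_addSMul, (smooth_rightInv α g).mlieBracket_add_right
    (SmoothFieldAt.smul hft (smooth_rightInv β g)),
    SmoothFieldAt.mlieBracket_smul_right hft (smooth_rightInv β g)]
  rfl

theorem QuotSection.exists_mod_eq (e : 𝒢.QuotSection H) : ∃ α : 𝒢.AlgSection, α.mod H = e := by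
  obtain ⟨α, hα⟩ := e.smooth
  exact ⟨α, QuotSection.ext (funext fun x => (hα x).symm)⟩

/-! ### The Spencer operator, the induced connection, and the consequences of involutivity. -/

section Spencer

variable [T2Space G] [SecondCountableTopology G]

/-- The Spencer operator of a multiplicative distribution. -/
noncomputable def spencerOperator (hH : 𝒢.IsMultiplicative H) (X : VField n M)
    (α : 𝒢.AlgSection) : 𝒢.QuotSection H :=
  ((hH.exists_isLift X).choose_spec.bracketSection α).mod H

theorem isSpencerOperator_spencerOperator (hH : 𝒢.IsMultiplicative H) :
    𝒢.IsSpencerOperator H (spencerOperator hH) := by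
  intro X V hV α x
  refine ⟨(hV.bracketSection α).val x |>.2, ?_⟩
  exact (Submodule.Quotient.eq _).2
    ((hH.exists_isLift X).choose_spec.mlieBracket_sub_mem hV α x)

variable {D : VField n M → 𝒢.AlgSection → 𝒢.QuotSection H}

namespace IsSpencerOperator

theorem eq_mod (hD : 𝒢.IsSpencerOperator H D) {X : VField n M} {V : VField p G}
    (hV : 𝒢.IsLift H X V) (α : 𝒢.AlgSection) : D X α = (hV.bracketSection α).mod H :=
  QuotSection.ext (funext fun x => (hD X V hV α x).choose_spec)

/-- Existence of a lift of every `X` is what makes the defining condition determine the operator. -/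
theorem eq (hH : 𝒢.IsMultiplicative H) (hD : 𝒢.IsSpencerOperator H D)
    {D' : VField n M → 𝒢.AlgSection → 𝒢.QuotSection H} (hD' : 𝒢.IsSpencerOperator H D') :
    D' = D := by
  funext X α
  obtain ⟨V, hV⟩ := hH.exists_isLift X
  rw [hD.eq_mod hV, hD'.eq_mod hV]

theorem val_eq_mk_iff (hD : 𝒢.IsSpencerOperator H D) {X : VField n M} {V : VField p G}
    (hV : 𝒢.IsLift H X V) (α : 𝒢.AlgSection) {x : M} {a : 𝒢.algFiber x} :
    (D X α).val x = Submodule.Quotient.mk a ↔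
      mlieBracket (𝓡 p) V.val (𝒢.rightInv α) (𝒢.unit x) - a.1 ∈ H.fiber (𝒢.unit x) := by
  rw [hD.eq_mod hV]
  exact Submodule.Quotient.eq _

/-- The right-invariant extension of `α + f β` is `αʳ + (f ∘ t) βʳ`, and at a unit a lift
differentiates `f ∘ t` to `X (f)`. Constant `f` gives additivity and differences; nonconstant `f`
gives the Leibniz rule. -/
theorem addSMul (hH : 𝒢.IsMultiplicative H) (hD : 𝒢.IsSpencerOperator H D) (X : VField n M)
    (α β : 𝒢.AlgSection) {f : M → ℝ} (hf : ContMDiff (𝓡 n) 𝓘(ℝ, ℝ) ∞ f) (x : M) :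
    (D X (α.addSMul β f hf)).val x = (D X α).val x +
      (X.lieDeriv f x • (β.mod H).val x + f x • (D X β).val x) := by
  obtain ⟨V, hV⟩ := hH.exists_isLift X
  rw [hD.eq_mod hV, hD.eq_mod hV, hD.eq_mod hV]
  have h1 : mvfderiv (𝓡 p) (f ∘ 𝒢.tgt) (𝒢.unit x) (V.val (𝒢.unit x)) = X.lieDeriv f x := by
    have hfd : MDifferentiableAt (𝓡 n) 𝓘(ℝ, ℝ) f (𝒢.tgt (𝒢.unit x)) :=
      (hf _).mdifferentiableAt (by simp)
    rw [mvfderiv_comp_apply_vector hfd (𝒢.mdiff_tgt _), hV.extends_unit]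
    have e : (_ : EuclideanSpace ℝ (Fin n)) = _ := 𝒢.dtgt_dunit x (X.val x)
    exact (congrArg (mfderiv (𝓡 n) 𝓘(ℝ, ℝ) f (𝒢.tgt (𝒢.unit x))) e).trans
      (mfderiv_congr_point_vec (I := 𝓡 n) (I' := 𝓘(ℝ, ℝ)) f (𝒢.tgt_unit x) _)
  have h2 : (hV.bracketSection (α.addSMul β f hf)).val x = (hV.bracketSection α).val x +
      (X.lieDeriv f x • β.val x + f x • (hV.bracketSection β).val x) := by
    refine Subtype.ext ?_
    refine (AlgSection.mlieBracket_rightInv_addSMul α β hf V.val (𝒢.unit x)).trans ?_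
    rw [h1, rightInv_unit, 𝒢.tgt_unit]
    rfl
  change Submodule.Quotient.mk _ = _
  rw [h2]
  rfl

theorem lieDeriv_const (X : VField n M) (r : ℝ) (x : M) : X.lieDeriv (fun _ => r) x = 0 := by
  unfold VField.lieDeriv
  rw [mfderiv_const]
  rfl

/-- Two representatives of a section of `E` differ by a section of the symbol space, on which `D`
vanishes. Uniqueness holds because every section of `E` is a class. -/
theorem existsUnique_isInduced (hH : 𝒢.IsMultiplicative H) (hD : 𝒢.IsSpencerOperator H D)
    (h : 𝒢.SymbolVanishes H D) : ∃! nab, 𝒢.IsInduced H D nab := by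
  have key : ∀ (X : VField n M) (α α' : 𝒢.AlgSection), α.mod H = α'.mod H → D X α = D X α' := by
    intro X α α' hα
    let β : 𝒢.SymbolSection H := ⟨α.addSMul α' (fun _ => -1) contMDiff_const, fun x => by
      change α.val x + (-1 : ℝ) • α'.val x ∈ _
      rw [neg_one_smul, ← sub_eq_add_neg]
      exact (Submodule.Quotient.eq _).1 (congrArg (fun e => QuotSection.val e x) hα)⟩
    refine QuotSection.ext (funext fun x => ?_)
    have h1 := h β X x
    have h2 := hD.addSMul hH X α α' (f := fun _ => -1) contMDiff_const x
    rw [lieDeriv_const, zero_smul, zero_add, neg_one_smul, ← sub_eq_add_neg] at h2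
    exact sub_eq_zero.1 (h2.symm.trans h1)
  choose r hr using fun e : 𝒢.QuotSection H => e.exists_mod_eq
  refine ⟨fun X e => D X (r e), fun X α => key X _ _ (hr _), fun nab hnab => ?_⟩
  funext X e
  rw [← hnab X (r e), hr]

theorem isConnection (hH : 𝒢.IsMultiplicative H) (hD : 𝒢.IsSpencerOperator H D)
    {nab : VField n M → 𝒢.QuotSection H → 𝒢.QuotSection H} (h : 𝒢.IsInduced H D nab) :
    𝒢.IsConnection H nab where
  add_field X Y Z e hZ x := by
    obtain ⟨α, rfl⟩ := e.exists_mod_eq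
    obtain ⟨V, hV⟩ := hH.exists_isLift X
    obtain ⟨W, hW⟩ := hH.exists_isLift Y
    rw [h, h, h, hD.eq_mod hV, hD.eq_mod hW, hD.eq_mod (hV.add hW hZ)]
    refine congrArg Submodule.Quotient.mk (Subtype.ext ?_)
    exact (V.smoothAt _).mlieBracket_add_left (W.smoothAt _)
  smul_field f X Z e hf hZ x := by
    obtain ⟨α, rfl⟩ := e.exists_mod_eq
    obtain ⟨V, hV⟩ := hH.exists_isLift X
    rw [h, h, hD.eq_mod hV, hD.eq_mod (hV.smul hf hZ)]
    refine congrArg Submodule.Quotient.mk (Subtype.ext ?_)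
    have hfs : ContMDiffAt (𝓡 p) 𝓘(ℝ, ℝ) ∞ (f ∘ 𝒢.src) (𝒢.unit x) :=
      (hf _).comp _ (𝒢.src_smooth _)
    refine (SmoothFieldAt.mlieBracket_smul_left hfs (V.smoothAt _)).trans ?_
    rw [mvfderiv_comp_apply_vector ((hf _).mdifferentiableAt (by simp)) (𝒢.mdiff_src _)]
    have e : mfderiv (𝓡 p) (𝓡 n) 𝒢.src (𝒢.unit x) (α.rightField.val (𝒢.unit x)) = 0 :=
      dsrc_rightInv α _
    rw [e, map_zero, neg_zero, zero_smul, zero_add, Function.comp_apply, 𝒢.src_unit]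
    rfl
  add_section X e₁ e₂ e he x := by
    obtain ⟨α, rfl⟩ := e₁.exists_mod_eq
    obtain ⟨β, rfl⟩ := e₂.exists_mod_eq
    have h1 : e = (α.addSMul β (fun _ => 1) contMDiff_const).mod H := by
      refine QuotSection.ext (funext fun x => (he x).trans ?_)
      change _ = Submodule.Quotient.mk (α.val x + (1 : ℝ) • β.val x)
      rw [one_smul]
      rfl
    rw [h1, h, h, h, hD.addSMul hH, lieDeriv_const, zero_smul, zero_add, one_smul]
  leibniz f X e₁ e hf he x := by
    obtain ⟨α, rfl⟩ := e₁.exists_mod_eq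
    -- The class `f e₁` is represented by `α + (f - 1) α`, to which the rule for `α + f β` applies
    -- directly.
    have hf' : ContMDiff (𝓡 n) 𝓘(ℝ, ℝ) ∞ (fun x => f x - 1) := hf.sub contMDiff_const
    have h1 : e = (α.addSMul α (fun x => f x - 1) hf').mod H := by
      refine QuotSection.ext (funext fun x => (he x).trans ?_)
      change _ = Submodule.Quotient.mk (α.val x + (f x - 1) • α.val x)
      rw [sub_smul, one_smul, add_sub_cancel]
      rfl
    have h2 : X.lieDeriv (fun x => f x - 1) x = X.lieDeriv f x := by
      unfold VField.lieDeriv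
      have : mfderiv (𝓡 n) 𝓘(ℝ, ℝ) (fun x => f x - 1) x = mfderiv (𝓡 n) 𝓘(ℝ, ℝ) f x := by
        have hfd : MDifferentiableAt (𝓡 n) 𝓘(ℝ, ℝ) f x := (hf x).mdifferentiableAt (by simp)
        have := (hfd.hasMFDerivAt.sub (hasMFDerivAt_const (c := (1 : ℝ)) (x := x))).mfderiv
        exact this.trans (sub_zero (mfderiv (𝓡 n) 𝓘(ℝ, ℝ) f x))
      rw [this]
      rfl
    rw [h1, h, h, hD.addSMul hH, h2, sub_smul, one_smul]
    abel

/-- A lift and the right-invariant field of a section of the symbol space are both tangent to `H`.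
-/
theorem symbolVanishes_of_isInvolutive (hH : 𝒢.IsMultiplicative H)
    (hD : 𝒢.IsSpencerOperator H D) (hinv : H.IsInvolutive) : 𝒢.SymbolVanishes H D := by
  intro β X x
  obtain ⟨V, hV⟩ := hH.exists_isLift X
  refine (hD.val_eq_mk_iff hV β.1 (a := 0)).2 ?_
  refine Submodule.sub_mem _ ?_ (Submodule.zero_mem _)
  exact hinv V β.1.rightField hV.tangent (fun g => hH.rightInv_mem.2 (β.2 _)) _

/-- Involutivity makes `[V, W]` a lift of `[X, Y]`, so the curvature at a unit is the Jacobi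
expression of `V`, `W` and `αʳ`. -/
theorem isFlat_of_isInvolutive (hH : 𝒢.IsMultiplicative H)
    (hD : 𝒢.IsSpencerOperator H D) (hinv : H.IsInvolutive)
    {nab : VField n M → 𝒢.QuotSection H → 𝒢.QuotSection H} (h : 𝒢.IsInduced H D nab) :
    𝒢.IsFlat H nab := by
  intro X Y e x
  obtain ⟨α, rfl⟩ := e.exists_mod_eq
  obtain ⟨V, hV⟩ := hH.exists_isLift X
  obtain ⟨W, hW⟩ := hH.exists_isLift Y
  rw [h, h, h, hD.eq_mod hV, hD.eq_mod hW, h, h, hD.eq_mod hV, hD.eq_mod hW,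
    hD.eq_mod (hV.bracket hW (hinv V W hV.tangent hW.tangent))]
  -- Iterating `D` re-extends `[W, αʳ]` from the units by right invariance. The two extensions agree
  -- on the units, and `V` is tangent to the units there, so their brackets with `V` agree at the
  -- units.
  have hdef : ∀ {X : VField n M} {V : VField p G} (hV : 𝒢.IsLift H X V) {Y : VField n M}
      {W : VField p G} (hW : 𝒢.IsLift H Y W),
      mlieBracket (𝓡 p) V.val (𝒢.rightInv (hW.bracketSection α)) (𝒢.unit x) =
        mlieBracket (𝓡 p) V.val (mlieBracket (𝓡 p) W.val (𝒢.rightInv α)) (𝒢.unit x) := by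
    intro X V hV Y W hW
    have hs : ∀ g, SmoothFieldAt (mlieBracket (𝓡 p) W.val (𝒢.rightInv α)) g := fun g =>
      (W.smoothAt g).mlieBracket (smooth_rightInv α g)
    rw [← sub_eq_zero, ← (smooth_rightInv (hW.bracketSection α) _).mlieBracket_sub_right (hs _)]
    refine hV.mlieBracket_unit_eq_zero
      ((smooth_rightInv (hW.bracketSection α) _).sub (hs _)) fun y => ?_
    change 𝒢.rightInv (hW.bracketSection α) (𝒢.unit y) - _ = 0
    rw [rightInv_unit, sub_eq_zero]
    rfl
  have hjac := (V.smoothAt (𝒢.unit x)).leibniz_mlieBracket (W.smoothAt _)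
    (smooth_rightInv α (𝒢.unit x))
  have h1 : (hV.bracketSection (hW.bracketSection α)).val x -
      (hW.bracketSection (hV.bracketSection α)).val x -
      ((hV.bracket hW (hinv V W hV.tangent hW.tangent)).bracketSection α).val x = 0 := by
    refine Subtype.ext ?_
    change mlieBracket (𝓡 p) V.val (𝒢.rightInv (hW.bracketSection α)) (𝒢.unit x) -
      mlieBracket (𝓡 p) W.val (𝒢.rightInv (hV.bracketSection α)) (𝒢.unit x) -
      mlieBracket (𝓡 p) (mlieBracket (𝓡 p) V.val W.val) (𝒢.rightInv α) (𝒢.unit x) = 0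
    rw [hdef hV hW, hdef hW hV]
    refine (congrArg (fun z => z - _ - _) hjac).trans ?_
    rw [add_sub_cancel_right, sub_self]
  change Submodule.Quotient.mk (_ - _ - _) = _
  rw [h1]
  rfl

end IsSpencerOperator

end Spencer

end LieGroupoid

/-! ### Finite sums in brackets, and tensoriality modulo a distribution. -/

section Sums

variable {n : ℕ} {N : Type*} [TopologicalSpace N]
  [ChartedSpace (EuclideanSpace ℝ (Fin n)) N] [IsManifold (𝓡 n) ∞ N]
  {x : N}

theorem SmoothFieldAt.const_smul {V : ∀ x : N, TangentSpace (𝓡 n) x} (hV : SmoothFieldAt V x)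
    (a : ℝ) : SmoothFieldAt (a • V) x :=
  SmoothFieldAt.smul (f := fun _ => a) contMDiffAt_const hV

theorem SmoothFieldAt.mlieBracket_sum_right {ι : Type*} (s : Finset ι)
    {W : ι → ∀ x : N, TangentSpace (𝓡 n) x} (hW : ∀ i ∈ s, SmoothFieldAt (W i) x)
    (V : ∀ x : N, TangentSpace (𝓡 n) x) :
    VectorField.mlieBracket (𝓡 n) V (fun y => ∑ i ∈ s, W i y) x =
      ∑ i ∈ s, VectorField.mlieBracket (𝓡 n) V (W i) x := by
  classical
  induction s using Finset.induction_on with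
  | empty =>
    simp only [Finset.sum_empty]
    exact mlieBracket_zero_field
  | insert i s hi ih =>
    have h1 : (fun y => ∑ j ∈ insert i s, W j y) = W i + fun y => ∑ j ∈ s, W j y := by
      funext y
      rw [Finset.sum_insert hi]
      rfl
    have hs : ∀ j ∈ s, SmoothFieldAt (W j) x := fun j hj => hW j (Finset.mem_insert_of_mem hj)
    rw [h1, (hW i (Finset.mem_insert_self i s)).mlieBracket_add_right (SmoothFieldAt.sum hs), ih hs,
      Finset.sum_insert hi]

theorem SmoothFieldAt.mlieBracket_const_smul_right {V W : ∀ x : N, TangentSpace (𝓡 n) x}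
    (hW : SmoothFieldAt W x) (a : ℝ) :
    VectorField.mlieBracket (𝓡 n) V (a • W) x = a • VectorField.mlieBracket (𝓡 n) V W x :=
  VectorField.mlieBracket_const_smul_right hW.mdiff

theorem TangentDistribution.mlieBracket_mem_swap (H : TangentDistribution n N)
    {V W : ∀ x : N, TangentSpace (𝓡 n) x} (h : mlieBracket (𝓡 n) V W x ∈ H.fiber x) :
    mlieBracket (𝓡 n) W V x ∈ H.fiber x := by
  rw [mlieBracket_swap_apply]
  exact Submodule.neg_mem _ h

/-- The curvature of a distribution is a tensor: whether a bracket of tangent fields lies in it at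
`x` depends only on the values at `x`. Each argument is replaced in turn, using antisymmetry. -/
theorem TangentDistribution.mlieBracket_mem_congr [T2Space N] [SecondCountableTopology N]
    (H : TangentDistribution n N) {V V' W W' : VField n N} (hV : ∀ y, V.val y ∈ H.fiber y)
    (hV' : ∀ y, V'.val y ∈ H.fiber y) (hW : ∀ y, W.val y ∈ H.fiber y)
    (hW' : ∀ y, W'.val y ∈ H.fiber y) (h1 : V.val x = V'.val x) (h2 : W.val x = W'.val x)
    (h : mlieBracket (𝓡 n) V.val W.val x ∈ H.fiber x) :
    mlieBracket (𝓡 n) V'.val W'.val x ∈ H.fiber x := by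
  have h3 := H.mlieBracket_sub_mlieBracket_mem (V'.smoothAt x) (V.smoothAt x) (W.smoothAt x)
    (Filter.Eventually.of_forall hV') (Filter.Eventually.of_forall hV) h1.symm
  have h4 := H.mlieBracket_sub_mlieBracket_mem (W'.smoothAt x) (W.smoothAt x) (V'.smoothAt x)
    (Filter.Eventually.of_forall hW') (Filter.Eventually.of_forall hW) h2.symm
  have h5 := (Submodule.sub_mem_iff_left _ h).1 h3
  have h6 := (Submodule.sub_mem_iff_left _ (H.mlieBracket_mem_swap h5)).1 h4
  exact H.mlieBracket_mem_swap h6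

end Sums

/-- Intersect with `K` any complement of `H ⊓ K`; the modular law shows that the result complements
`H`. -/
theorem Submodule.exists_isCompl_le {V : Type*} [AddCommGroup V] [Module ℝ V]
    {H K : Submodule ℝ V} (h : H ⊔ K = ⊤) : ∃ C ≤ K, IsCompl H C := by
  obtain ⟨C, hC⟩ := (H ⊓ K).exists_isCompl
  refine ⟨C ⊓ K, inf_le_right, ?_, ?_⟩
  · rw [disjoint_iff, ← inf_assoc, inf_right_comm]
    exact hC.inf_eq_bot
  · rw [codisjoint_iff, eq_top_iff, ← h]
    refine sup_le le_sup_left ?_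
    have h1 : H ⊓ K ⊔ C ⊓ K = K := by
      rw [← sup_inf_assoc_of_le _ inf_le_right, hC.sup_eq_top, top_inf_eq]
    calc K = H ⊓ K ⊔ C ⊓ K := h1.symm
      _ ≤ H ⊔ C ⊓ K := sup_le_sup_right inf_le_left _

/-! ### Inversion, target-projectable fields, and involutivity at the units. -/

namespace LieGroupoid

variable {p n : ℕ} {G M : Type*}
  [TopologicalSpace G] [ChartedSpace (EuclideanSpace ℝ (Fin p)) G] [IsManifold (𝓡 p) ∞ G]
  [TopologicalSpace M] [ChartedSpace (EuclideanSpace ℝ (Fin n)) M] [IsManifold (𝓡 n) ∞ M]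
  {𝒢 : LieGroupoid p n G M} {H : TangentDistribution p G}

/-- The image of a vector field under the inversion. -/
noncomputable def invField (𝒢 : LieGroupoid p n G M) (V : VField p G) : VField p G where
  val g := (𝒢.dinv (𝒢.inv g) (V.val (𝒢.inv g)) : EuclideanSpace ℝ (Fin p))
  smooth := fun g => by
    have h1 : ContMDiffAt (𝓡 p) (𝓡 p).tangent ∞
        (fun g => (⟨𝒢.inv g, V.val (𝒢.inv g)⟩ : TangentBundle (𝓡 p) G)) g :=
      (V.smooth _).comp g (𝒢.inv_smooth g)
    refine (ContMDiffAt.mfderiv_apply_field (𝒢.inv_smooth (𝒢.inv g)) h1).congr_of_eventuallyEq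
      (Filter.Eventually.of_forall fun k => ?_)
    exact (totalSpace_mk_eq (𝒢.inv_inv k) _).symm

theorem invField_eq {V : VField p G} {g : G} {v : TangentSpace (𝓡 p) g}
    (h : V.val (𝒢.inv g) = 𝒢.dinv g v) : (𝒢.invField V).val g = v :=
  (congrArg (𝒢.dinv (𝒢.inv g)) h).trans (𝒢.dinv_dinv g v)

theorem dtgt_invField (V : VField p G) (g : G) :
    (𝒢.dtgt g ((𝒢.invField V).val g) : EuclideanSpace ℝ (Fin n)) =
      𝒢.dsrc (𝒢.inv g) (V.val (𝒢.inv g)) :=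
  (mfderiv_congr_point_vec (I := 𝓡 p) (I' := 𝓡 n) 𝒢.tgt (𝒢.inv_inv g).symm _).trans
    (𝒢.dtgt_dinv (𝒢.inv g) (V.val (𝒢.inv g)))

theorem dsrc_dinv (g : G) (v : TangentSpace (𝓡 p) g) :
    (𝒢.dsrc (𝒢.inv g) (𝒢.dinv g v) : EuclideanSpace ℝ (Fin n)) = 𝒢.dtgt g v := by
  have h := 𝒢.dtgt_dinv (𝒢.inv g) (𝒢.dinv g v)
  rw [← h]
  have e : (𝒢.dinv (𝒢.inv g) (𝒢.dinv g v) : EuclideanSpace ℝ (Fin p)) = v := 𝒢.dinv_dinv g v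
  refine (mfderiv_congr_point_vec (I := 𝓡 p) (I' := 𝓡 n) 𝒢.tgt (𝒢.inv_inv g) _).trans ?_
  exact congrArg (𝒢.dtgt g) e

variable [T2Space G] [SecondCountableTopology G]

theorem IsMultiplicative.exists_dtgt_eq (hH : 𝒢.IsMultiplicative H) (g : G)
    (X : TangentSpace (𝓡 n) (𝒢.tgt g)) : ∃ v ∈ H.fiber g, 𝒢.dtgt g v = X := by
  obtain ⟨Y, hY⟩ : ∃ Y : TangentSpace (𝓡 n) (𝒢.src (𝒢.inv g)),
    (Y : EuclideanSpace ℝ (Fin n)) = X := ⟨(X : EuclideanSpace ℝ (Fin n)), rfl⟩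
  obtain ⟨v, hv, hvY⟩ := hH.exists_dsrc_eq (𝒢.inv g) Y
  refine ⟨(𝒢.dinv (𝒢.inv g) v : EuclideanSpace ℝ (Fin p)),
    H.mem_fiber_of_eq (𝒢.inv_inv g) (hH.inv_mem _ v hv), ?_⟩
  refine (mfderiv_congr_point_vec (I := 𝓡 p) (I' := 𝓡 n) 𝒢.tgt (𝒢.inv_inv g).symm _).trans ?_
  exact (𝒢.dtgt_dinv (𝒢.inv g) v).trans
    ((hvY : (𝒢.dsrc (𝒢.inv g) v : EuclideanSpace ℝ (Fin n)) = Y).trans hY)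

/-- Vector fields with vertical values for the target map. -/
theorem exists_tgt_vertical {g : G} {v : TangentSpace (𝓡 p) g} (hv : 𝒢.dtgt g v = 0) :
    ∃ V : VField p G, V.val g = v ∧ ∀ k, 𝒢.dtgt k (V.val k) = 0 := by
  obtain ⟨α, hα⟩ := exists_rightInv_eq (𝒢 := 𝒢) (g := 𝒢.inv g) (v := 𝒢.dinv g v)
    ((dsrc_dinv g v).trans hv)
  exact ⟨𝒢.invField α.rightField, invField_eq hα, fun k =>
    (dtgt_invField _ k).trans (dsrc_rightInv α _)⟩

variable [T2Space M] [SecondCountableTopology M]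

/-- Subtracting a lift of an extension of `ds v` leaves a vector of `H` vertical for the source,
which comes from the symbol space. -/
theorem IsMultiplicative.exists_isLift_add_rightInv (hH : 𝒢.IsMultiplicative H) {g : G}
    {v : TangentSpace (𝓡 p) g} (hv : v ∈ H.fiber g) :
    ∃ (X : VField n M) (V : VField p G) (β : 𝒢.SymbolSection H), 𝒢.IsLift H X V ∧
      V.val g + 𝒢.rightInv β.1 g = v := by
  obtain ⟨X, hX⟩ := VField.exists_eq (𝒢.src g) (𝒢.dsrc g v)
  obtain ⟨V, hV⟩ := hH.exists_isLift X
  obtain ⟨β, hβ⟩ := hH.exists_symbolSection_rightInv_eq (g := g) (v := v - V.val g)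
    (by rw [map_sub, hV.projects, hX, sub_self]) (Submodule.sub_mem _ hv (hV.tangent g))
  exact ⟨X, V, β, hV, by rw [hβ, add_sub_cancel]⟩

/-- Inversion exchanges source and target and preserves `H`, so the construction at `g⁻¹` is carried
over to `g`. -/
theorem IsMultiplicative.exists_tgt_projectable (hH : 𝒢.IsMultiplicative H) {g : G}
    {v : TangentSpace (𝓡 p) g} (hv : v ∈ H.fiber g) :
    ∃ (X : VField n M) (V : VField p G), V.val g = v ∧ (∀ k, V.val k ∈ H.fiber k) ∧
      ∀ k, 𝒢.dtgt k (V.val k) = X.val (𝒢.tgt k) := by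
  obtain ⟨X, V, β, hV, hVβ⟩ := hH.exists_isLift_add_rightInv (hH.inv_mem g v hv)
  set W : VField p G := ⟨V.val + β.1.rightField.val,
    fun g => (V.smoothAt g).add (β.1.rightField.smoothAt g)⟩ with hW
  have hWH : ∀ k, W.val k ∈ H.fiber k := fun k =>
    Submodule.add_mem _ (hV.tangent k) (hH.rightInv_mem.2 (β.2 _))
  refine ⟨X, 𝒢.invField W, invField_eq hVβ, fun k => ?_, fun k => ?_⟩
  · exact H.mem_fiber_of_eq (𝒢.inv_inv k) (hH.inv_mem _ _ (hWH (𝒢.inv k)))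
  · refine (dtgt_invField W k).trans ?_
    change 𝒢.dsrc (𝒢.inv k) (V.val (𝒢.inv k) + 𝒢.rightInv β.1 (𝒢.inv k)) = _
    rw [map_add, dsrc_rightInv, add_zero, hV.projects]
    exact field_eq_of_eq X.val (𝒢.src_inv k)

namespace IsSpencerOperator

variable {D : VField n M → 𝒢.AlgSection → 𝒢.QuotSection H}

/-- The bracket of a vector field tangent to the distribution with a right-invariant vector field
is given, modulo the distribution, by the Spencer operator. -/
theorem mlieBracket_sub_rightTrans_mem (hH : 𝒢.IsMultiplicative H)
    (hD : 𝒢.IsSpencerOperator H D) {g : G}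
    {V : ∀ g : G, TangentSpace (𝓡 p) g} (hV : SmoothFieldAt V g)
    (hVH : ∀ᶠ k in 𝓝 g, V k ∈ H.fiber k) (α : 𝒢.AlgSection) {Y : VField n M}
    (hYV : 𝒢.dtgt g (V g) = Y.val (𝒢.tgt g)) {a : 𝒢.algFiber (𝒢.tgt g)}
    (ha : (D Y α).val (𝒢.tgt g) = Submodule.Quotient.mk a) :
    mlieBracket (𝓡 p) V (𝒢.rightInv α) g - 𝒢.rightTrans g a.1 ∈ H.fiber g := by
  obtain ⟨Y', hY'⟩ := hH.exists_isLift Y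
  have h1 := hH.mlieBracket_rightInv_sub_rightTrans_mem hV hVH α hY' hYV
  have h2 := (hD.val_eq_mk_iff hY' α).1 ha
  have hmem : mlieBracket (𝓡 p) Y'.val (𝒢.rightInv α) (𝒢.unit (𝒢.tgt g)) - a.1 ∈
      𝒢.algFiber (𝒢.tgt g) :=
    Submodule.sub_mem _ ((hY'.bracketSection α).val _).2 a.2
  have h3 := (hH.rightTrans_mem_iff hmem).2 h2
  rw [map_sub] at h3
  have h4 := Submodule.add_mem _ h1 h3
  rwa [sub_add_sub_cancel] at h4

theorem mlieBracket_sub_rightInv_mem (hH : 𝒢.IsMultiplicative H)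
    (hD : 𝒢.IsSpencerOperator H D) {g : G}
    {V : ∀ g : G, TangentSpace (𝓡 p) g} (hV : SmoothFieldAt V g)
    (hVH : ∀ᶠ k in 𝓝 g, V k ∈ H.fiber k) {α γ : 𝒢.AlgSection} {Y : VField n M}
    (hYV : 𝒢.dtgt g (V g) = Y.val (𝒢.tgt g)) (hγ : γ.mod H = D Y α) :
    mlieBracket (𝓡 p) V (𝒢.rightInv α) g - 𝒢.rightInv γ g ∈ H.fiber g := by
  rw [𝒢.rightInv_eq γ]
  exact hD.mlieBracket_sub_rightTrans_mem hH hV hVH α hYV (by rw [← hγ]; rfl)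

/-- The bracket is controlled by `D_Y β`, with `Y` extending `dt (V g)`; its class is zero, so its
right translate can be taken to be zero. -/
theorem mlieBracket_symbol_mem (hH : 𝒢.IsMultiplicative H)
    (hD : 𝒢.IsSpencerOperator H D) (hs : 𝒢.SymbolVanishes H D) {V : VField p G}
    (hV : ∀ g, V.val g ∈ H.fiber g) (β : 𝒢.SymbolSection H) (g : G) :
    mlieBracket (𝓡 p) V.val (𝒢.rightInv β.1) g ∈ H.fiber g := by
  obtain ⟨Y, hY⟩ := VField.exists_eq (𝒢.tgt g) (𝒢.dtgt g (V.val g))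
  have := hD.mlieBracket_sub_rightTrans_mem hH (V.smoothAt g) (Filter.Eventually.of_forall hV) β.1
    hY.symm (a := 0) (hs β Y (𝒢.tgt g))
  have h0 : 𝒢.rightTrans g (0 : 𝒢.algFiber (𝒢.tgt g)).1 = 0 := map_zero _
  rwa [h0, sub_zero] at this

/-- By tensoriality both fields may be replaced by a lift plus a right-invariant field of the symbol
space. The bracket of the lifts is in the image of `du`, and the three other terms involve the
symbol space. -/
theorem mlieBracket_mem_unit (hH : 𝒢.IsMultiplicative H)
    (hD : 𝒢.IsSpencerOperator H D) (hs : 𝒢.SymbolVanishes H D) {V W : VField p G}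
    (hV : ∀ g, V.val g ∈ H.fiber g) (hW : ∀ g, W.val g ∈ H.fiber g) (x : M) :
    mlieBracket (𝓡 p) V.val W.val (𝒢.unit x) ∈ H.fiber (𝒢.unit x) := by
  obtain ⟨X, V₀, β, hV₀, hVβ⟩ := hH.exists_isLift_add_rightInv (hV (𝒢.unit x))
  obtain ⟨Y, W₀, γ, hW₀, hWγ⟩ := hH.exists_isLift_add_rightInv (hW (𝒢.unit x))
  have hβ : ∀ g, β.1.rightField.val g ∈ H.fiber g := fun g => hH.rightInv_mem.2 (β.2 _)
  have hγ : ∀ g, γ.1.rightField.val g ∈ H.fiber g := fun g => hH.rightInv_mem.2 (γ.2 _)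
  refine H.mlieBracket_mem_congr
    (V := ⟨V₀.val + β.1.rightField.val, fun g => (V₀.smoothAt g).add (β.1.rightField.smoothAt g)⟩)
    (W := ⟨W₀.val + γ.1.rightField.val, fun g => (W₀.smoothAt g).add (γ.1.rightField.smoothAt g)⟩)
    (fun g => Submodule.add_mem _ (hV₀.tangent g) (hβ g)) hV
    (fun g => Submodule.add_mem _ (hW₀.tangent g) (hγ g)) hW hVβ hWγ ?_
  change mlieBracket (𝓡 p) (V₀.val + β.1.rightField.val) (W₀.val + γ.1.rightField.val)
    (𝒢.unit x) ∈ _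
  rw [(V₀.smoothAt _).mlieBracket_add_left (β.1.rightField.smoothAt _),
    (W₀.smoothAt _).mlieBracket_add_right (γ.1.rightField.smoothAt _),
    (W₀.smoothAt _).mlieBracket_add_right (γ.1.rightField.smoothAt _)]
  refine Submodule.add_mem _ (Submodule.add_mem _ ?_ ?_) (Submodule.add_mem _ ?_ ?_)
  · rw [hV₀.mlieBracket_unit hW₀]
    exact hH.unit_mem x _
  · exact hD.mlieBracket_symbol_mem hH hs hV₀.tangent γ _
  · exact H.mlieBracket_mem_swap (hD.mlieBracket_symbol_mem hH hs hW₀.tangent β _)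
  · exact hD.mlieBracket_symbol_mem hH hs hβ γ _

end IsSpencerOperator

end LieGroupoid

/-! ### Adapted frames and the differential equation of the curvature. -/

namespace LieGroupoid

variable {p n : ℕ} {G M : Type*}
  [TopologicalSpace G] [ChartedSpace (EuclideanSpace ℝ (Fin p)) G] [IsManifold (𝓡 p) ∞ G]
  [TopologicalSpace M] [ChartedSpace (EuclideanSpace ℝ (Fin n)) M] [IsManifold (𝓡 n) ∞ M]

/-- A frame near `g₀` consisting of vector fields which are tangent to `H` and
`t`-projectable, and of `t`-vertical vector fields; with its dual coframe in a chart. -/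
structure AdaptedFrame (𝒢 : LieGroupoid p n G M) (H : TangentDistribution p G) (g₀ : G) where
  m : ℕ
  V : Fin H.rank → VField p G
  X : Fin H.rank → VField n M
  Q : Fin m → VField p G
  form : G → EuclideanSpace ℝ (Fin p) →L[ℝ] (Fin H.rank ⊕ Fin m → ℝ)
  tangent : ∀ i g, (V i).val g ∈ H.fiber g
  projects : ∀ i g, 𝒢.dtgt g ((V i).val g) = (X i).val (𝒢.tgt g)
  vertical : ∀ b g, 𝒢.dtgt g ((Q b).val g) = 0
  isCoframe : ∀ᶠ g in 𝓝 g₀, g ∈ (chartAt (EuclideanSpace ℝ (Fin p)) g₀).source ∧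
    ContMDiffAt (𝓡 p) 𝓘(ℝ, EuclideanSpace ℝ (Fin p) →L[ℝ] (Fin H.rank ⊕ Fin m → ℝ)) ∞ form g ∧
    (∀ i, form g (mvfderiv (𝓡 p) (extChartAt (𝓡 p) g₀) g ((V i).val g)) =
      Pi.single (Sum.inl i) 1) ∧
    (∀ b, form g (mvfderiv (𝓡 p) (extChartAt (𝓡 p) g₀) g ((Q b).val g)) =
      Pi.single (Sum.inr b) 1) ∧
    (∀ v : TangentSpace (𝓡 p) g,
      v = ∑ i, form g (mvfderiv (𝓡 p) (extChartAt (𝓡 p) g₀) g v) (Sum.inl i) • (V i).val g +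
        ∑ b, form g (mvfderiv (𝓡 p) (extChartAt (𝓡 p) g₀) g v) (Sum.inr b) • (Q b).val g) ∧
    ∀ v : TangentSpace (𝓡 p) g, v ∈ H.fiber g ↔
      ∀ b, form g (mvfderiv (𝓡 p) (extChartAt (𝓡 p) g₀) g v) (Sum.inr b) = 0

variable {𝒢 : LieGroupoid p n G M} {H : TangentDistribution p G}

/-- Since `dt` is onto on `H`, the tangent space is the sum of `H` and `ker dt`, so a complement of
`H` can be chosen inside `ker dt`. Vertical complementary fields are needed so that the part of a
bracket in `H` keeps its full `dt`-image. -/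
theorem IsMultiplicative.nonempty_adaptedFrame [T2Space G] [SecondCountableTopology G]
    [T2Space M] [SecondCountableTopology M] (hH : 𝒢.IsMultiplicative H) (g₀ : G) :
    Nonempty (AdaptedFrame 𝒢 H g₀) := by
  have := finiteDimensional_tangentSpace (p := p) g₀
  have hsup : H.fiber g₀ ⊔ LinearMap.ker (𝒢.dtgt g₀).toLinearMap = ⊤ := by
    rw [eq_top_iff]
    intro v _
    obtain ⟨w, hw, hwv⟩ := hH.exists_dtgt_eq g₀ (𝒢.dtgt g₀ v)
    rw [← add_sub_cancel w v]
    refine Submodule.add_mem_sup hw ?_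
    change 𝒢.dtgt g₀ (v - w) = 0
    rw [map_sub, hwv, sub_self]
  obtain ⟨C, hCK, hC⟩ := Submodule.exists_isCompl_le hsup
  set bH := Module.finBasisOfFinrankEq ℝ (H.fiber g₀) (H.finrank_fiber g₀)
  set bC := Module.finBasis ℝ C
  choose X V hV hVH hVX using fun i => hH.exists_tgt_projectable (bH i).2
  choose Q hQ hQt using fun b => exists_tgt_vertical (𝒢 := 𝒢) (hCK (bC b).2)
  have hli : LinearIndependent ℝ (fun i => (Sum.elim V Q i).val g₀) := by
    have h1 : LinearIndependent ℝ (fun i => (V i).val g₀) := by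
      simp only [hV]
      exact bH.linearIndependent.map' (H.fiber g₀).subtype (Submodule.ker_subtype _)
    have h2 : LinearIndependent ℝ (fun i => (Q i).val g₀) := by
      simp only [hQ]
      exact bC.linearIndependent.map' C.subtype (Submodule.ker_subtype _)
    have := h1.sum_type h2 (hC.disjoint.mono ?_ ?_)
    · have e : (fun i => (Sum.elim V Q i).val g₀) =
          Sum.elim (fun i => (V i).val g₀) fun i => (Q i).val g₀ := by
        ext1 i
        cases i <;> rfl
      rw [e]
      exact this
    · rw [Submodule.span_le]
      rintro _ ⟨i, rfl⟩
      simp only [hV]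
      exact (bH i).2
    · rw [Submodule.span_le]
      rintro _ ⟨i, rfl⟩
      simp only [hQ]
      exact (bC i).2
  obtain ⟨θ, hθ⟩ := H.exists_adapted_coframe (x₀ := g₀) (Z := fun i => (Sum.elim V Q i).val)
    (fun i => Filter.Eventually.of_forall fun x => (Sum.elim V Q i).smoothAt x)
    (fun i => Filter.Eventually.of_forall fun x => hVH i x) hli
    (Fintype.card_fin _)
    (by
      rw [Fintype.card_sum, Fintype.card_fin, Fintype.card_fin, ← H.finrank_fiber g₀,
        Submodule.finrank_add_eq_of_isCompl hC]
      exact finrank_tangentSpace g₀)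
  refine ⟨⟨_, V, X, Q, θ, hVH, hVX, hQt, ?_⟩⟩
  filter_upwards [hθ, (chartAt (EuclideanSpace ℝ (Fin p)) g₀).open_source.mem_nhds
    (mem_chart_source _ g₀)] with g h1 h2
  refine ⟨h2, h1.1, fun i => h1.2.1 (Sum.inl i), fun b => h1.2.1 (Sum.inr b), fun v => ?_,
    h1.2.2.2⟩
  refine (h1.2.2.1 v).trans ?_
  rw [Fintype.sum_sum_type]
  rfl

namespace AdaptedFrame

variable {g₀ : G} (F : AdaptedFrame 𝒢 H g₀)

/-- The coordinates of a tangent vector in the frame. -/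
noncomputable def coord (g : G) : TangentSpace (𝓡 p) g →L[ℝ] (Fin H.rank ⊕ Fin F.m → ℝ) :=
  F.form g ∘L mvfderiv (𝓡 p) (extChartAt (𝓡 p) g₀) g

theorem mem_iff : ∀ᶠ g in 𝓝 g₀, ∀ v : TangentSpace (𝓡 p) g,
    v ∈ H.fiber g ↔ ∀ b, F.coord g v (Sum.inr b) = 0 :=
  F.isCoframe.mono fun _ h => h.2.2.2.2.2

theorem coord_Q : ∀ᶠ g in 𝓝 g₀, ∀ b, F.coord g ((F.Q b).val g) = Pi.single (Sum.inr b) 1 :=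
  F.isCoframe.mono fun _ h => h.2.2.2.1

theorem eq_sum : ∀ᶠ g in 𝓝 g₀, ∀ v : TangentSpace (𝓡 p) g,
    v = ∑ i, F.coord g v (Sum.inl i) • (F.V i).val g +
      ∑ b, F.coord g v (Sum.inr b) • (F.Q b).val g :=
  F.isCoframe.mono fun _ h => h.2.2.2.2.1

theorem contMDiffAt_coord {W : ∀ g : G, TangentSpace (𝓡 p) g} : ∀ᶠ g in 𝓝 g₀,
    SmoothFieldAt W g → ∀ i, ContMDiffAt (𝓡 p) 𝓘(ℝ, ℝ) ∞ (fun k => F.coord k (W k) i) g :=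
  F.isCoframe.mono fun _ h hW i => contMDiffAt_pi_space.1 (h.2.1.coframe_apply h.1 hW) i

/-- The components transverse to `H` of the brackets of the vector fields of the frame. -/
noncomputable def curv (g : G) (i j : Fin H.rank) (b : Fin F.m) : ℝ :=
  F.coord g (mlieBracket (𝓡 p) (F.V i).val (F.V j).val g) (Sum.inr b)

variable [T2Space G] [SecondCountableTopology G]

theorem coord_mlieBracket : ∀ᶠ g in 𝓝 g₀, ∀ (i : Fin H.rank) (W : ∀ g : G, TangentSpace (𝓡 p) g),
    SmoothFieldAt W g → (∀ᶠ k in 𝓝 g, W k ∈ H.fiber k) → ∀ b,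
    F.coord g (mlieBracket (𝓡 p) (F.V i).val W g) (Sum.inr b) =
      ∑ l, F.coord g (W g) (Sum.inl l) * F.curv g i l b := by
  filter_upwards [F.mem_iff, F.eq_sum] with g h1 h2 i W hW hWH b
  -- `W` is replaced by the combination of the frame with coefficients frozen at `g`. It has the
  -- same value there, hence the same bracket modulo `H`, and constant coefficients produce no
  -- derivative terms.
  set W' : ∀ g : G, TangentSpace (𝓡 p) g := fun k =>
    ∑ l, (F.coord g (W g) (Sum.inl l) • (F.V l).val) k with hW'
  have hs : ∀ l ∈ Finset.univ, SmoothFieldAt (F.coord g (W g) (Sum.inl l) • (F.V l).val) g :=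
    fun l _ => ((F.V l).smoothAt g).const_smul _
  have hWW' : W g = W' g := by
    refine (h2 (W g)).trans ?_
    have h3 := (h1 (W g)).1 hWH.self_of_nhds
    simp only [h3, zero_smul, Finset.sum_const_zero, add_zero]
    rfl
  have h3 := H.mlieBracket_sub_mlieBracket_mem hW (SmoothFieldAt.sum hs) ((F.V i).smoothAt g)
    hWH (Filter.Eventually.of_forall fun k => Submodule.sum_mem _ fun l _ =>
      Submodule.smul_mem _ _ (F.tangent l k)) hWW'
  have h4 : F.coord g (mlieBracket (𝓡 p) (F.V i).val W' g) (Sum.inr b) =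
      ∑ l, F.coord g (W g) (Sum.inl l) * F.curv g i l b := by
    rw [hW', SmoothFieldAt.mlieBracket_sum_right _ hs, map_sum, Finset.sum_apply]
    refine Finset.sum_congr rfl fun l _ => ?_
    rw [((F.V l).smoothAt g).mlieBracket_const_smul_right, map_smul]
    rfl
  rw [← h4, mlieBracket_swap_apply, mlieBracket_swap_apply (W := W')]
  have h5 := (h1 _).1 h3 b
  rw [map_sub, Pi.sub_apply, sub_eq_zero] at h5
  rw [map_neg, map_neg, Pi.neg_apply, Pi.neg_apply, h5]

/-- The left side does not mention the frame, so vanishing of `curv` can be compared between frames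
centred at different points. -/
theorem mlieBracket_mem_iff : ∀ᶠ g in 𝓝 g₀,
    (∀ V W : VField p G, (∀ k, V.val k ∈ H.fiber k) → (∀ k, W.val k ∈ H.fiber k) →
      mlieBracket (𝓡 p) V.val W.val g ∈ H.fiber g) ↔ F.curv g = 0 := by
  filter_upwards [F.mem_iff, F.eq_sum, F.coord_mlieBracket] with g h1 h2 h3
  constructor
  · intro h
    funext i j b
    exact (h1 _).1 (h (F.V i) (F.V j) (F.tangent i) (F.tangent j)) b
  · intro h V W hV hW
    have hi : ∀ i, mlieBracket (𝓡 p) (F.V i).val W.val g ∈ H.fiber g := by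
      intro i
      rw [h1]
      intro b
      rw [h3 i W.val (W.smoothAt g) (Filter.Eventually.of_forall hW) b, h]
      simp
    set V' : ∀ g : G, TangentSpace (𝓡 p) g := fun k =>
      ∑ l, (F.coord g (V.val g) (Sum.inl l) • (F.V l).val) k with hV'
    have hs : ∀ l ∈ Finset.univ, SmoothFieldAt (F.coord g (V.val g) (Sum.inl l) • (F.V l).val) g :=
      fun l _ => ((F.V l).smoothAt g).const_smul _
    have hVV' : V.val g = V' g := by
      refine (h2 (V.val g)).trans ?_
      have h3 := (h1 (V.val g)).1 (hV g)
      simp only [h3, zero_smul, Finset.sum_const_zero, add_zero]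
      rfl
    have h4 := H.mlieBracket_sub_mlieBracket_mem (V.smoothAt g) (SmoothFieldAt.sum hs)
      (W.smoothAt g) (Filter.Eventually.of_forall hV)
      (Filter.Eventually.of_forall fun k => Submodule.sum_mem _ fun l _ =>
        Submodule.smul_mem _ _ (F.tangent l k)) hVV'
    refine (Submodule.sub_mem_iff_left _ ?_).1 h4
    refine H.mlieBracket_mem_swap ?_
    rw [SmoothFieldAt.mlieBracket_sum_right _ hs]
    refine Submodule.sum_mem _ fun l _ => ?_
    rw [((F.V l).smoothAt g).mlieBracket_const_smul_right]
    exact Submodule.smul_mem _ _ (H.mlieBracket_mem_swap (hi l))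

variable [T2Space M] [SecondCountableTopology M]

/-- The derivatives along right-invariant vector fields of the components transverse to `H` of the
brackets depend linearly on these components. -/
theorem exists_mvfderiv_curv_eq (hH : 𝒢.IsMultiplicative H)
    {D : VField n M → 𝒢.AlgSection → 𝒢.QuotSection H} (hD : 𝒢.IsSpencerOperator H D)
    {nab : VField n M → 𝒢.QuotSection H → 𝒢.QuotSection H} (hnab : 𝒢.IsInduced H D nab)
    (hflat : 𝒢.IsFlat H nab) (β : 𝒢.AlgSection) :
    ∃ κ : Fin H.rank → VField p G, ∀ᶠ g in 𝓝 g₀, ∀ i j b,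
      mvfderiv (𝓡 p) (fun k => F.curv k i j b) g (𝒢.rightInv β g) =
        ∑ c, F.curv g i j c *
          F.coord g (mlieBracket (𝓡 p) (F.Q c).val (𝒢.rightInv β) g) (Sum.inr b) -
        ∑ l, F.coord g ((κ j).val g) (Sum.inl l) * F.curv g i l b +
        ∑ l, F.coord g ((κ i).val g) (Sum.inl l) * F.curv g j l b := by
  choose γ hγ using fun j => (D (F.X j) β).exists_mod_eq
  choose γγ hγγ using fun i j => (D (F.X i) (γ j)).exists_mod_eq
  choose δ hδ using fun i j => (D ((F.X i).bracket (F.X j)) β).exists_mod_eq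
  -- This is the remainder of `[V_j, βʳ]` after subtracting the right-invariant field that
  -- represents `D_{X_j} β`; it is tangent to `H`.
  set κ : Fin H.rank → VField p G := fun j =>
    ⟨mlieBracket (𝓡 p) (F.V j).val (𝒢.rightInv β) - 𝒢.rightInv (γ j), fun g =>
      (((F.V j).smoothAt g).mlieBracket (smooth_rightInv β g)).sub
        (smooth_rightInv (γ j) g)⟩ with hκ
  have hκH : ∀ j g, (κ j).val g ∈ H.fiber g := fun j g =>
    hD.mlieBracket_sub_rightInv_mem hH ((F.V j).smoothAt g)
      (Filter.Eventually.of_forall (F.tangent j)) (F.projects j g) (hγ j)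
  have hflat' : ∀ i j g, 𝒢.rightInv (γγ i j) g - 𝒢.rightInv (γγ j i) g - 𝒢.rightInv (δ i j) g ∈
      H.fiber g := by
    intro i j g
    have h1 := hflat (F.X i) (F.X j) (β.mod H) (𝒢.tgt g)
    rw [hnab, hnab, hnab, ← hγ, ← hγ, hnab, hnab, ← hγγ, ← hγγ, ← hδ] at h1
    have h2 : (γγ i j).val (𝒢.tgt g) - (γγ j i).val (𝒢.tgt g) - (δ i j).val (𝒢.tgt g) ∈
        𝒢.symbolFiber H (𝒢.tgt g) := (Submodule.Quotient.mk_eq_zero _).1 h1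
    rw [𝒢.rightInv_eq, 𝒢.rightInv_eq, 𝒢.rightInv_eq, ← map_sub, ← map_sub]
    exact (hH.rightTrans_mem_iff
      ((γγ i j).val (𝒢.tgt g) - (γγ j i).val (𝒢.tgt g) - (δ i j).val (𝒢.tgt g)).2).2 h2
  refine ⟨κ, ?_⟩
  have hcs : ∀ i j : Fin H.rank, ∀ᶠ g in 𝓝 g₀, ∀ a, ContMDiffAt (𝓡 p) 𝓘(ℝ, ℝ) ∞
      (fun k => F.coord k (mlieBracket (𝓡 p) (F.V i).val (F.V j).val k) a) g := fun i j =>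
    F.contMDiffAt_coord.mono fun g hg => hg (((F.V i).smoothAt g).mlieBracket ((F.V j).smoothAt g))
  filter_upwards [F.mem_iff, F.coord_Q, F.eq_sum.eventually_nhds, F.coord_mlieBracket,
    Filter.eventually_all.2 fun i => Filter.eventually_all.2 fun j => hcs i j]
    with g h1 hQ h2 h3 hcs i j b
  set r := 𝒢.rightInv β with hr
  set U := mlieBracket (𝓡 p) (F.V i).val (F.V j).val with hU
  have hUs : SmoothFieldAt U g := ((F.V i).smoothAt g).mlieBracket ((F.V j).smoothAt g)
  have hrs : SmoothFieldAt r g := smooth_rightInv β g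
  set s : Fin H.rank ⊕ Fin F.m → G → ℝ := fun a k => F.coord k (U k) a with hs
  have hss : ∀ a, ContMDiffAt (𝓡 p) 𝓘(ℝ, ℝ) ∞ (s a) g := hcs i j
  -- The bracket `[V_i, V_j]` is split as `η + ζ`, with `η` tangent to `H` and `ζ` the combination
  -- of the `Q_c` whose coefficients are the curvature.
  set η : ∀ g : G, TangentSpace (𝓡 p) g := fun k =>
    ∑ l, (s (Sum.inl l) • (F.V l).val) k with hη
  have hηi : ∀ l ∈ Finset.univ, SmoothFieldAt (s (Sum.inl l) • (F.V l).val) g := fun l _ =>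
    SmoothFieldAt.smul (hss _) ((F.V l).smoothAt g)
  have hηs : SmoothFieldAt η g := SmoothFieldAt.sum hηi
  have hηH : ∀ k, η k ∈ H.fiber k := fun k => Submodule.sum_mem _ fun l _ =>
    Submodule.smul_mem _ _ (F.tangent l k)
  set ζ : ∀ g : G, TangentSpace (𝓡 p) g := fun k =>
    ∑ c, (s (Sum.inr c) • (F.Q c).val) k with hζ
  have hζi : ∀ l ∈ Finset.univ, SmoothFieldAt (s (Sum.inr l) • (F.Q l).val) g := fun l _ =>
    SmoothFieldAt.smul (hss _) ((F.Q l).smoothAt g)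
  have hζs : SmoothFieldAt ζ g := SmoothFieldAt.sum hζi
  have hUηζ : ∀ᶠ k in 𝓝 g, U k = (η + ζ) k := h2.mono fun k hk => hk (U k)
  -- As `ζ` is vertical for the target, `η` carries the whole image `[X_i, X_j]` under `dt`, so `[η,
  -- βʳ]` is governed by `D_{[X_i, X_j]} β`.
  have hηt : 𝒢.dtgt g (η g) = ((F.X i).bracket (F.X j)).val (𝒢.tgt g) := by
    have e1 : 𝒢.dtgt g (U g) = ((F.X i).bracket (F.X j)).val (𝒢.tgt g) :=
      dtgt_mlieBracket ((F.V i).smoothAt g) ((F.V j).smoothAt g)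
        (Filter.Eventually.of_forall (F.projects i)) (Filter.Eventually.of_forall (F.projects j))
    have e2 : 𝒢.dtgt g (ζ g) = 0 := by
      rw [hζ, map_sum]
      refine Finset.sum_eq_zero fun c _ => ?_
      change 𝒢.dtgt g (s (Sum.inr c) g • (F.Q c).val g) = 0
      rw [map_smul, F.vertical, smul_zero]
    rw [← e1, hUηζ.self_of_nhds, Pi.add_apply, map_add, e2, add_zero]
  have hηδ : mlieBracket (𝓡 p) η r g - 𝒢.rightInv (δ i j) g ∈ H.fiber g :=
    hD.mlieBracket_sub_rightInv_mem hH hηs (Filter.Eventually.of_forall hηH) hηt (hδ i j)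
  have hUbr : mlieBracket (𝓡 p) U r g = mlieBracket (𝓡 p) η r g + mlieBracket (𝓡 p) ζ r g := by
    rw [← hηs.mlieBracket_add_left hζs]
    exact Filter.EventuallyEq.mlieBracket_vectorField_eq hUηζ (Filter.EventuallyEq.refl _ r)
  have hVγ : ∀ i j, mlieBracket (𝓡 p) (F.V i).val (mlieBracket (𝓡 p) (F.V j).val r) g =
      mlieBracket (𝓡 p) (F.V i).val (𝒢.rightInv (γ j)) g +
        mlieBracket (𝓡 p) (F.V i).val (κ j).val g := by
    intro i j
    rw [← (smooth_rightInv (γ j) g).mlieBracket_add_right ((κ j).smoothAt g)]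
    congr 1
    exact (add_sub_cancel _ _).symm
  have hγγH : ∀ i j, mlieBracket (𝓡 p) (F.V i).val (𝒢.rightInv (γ j)) g - 𝒢.rightInv (γγ i j) g ∈
      H.fiber g := fun i j =>
    hD.mlieBracket_sub_rightInv_mem hH ((F.V i).smoothAt g)
      (Filter.Eventually.of_forall (F.tangent i)) (F.projects i g) (hγγ i j)
  have hjac := ((F.V i).smoothAt g).leibniz_mlieBracket ((F.V j).smoothAt g) hrs
  rw [hVγ, hVγ] at hjac
  -- In the Jacobi identity the terms representing `D_{X_i} D_{X_j} β`, `D_{X_j} D_{X_i} β` and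
  -- `D_{[X_i, X_j]} β` cancel modulo `H` by flatness. What remains is `[ζ, βʳ] ≡ [V_i, κ_j] - [V_j,
  -- κ_i]`.
  have hmem : mlieBracket (𝓡 p) ζ r g - mlieBracket (𝓡 p) (F.V i).val (κ j).val g +
      mlieBracket (𝓡 p) (F.V j).val (κ i).val g ∈ H.fiber g := by
    have h4 := Submodule.add_mem _ (Submodule.sub_mem _ (hγγH i j) (hγγH j i))
      (Submodule.sub_mem _ (hflat' i j g) hηδ)
    have h5 : mlieBracket (𝓡 p) ζ r g = mlieBracket (𝓡 p) U r g - mlieBracket (𝓡 p) η r g := by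
      rw [hUbr, add_sub_cancel_left]
    have h6 : mlieBracket (𝓡 p) U r g =
        mlieBracket (𝓡 p) (F.V i).val (𝒢.rightInv (γ j)) g +
        mlieBracket (𝓡 p) (F.V i).val (κ j).val g -
        (mlieBracket (𝓡 p) (F.V j).val (𝒢.rightInv (γ i)) g +
        mlieBracket (𝓡 p) (F.V j).val (κ i).val g) := eq_sub_of_add_eq hjac.symm
    rw [h5, h6]
    convert h4 using 1
    abel
  -- The Leibniz rule brings out the derivatives of the curvature along `βʳ`; taking the
  -- `Q_b`-component isolates one of them, and all other terms are linear in the curvature.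
  have hζbr : mlieBracket (𝓡 p) ζ r g =
      ∑ c, (- mvfderiv (𝓡 p) (s (Sum.inr c)) g (r g) • (F.Q c).val g +
        s (Sum.inr c) g • mlieBracket (𝓡 p) (F.Q c).val r g) := by
    rw [mlieBracket_swap_apply, hζ, SmoothFieldAt.mlieBracket_sum_right _ hζi,
      ← Finset.sum_neg_distrib]
    refine Finset.sum_congr rfl fun c _ => ?_
    rw [← mlieBracket_swap_apply, SmoothFieldAt.mlieBracket_smul_left (hss _) ((F.Q c).smoothAt g)]
  have h7 := (h1 _).1 hmem b
  rw [map_add, map_sub, Pi.add_apply, Pi.sub_apply,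
    h3 i (κ j).val ((κ j).smoothAt g) (Filter.Eventually.of_forall (hκH j)) b,
    h3 j (κ i).val ((κ i).smoothAt g) (Filter.Eventually.of_forall (hκH i)) b,
    hζbr, map_sum, Finset.sum_apply] at h7
  have h8 : ∀ c, F.coord g (- mvfderiv (𝓡 p) (s (Sum.inr c)) g (r g) • (F.Q c).val g +
        s (Sum.inr c) g • mlieBracket (𝓡 p) (F.Q c).val r g) (Sum.inr b) =
      - (if c = b then mvfderiv (𝓡 p) (s (Sum.inr c)) g (r g) else 0) +
        F.curv g i j c * F.coord g (mlieBracket (𝓡 p) (F.Q c).val r g) (Sum.inr b) := by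
    intro c
    rw [map_add, map_smul, map_smul, hQ, Pi.add_apply, Pi.smul_apply, Pi.smul_apply]
    have h9 : (Pi.single (Sum.inr c) (1 : ℝ) : Fin H.rank ⊕ Fin F.m → ℝ) (Sum.inr b) =
        if c = b then 1 else 0 := by
      rw [Pi.single_apply]
      simp [eq_comm]
    rw [h9, smul_eq_mul, smul_eq_mul]
    congr 1
    split_ifs <;> simp
  simp only [h8, Finset.sum_add_distrib, Finset.sum_neg_distrib, Finset.sum_ite_eq',
    Finset.mem_univ, if_true] at h7
  have h9 : mvfderiv (𝓡 p) (fun k => F.curv k i j b) g (r g) =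
    mvfderiv (𝓡 p) (s (Sum.inr b)) g (r g) := rfl
  rw [h9]
  linarith

end AdaptedFrame

end LieGroupoid

/-! ### Grönwall estimates along the fibres of a submersion. -/

section Propagation

/-- A function on a convex set whose derivative is bounded by a multiple of the function vanishes
identically as soon as it vanishes somewhere. -/
theorem Convex.eq_zero_of_norm_fderiv_le {E W : Type*} [NormedAddCommGroup E] [NormedSpace ℝ E]
    [NormedAddCommGroup W] [NormedSpace ℝ W] {s : Set E} (hs : Convex ℝ s) {Y : E → W} {K : ℝ}
    (hY : ∀ z ∈ s, DifferentiableAt ℝ Y z) (hK : ∀ z ∈ s, ‖fderiv ℝ Y z‖ ≤ K * ‖Y z‖)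
    {z w : E} (hz : z ∈ s) (hw : w ∈ s) (h : Y z = 0) : Y w = 0 := by
  set l : ℝ → E := fun t => z + t • (w - z) with hl
  have hls : ∀ t ∈ Icc (0 : ℝ) 1, l t ∈ s := fun t ht => hs.add_smul_sub_mem hz hw ht
  have hld : ∀ t, HasDerivAt l (w - z) t := by
    intro t
    have := ((hasDerivAt_id t).smul_const (w - z)).const_add z
    rwa [one_smul] at this
  have hd : ∀ t ∈ Icc (0 : ℝ) 1, HasDerivAt (Y ∘ l) (fderiv ℝ Y (l t) (w - z)) t := fun t ht =>
    (hY _ (hls t ht)).hasFDerivAt.comp_hasDerivAt t (hld t)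
  have h0 := eq_zero_of_abs_deriv_le_mul_abs_self_of_eq_zero_right (f := Y ∘ l)
    (f' := fun t => fderiv ℝ Y (l t) (w - z)) (K := K * ‖w - z‖) (a := 0) (b := 1)
    (fun t ht => (hd t ht).continuousAt.continuousWithinAt)
    (fun t ht => (hd t (Ico_subset_Icc_self ht)).hasDerivWithinAt) (by simp [hl, h])
    (fun t ht => by
      refine (ContinuousLinearMap.le_opNorm _ _).trans ?_
      rw [mul_right_comm]
      exact mul_le_mul_of_nonneg_right (hK _ (hls t (Ico_subset_Icc_self ht))) (norm_nonneg _))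
    1 (right_mem_Icc.2 zero_le_one)
  simpa [hl] using h0

theorem exists_eventually_abs_le {X ι : Type*} [TopologicalSpace X] [Finite ι] {f : ι → X → ℝ}
    {x : X} (hf : ∀ i, ContinuousAt (f i) x) :
    ∃ C : ℝ, 0 ≤ C ∧ ∀ᶠ y in 𝓝 x, ∀ i, |f i y| ≤ C := by
  cases nonempty_fintype ι
  have h : ContinuousAt (fun y i => f i y) x := continuousAt_pi.2 hf
  refine ⟨‖fun i => f i x‖ + 1, by positivity, ?_⟩
  filter_upwards [h.norm.eventually (gt_mem_nhds (lt_add_one _))] with y hy i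
  exact (norm_le_pi_norm (fun i => f i y) i).trans hy.le

variable {E : Type*} [NormedAddCommGroup E] [NormedSpace ℝ E] [CompleteSpace E]
  {H : Type*} [TopologicalSpace H] {I : ModelWithCorners ℝ E H} [I.Boundaryless]
  {M : Type*} [TopologicalSpace M] [ChartedSpace H M] [IsManifold I ∞ M]
  {E' : Type*} [NormedAddCommGroup E'] [NormedSpace ℝ E'] [CompleteSpace E']
  {H' : Type*} [TopologicalSpace H'] {I' : ModelWithCorners ℝ E' H'} [I'.Boundaryless]
  {M' : Type*} [TopologicalSpace M'] [ChartedSpace H' M'] [IsManifold I' ∞ M']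
  {W : Type*} [NormedAddCommGroup W] [NormedSpace ℝ W]

/-- Vanishing propagates along the fibres of a submersion for functions satisfying a linear
differential inequality along the fibres. -/
theorem Manifold.IsSubmersionAt.eventually_eq_zero_iff {f : M → M'} {x₀ : M}
    (hf : IsSubmersionAt I I' ∞ f x₀) {y : M → W} {K : ℝ}
    (hy : ∀ᶠ x in 𝓝 x₀, MDifferentiableAt I 𝓘(ℝ, W) y x)
    (hK : ∀ᶠ x in 𝓝 x₀, ∀ u : TangentSpace I x, mfderiv I I' f x u = 0 →
      ‖mvfderiv I y x u‖ ≤ K * ‖mvfderiv I (extChartAt I x₀) x u‖ * ‖y x‖) :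
    ∀ᶠ x in 𝓝 x₀, f x = f x₀ → (y x₀ = 0 ↔ y x = 0) := by
  have : IsManifold I 1 M := IsManifold.of_le (n := ∞) (by simp)
  obtain ⟨B, hBs, hBf, hBx⟩ := hf.exists_fiber_retraction
  set φ := extChartAt I x₀ with hφ
  -- A smooth map from a chart ball to the fibre through `x₀` that hits every nearby point of the
  -- fibre: the ball is convex, so the segment estimate applies to `y ∘ b`.
  set b : E → M := fun z => B (f x₀, φ.symm z) with hb
  have hφc : ContMDiffAt 𝓘(ℝ, E) I ∞ φ.symm (φ x₀) :=
    (contMDiffOn_extChartAt_symm (I := I) (n := ∞) x₀).contMDiffAt (extChartAt_target_mem_nhds x₀)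
  have hφx : φ.symm (φ x₀) = x₀ := extChartAt_to_inv x₀
  have hpt : Filter.Tendsto (fun z => (f x₀, φ.symm z)) (𝓝 (φ x₀)) (𝓝 (f x₀, x₀)) := by
    have : ContinuousAt (fun z => (f x₀, φ.symm z)) (φ x₀) :=
      continuousAt_const.prodMk hφc.continuousAt
    have := this.tendsto
    rwa [hφx] at this
  have hbx : b (φ x₀) = x₀ := by
    simp only [hb]
    rw [hφx]
    exact hBx.self_of_nhds
  have hbs : ContMDiffAt 𝓘(ℝ, E) I ∞ b (φ x₀) := by
    have h1 : ContMDiffAt 𝓘(ℝ, E) (I'.prod I) ∞ (fun z => (f x₀, φ.symm z)) (φ x₀) :=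
      contMDiffAt_const.prodMk hφc
    exact ContMDiffAt.comp (φ x₀) (g := B) (f := fun z => (f x₀, φ.symm z))
      (by rw [hφx]; exact hBs.self_of_nhds) h1
  have hbt : Filter.Tendsto b (𝓝 (φ x₀)) (𝓝 x₀) := by
    have := hbs.continuousAt.tendsto
    rwa [hbx] at this
  have hφs : ContMDiffAt I 𝓘(ℝ, E) ∞ φ x₀ := contMDiffAt_extChartAt
  have ha : ContDiffAt ℝ ∞ (φ ∘ b) (φ x₀) :=
    contMDiffAt_iff_contDiffAt.1
      (ContMDiffAt.comp (φ x₀) (g := φ) (f := b) (by rw [hbx]; exact hφs) hbs)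
  have hac : ContinuousAt (fderiv ℝ (φ ∘ b)) (φ x₀) :=
    (ha.fderiv_right (m := 0) (by simp)).continuousAt
  obtain ⟨L, hL⟩ : ∃ L, ∀ᶠ z in 𝓝 (φ x₀), ‖fderiv ℝ (φ ∘ b) z‖ ≤ L :=
    ⟨_, (hac.norm.eventually (gt_mem_nhds (lt_add_one _))).mono fun z hz => hz.le⟩
  have hall : ∀ᶠ z in 𝓝 (φ x₀), MDifferentiableAt 𝓘(ℝ, E) I b z ∧
      MDifferentiableAt I I' f (b z) ∧ MDifferentiableAt I 𝓘(ℝ, E) φ (b z) ∧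
      MDifferentiableAt I 𝓘(ℝ, W) y (b z) ∧ (∀ᶠ z' in 𝓝 z, f (b z') = f x₀) ∧
      ‖fderiv ℝ (φ ∘ b) z‖ ≤ L ∧ (∀ u : TangentSpace I (b z), mfderiv I I' f (b z) u = 0 →
        ‖mvfderiv I y (b z) u‖ ≤ K * ‖mvfderiv I φ (b z) u‖ * ‖y (b z)‖) := by
    filter_upwards [hbs.eventually_mdifferentiableAt,
      hbt.eventually hf.contMDiffAt.eventually_mdifferentiableAt,
      hbt.eventually hφs.eventually_mdifferentiableAt, hbt.eventually hy,
      (hpt.eventually hBf).eventually_nhds, hL, hbt.eventually hK]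
      with z h1 h2 h3 h4 h5 h6 h7
    exact ⟨h1, h2, h3, h4, h5, h6, h7⟩
  obtain ⟨ρ, hρ, hball⟩ := Metric.eventually_nhds_iff_ball.1 hall
  have hYd : ∀ z ∈ Metric.ball (φ x₀) ρ, DifferentiableAt ℝ (y ∘ b) z := fun z hz =>
    mdifferentiableAt_iff_differentiableAt.1
      (MDifferentiableAt.comp z (hball z hz).2.2.2.1 (hball z hz).1)
  -- The derivative of `b` lands in `ker df`, where the inequality for `y` holds; `L` bounds that
  -- derivative read in the chart. The absolute value is taken because the sign of `K` is not
  -- prescribed.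
  have hYK : ∀ z ∈ Metric.ball (φ x₀) ρ, ‖fderiv ℝ (y ∘ b) z‖ ≤ |K| * L * ‖(y ∘ b) z‖ := by
    intro z hz
    obtain ⟨h1, h2, h3, h4, h5, h6, h7⟩ := hball z hz
    have hL0 : 0 ≤ L := (norm_nonneg _).trans h6
    refine ContinuousLinearMap.opNorm_le_bound _ (by positivity) fun w => ?_
    have e1 : fderiv ℝ (y ∘ b) z w = mvfderiv I y (b z) (mfderiv 𝓘(ℝ, E) I b z w) := by
      rw [← mfderiv_eq_fderiv]
      exact mvfderiv_comp_apply_vector h4 h1 w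
    have e2 : fderiv ℝ (φ ∘ b) z w = mvfderiv I φ (b z) (mfderiv 𝓘(ℝ, E) I b z w) := by
      rw [← mfderiv_eq_fderiv]
      exact mvfderiv_comp_apply_vector h3 h1 w
    have e3 : mfderiv I I' f (b z) (mfderiv 𝓘(ℝ, E) I b z w) = 0 := by
      have h8 := mfderiv_comp z h2 h1
      have h9 : f ∘ b =ᶠ[𝓝 z] fun _ => f x₀ := h5
      rw [h9.mfderiv_eq, mfderiv_const] at h8
      exact (congrArg (fun L : E →L[ℝ] E' => L w) h8).symm
    rw [e1]
    refine (h7 _ e3).trans ?_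
    rw [← e2]
    calc K * ‖fderiv ℝ (φ ∘ b) z w‖ * ‖y (b z)‖ ≤ |K| * (L * ‖w‖) * ‖y (b z)‖ := by
          gcongr
          · exact le_abs_self K
          · exact (ContinuousLinearMap.le_opNorm _ _).trans (by gcongr)
      _ = |K| * L * ‖(y ∘ b) z‖ * ‖w‖ := by
          simp only [Function.comp_apply]
          ring
  have hφt : ContinuousAt φ x₀ := hφs.continuousAt
  filter_upwards [hφt.preimage_mem_nhds (Metric.ball_mem_nhds _ hρ),
    extChartAt_source_mem_nhds (I := I) x₀, hBx] with x h1 h2 h3 h4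
  have e1 : b (φ x) = x := by
    simp only [hb]
    rw [φ.left_inv h2, ← h4, h3]
  have h5 := (convex_ball (φ x₀) ρ).eq_zero_of_norm_fderiv_le hYd hYK (Metric.mem_ball_self hρ) h1
  have h6 := (convex_ball (φ x₀) ρ).eq_zero_of_norm_fderiv_le hYd hYK h1 (Metric.mem_ball_self hρ)
  simp only [Function.comp_apply] at h5 h6
  rw [hbx, e1] at h5 h6
  exact ⟨h5, h6⟩

end Propagation

/-! ### Vanishing of the curvature propagates along source fibres. -/

namespace LieGroupoid

variable {p n : ℕ} {G M : Type*}
  [TopologicalSpace G] [ChartedSpace (EuclideanSpace ℝ (Fin p)) G] [IsManifold (𝓡 p) ∞ G]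
  [TopologicalSpace M] [ChartedSpace (EuclideanSpace ℝ (Fin n)) M] [IsManifold (𝓡 n) ∞ M]
  {𝒢 : LieGroupoid p n G M} {H : TangentDistribution p G}
  [T2Space G] [SecondCountableTopology G]

/-- Near a point, the vectors tangent to the source fibres are combinations of right-invariant
vector fields, with controlled coefficients. -/
theorem exists_rightInv_spanning (g₀ : G) :
    ∃ (k : ℕ) (β : Fin k → 𝒢.AlgSection) (C : ℝ), ∀ᶠ g in 𝓝 g₀, ∀ u : TangentSpace (𝓡 p) g,
      𝒢.dsrc g u = 0 → ∃ a : Fin k → ℝ, u = ∑ i, a i • 𝒢.rightInv (β i) g ∧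
        ∀ i, |a i| ≤ C * ‖mvfderiv (𝓡 p) (extChartAt (𝓡 p) g₀) g u‖ := by
  have := finiteDimensional_tangentSpace (p := p) g₀
  set S := LinearMap.ker (𝒢.dsrc g₀).toLinearMap
  obtain ⟨C, hC⟩ := S.exists_isCompl
  -- The truncated subtraction `p - n` is exact, since `n + dim ker ds = p`.
  have hS : ∀ g, Module.finrank ℝ (LinearMap.ker (𝒢.dsrc g).toLinearMap) = p - n := fun g => by
    have := finrank_ker_dsrc (𝒢 := 𝒢) g
    omega
  set bS := Module.finBasisOfFinrankEq ℝ S (hS g₀)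
  set bC := Module.finBasis ℝ C
  choose β hβ using fun i => exists_rightInv_eq (𝒢 := 𝒢) (g := g₀) (bS i).2
  choose Z hZ using fun i => VField.exists_eq g₀ (bC i : TangentSpace (𝓡 p) g₀)
  set Y : _ ⊕ _ → VField p G := Sum.elim (fun i => (β i).rightField) Z with hY
  have hli : LinearIndependent ℝ (fun i => (Y i).val g₀) := by
    have h1 : LinearIndependent ℝ (fun i => (β i).rightField.val g₀) := by
      have : (fun i => (β i).rightField.val g₀) = fun i => (bS i : TangentSpace (𝓡 p) g₀) :=
        funext hβ
      rw [this]
      exact bS.linearIndependent.map' S.subtype (Submodule.ker_subtype _)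
    have h2 : LinearIndependent ℝ (fun i => (Z i).val g₀) := by
      simp only [hZ]
      exact bC.linearIndependent.map' C.subtype (Submodule.ker_subtype _)
    have := h1.sum_type h2 (hC.disjoint.mono ?_ ?_)
    · have e : (fun i => (Y i).val g₀) =
          Sum.elim (fun i => (β i).rightField.val g₀) fun i => (Z i).val g₀ := by
        ext1 i
        cases i <;> rfl
      rw [e]
      exact this
    · rw [Submodule.span_le]
      rintro _ ⟨i, rfl⟩
      exact dsrc_rightInv (β i) g₀
    · rw [Submodule.span_le]
      rintro _ ⟨i, rfl⟩
      simp only [hZ]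
      exact (bC i).2
  obtain ⟨θ, hθ⟩ := exists_dual_coframe (I := 𝓡 p) (Z := fun i => (Y i).val)
    (fun i => Filter.Eventually.of_forall fun x => (Y i).smooth x) hli (by
      rw [Fintype.card_sum, Fintype.card_fin, Fintype.card_fin, ← hS g₀,
        Submodule.finrank_add_eq_of_isCompl hC]
      exact (finrank_tangentSpace g₀).trans (finrank_tangentSpace g₀).symm)
  have hθc : ContinuousAt θ g₀ := hθ.self_of_nhds.1.continuousAt
  refine ⟨p - n, β, ‖θ g₀‖ + 1, ?_⟩
  filter_upwards [hθ, hθc.norm.eventually (gt_mem_nhds (lt_add_one _))] with g h1 h2 u hu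
  have hfd := finiteDimensional_tangentSpace (p := p) g
  set T : TangentSpace (𝓡 p) g →ₗ[ℝ] (_ → ℝ) :=
    ((θ g).toLinearMap ∘ₗ (mvfderiv (𝓡 p) (extChartAt (𝓡 p) g₀) g).toLinearMap :
      EuclideanSpace ℝ (Fin p) →ₗ[ℝ] (_ → ℝ)) with hT
  have hTβ : ∀ i, T (𝒢.rightInv (β i) g) = Pi.single (Sum.inl i) 1 := fun i => h1.2.1 (Sum.inl i)
  have hlig : LinearIndependent ℝ (fun i => 𝒢.rightInv (β i) g) := by
    refine LinearIndependent.of_comp T ?_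
    have := (Pi.basisFun ℝ (Fin (p - n) ⊕ Fin (Module.finrank ℝ C))).linearIndependent.comp _
      Sum.inl_injective
    convert this using 1
    ext i : 1
    simp [hTβ]
  have hspan : Submodule.span ℝ (range fun i => 𝒢.rightInv (β i) g) =
      LinearMap.ker (𝒢.dsrc g).toLinearMap := by
    refine Submodule.eq_of_le_of_finrank_eq ?_ ?_
    · rw [Submodule.span_le]
      rintro _ ⟨i, rfl⟩
      exact dsrc_rightInv (β i) g
    · rw [finrank_span_eq_card hlig, hS, Fintype.card_fin]
  have hu' : u ∈ LinearMap.ker (𝒢.dsrc g).toLinearMap := hu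
  rw [← hspan] at hu'
  obtain ⟨a, ha⟩ := (Submodule.mem_span_range_iff_exists_fun ℝ).1 hu'
  refine ⟨a, ha.symm, fun i => ?_⟩
  -- The coefficients are components of the dual coframe, hence bounded by the norm of `u` in the
  -- chart times a local bound for the coframe.
  have h3 : T u (Sum.inl i) = a i := by
    rw [← ha, map_sum, Finset.sum_apply, Finset.sum_eq_single i]
    · rw [map_smul, hTβ]
      simp
    · intro j _ hj
      rw [map_smul, hTβ]
      simp [hj.symm]
    · simp
  rw [← h3]
  refine (norm_le_pi_norm (T u) (Sum.inl i)).trans ?_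
  refine ((θ g).le_opNorm _).trans ?_
  exact mul_le_mul_of_nonneg_right h2.le (norm_nonneg _)

namespace AdaptedFrame

variable {g₀ : G} (F : AdaptedFrame 𝒢 H g₀)

theorem contMDiffAt_curv : ∀ᶠ g in 𝓝 g₀, ContMDiffAt (𝓡 p)
    𝓘(ℝ, Fin H.rank → Fin H.rank → Fin F.m → ℝ) ∞ F.curv g := by
  have h : ∀ i j : Fin H.rank, ∀ᶠ g in 𝓝 g₀, ∀ a, ContMDiffAt (𝓡 p) 𝓘(ℝ, ℝ) ∞
      (fun k => F.coord k (mlieBracket (𝓡 p) (F.V i).val (F.V j).val k) a) g := fun i j =>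
    F.contMDiffAt_coord.mono fun g hg => hg (((F.V i).smoothAt g).mlieBracket ((F.V j).smoothAt g))
  filter_upwards [Filter.eventually_all.2 fun i => Filter.eventually_all.2 fun j => h i j]
    with g hg
  exact contMDiffAt_pi_space.2 fun i => contMDiffAt_pi_space.2 fun j =>
    contMDiffAt_pi_space.2 fun b => hg i j (Sum.inr b)

theorem abs_curv_le (g : G) (i j : Fin H.rank) (b : Fin F.m) : |F.curv g i j b| ≤ ‖F.curv g‖ :=
  (norm_le_pi_norm (F.curv g i j) b).trans
    ((norm_le_pi_norm (F.curv g i) j).trans (norm_le_pi_norm (F.curv g) i))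

theorem mvfderiv_curv_apply : ∀ᶠ g in 𝓝 g₀, ∀ (u : TangentSpace (𝓡 p) g) i j b,
    mvfderiv (𝓡 p) F.curv g u i j b = mvfderiv (𝓡 p) (fun k => F.curv k i j b) g u := by
  filter_upwards [F.contMDiffAt_curv] with g hg u i j b
  set P : (Fin H.rank → Fin H.rank → Fin F.m → ℝ) →L[ℝ] ℝ :=
    ContinuousLinearMap.proj b ∘L ContinuousLinearMap.proj j ∘L ContinuousLinearMap.proj i with hP
  have h1 := mvfderiv_comp_apply_vector (I' := 𝓘(ℝ, Fin H.rank → Fin H.rank → Fin F.m → ℝ))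
    (g := P) (f := F.curv) (x := g)
    P.differentiableAt.mdifferentiableAt (hg.mdifferentiableAt (by simp)) u
  refine Eq.trans ?_ h1.symm
  change _ = (mfderiv 𝓘(ℝ, Fin H.rank → Fin H.rank → Fin F.m → ℝ) 𝓘(ℝ, ℝ) P (F.curv g))
    (mfderiv (𝓡 p) 𝓘(ℝ, Fin H.rank → Fin H.rank → Fin F.m → ℝ) F.curv g u)
  rw [mfderiv_eq_fderiv, P.fderiv]
  rfl

variable [T2Space M] [SecondCountableTopology M]

theorem exists_norm_mvfderiv_curv_rightInv_le (hH : 𝒢.IsMultiplicative H)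
    {D : VField n M → 𝒢.AlgSection → 𝒢.QuotSection H} (hD : 𝒢.IsSpencerOperator H D)
    {nab : VField n M → 𝒢.QuotSection H → 𝒢.QuotSection H} (hnab : 𝒢.IsInduced H D nab)
    (hflat : 𝒢.IsFlat H nab) (β : 𝒢.AlgSection) :
    ∃ K : ℝ, 0 ≤ K ∧
      ∀ᶠ g in 𝓝 g₀, ‖mvfderiv (𝓡 p) F.curv g (𝒢.rightInv β g)‖ ≤ K * ‖F.curv g‖ := by
  obtain ⟨κ, hκ⟩ := F.exists_mvfderiv_curv_eq hH hD hnab hflat β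
  obtain ⟨C₁, hC₁, h₁⟩ := exists_eventually_abs_le (ι := Fin H.rank × Fin H.rank) (x := g₀)
    (f := fun q g => F.coord g ((κ q.1).val g) (Sum.inl q.2)) (fun q =>
      (F.contMDiffAt_coord.self_of_nhds ((κ q.1).smoothAt g₀) _).continuousAt)
  obtain ⟨C₂, hC₂, h₂⟩ := exists_eventually_abs_le (ι := Fin F.m × Fin F.m) (x := g₀)
    (f := fun q g => F.coord g (mlieBracket (𝓡 p) (F.Q q.1).val (𝒢.rightInv β) g) (Sum.inr q.2))
    (fun q => (F.contMDiffAt_coord.self_of_nhds (((F.Q q.1).smoothAt g₀).mlieBracket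
      (smooth_rightInv β g₀)) _).continuousAt)
  -- One summand for each of the three sums in the equation for the derivative: the number of terms
  -- times the local bound for their coefficients.
  refine ⟨F.m * C₂ + H.rank * C₁ + H.rank * C₁, by positivity, ?_⟩
  filter_upwards [hκ, h₁, h₂, F.mvfderiv_curv_apply] with g h1 h2 h3 h4
  have hnn : 0 ≤ (F.m * C₂ + H.rank * C₁ + H.rank * C₁) * ‖F.curv g‖ := by positivity
  refine (pi_norm_le_iff_of_nonneg hnn).2 fun i => (pi_norm_le_iff_of_nonneg hnn).2 fun j =>
    (pi_norm_le_iff_of_nonneg hnn).2 fun b => ?_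
  rw [h4, h1, Real.norm_eq_abs]
  have hA : |∑ c, F.curv g i j c *
      F.coord g (mlieBracket (𝓡 p) (F.Q c).val (𝒢.rightInv β) g) (Sum.inr b)| ≤
      F.m * (‖F.curv g‖ * C₂) := by
    refine (Finset.abs_sum_le_sum_abs _ _).trans ?_
    refine (Finset.sum_le_card_nsmul _ _ (‖F.curv g‖ * C₂) fun c _ => ?_).trans (by simp)
    rw [abs_mul]
    exact mul_le_mul (F.abs_curv_le g i j c) (h3 (c, b)) (abs_nonneg _) (norm_nonneg _)
  have hB : ∀ i j, |∑ l, F.coord g ((κ j).val g) (Sum.inl l) * F.curv g i l b| ≤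
      H.rank * (C₁ * ‖F.curv g‖) := by
    intro i j
    refine (Finset.abs_sum_le_sum_abs _ _).trans ?_
    refine (Finset.sum_le_card_nsmul _ _ (C₁ * ‖F.curv g‖) fun l _ => ?_).trans (by simp)
    rw [abs_mul]
    exact mul_le_mul (h2 (j, l)) (F.abs_curv_le g i l b) (abs_nonneg _) hC₁
  have h5 := abs_add_le (∑ c, F.curv g i j c *
      F.coord g (mlieBracket (𝓡 p) (F.Q c).val (𝒢.rightInv β) g) (Sum.inr b) -
      ∑ l, F.coord g ((κ j).val g) (Sum.inl l) * F.curv g i l b)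
      (∑ l, F.coord g ((κ i).val g) (Sum.inl l) * F.curv g j l b)
  have h6 := abs_sub (∑ c, F.curv g i j c *
      F.coord g (mlieBracket (𝓡 p) (F.Q c).val (𝒢.rightInv β) g) (Sum.inr b))
      (∑ l, F.coord g ((κ j).val g) (Sum.inl l) * F.curv g i l b)
  have h7 := hB i j
  have h8 := hB j i
  refine h5.trans ?_
  linarith

theorem exists_norm_mvfderiv_curv_le (hH : 𝒢.IsMultiplicative H)
    {D : VField n M → 𝒢.AlgSection → 𝒢.QuotSection H} (hD : 𝒢.IsSpencerOperator H D)
    {nab : VField n M → 𝒢.QuotSection H → 𝒢.QuotSection H} (hnab : 𝒢.IsInduced H D nab)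
    (hflat : 𝒢.IsFlat H nab) :
    ∃ K : ℝ, ∀ᶠ g in 𝓝 g₀, ∀ u : TangentSpace (𝓡 p) g, 𝒢.dsrc g u = 0 →
      ‖mvfderiv (𝓡 p) F.curv g u‖ ≤
        K * ‖mvfderiv (𝓡 p) (extChartAt (𝓡 p) g₀) g u‖ * ‖F.curv g‖ := by
  obtain ⟨k, β, C, hβ⟩ := exists_rightInv_spanning (𝒢 := 𝒢) g₀
  choose K hK0 hK using fun i =>
    F.exists_norm_mvfderiv_curv_rightInv_le hH hD hnab hflat (β i)
  refine ⟨∑ i, C * K i, ?_⟩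
  filter_upwards [hβ, Filter.eventually_all.2 hK] with g h1 h2 u hu
  obtain ⟨a, ha, hab⟩ := h1 u hu
  have h3 : mvfderiv (𝓡 p) F.curv g u =
      ∑ i, a i • mvfderiv (𝓡 p) F.curv g (𝒢.rightInv (β i) g) := by
    conv_lhs => rw [ha]
    rw [map_sum]
    exact Finset.sum_congr rfl fun i _ => map_smul _ _ _
  rw [h3, Finset.sum_mul, Finset.sum_mul]
  refine (norm_sum_le _ _).trans (Finset.sum_le_sum fun i _ => ?_)
  rw [norm_smul, Real.norm_eq_abs]
  calc |a i| * ‖mvfderiv (𝓡 p) F.curv g (𝒢.rightInv (β i) g)‖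
      ≤ (C * ‖mvfderiv (𝓡 p) (extChartAt (𝓡 p) g₀) g u‖) * (K i * ‖F.curv g‖) :=
        mul_le_mul (hab i) (h2 i) (norm_nonneg _) ((abs_nonneg _).trans (hab i))
    _ = C * K i * ‖mvfderiv (𝓡 p) (extChartAt (𝓡 p) g₀) g u‖ * ‖F.curv g‖ := by ring

end AdaptedFrame

variable [T2Space M] [SecondCountableTopology M]

/-- Near each arrow, involutivity at points of the same source fibre is equivalent; the fibre is
connected and contains a unit, where involutivity holds. -/
theorem IsSpencerOperator.isInvolutive (hconn : 𝒢.IsSourceConnected)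
    (hH : 𝒢.IsMultiplicative H) {D : VField n M → 𝒢.AlgSection → 𝒢.QuotSection H}
    (hD : 𝒢.IsSpencerOperator H D) (hs : 𝒢.SymbolVanishes H D)
    {nab : VField n M → 𝒢.QuotSection H → 𝒢.QuotSection H} (hnab : 𝒢.IsInduced H D nab)
    (hflat : 𝒢.IsFlat H nab) : H.IsInvolutive := by
  set S : G → Prop := fun g => ∀ V W : VField p G, (∀ k, V.val k ∈ H.fiber k) →
    (∀ k, W.val k ∈ H.fiber k) → mlieBracket (𝓡 p) V.val W.val g ∈ H.fiber g with hS
  have hloc : ∀ g₀ : G, ∀ᶠ g in 𝓝 g₀, 𝒢.src g = 𝒢.src g₀ → (S g₀ ↔ S g) := by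
    intro g₀
    obtain ⟨F⟩ := hH.nonempty_adaptedFrame g₀
    obtain ⟨K, hK⟩ := F.exists_norm_mvfderiv_curv_le hH hD hnab hflat
    filter_upwards [(𝒢.src_submersion.isSubmersionAt g₀).eventually_eq_zero_iff
      (F.contMDiffAt_curv.mono fun g hg => hg.mdifferentiableAt (by simp)) hK,
      F.mlieBracket_mem_iff] with g h1 h2 h3
    exact F.mlieBracket_mem_iff.self_of_nhds.trans ((h1 h3).trans h2.symm)
  intro V W hV hW g
  -- The relation "involutive at one point iff at the other" is transitive and holds locally in the
  -- fibre, so preconnectedness extends it from the unit to `g`.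
  have hfib := (hconn (𝒢.src g)).isPreconnected.induction₂' (fun g k => S g ↔ S k)
    (fun g₀ hg₀ => by
      filter_upwards [nhdsWithin_le_nhds (hloc g₀), self_mem_nhdsWithin] with k h1 h2
      have h3 := h1 (Eq.trans h2 (Eq.symm hg₀))
      exact ⟨h3, h3.symm⟩)
    (fun _ _ _ _ _ _ h1 h2 => h1.trans h2)
    (x := 𝒢.unit (𝒢.src g)) (y := g) (𝒢.src_unit _) rfl
  exact hfib.1 (fun V W hV hW => hD.mlieBracket_mem_unit hH hs hV hW _) V W hV hW

end LieGroupoid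

theorem theorem5 {p n : ℕ} {G M : Type*}
    [TopologicalSpace G] [T2Space G] [SecondCountableTopology G]
    [ChartedSpace (EuclideanSpace ℝ (Fin p)) G] [IsManifold (𝓡 p) ∞ G]
    [TopologicalSpace M] [T2Space M] [SecondCountableTopology M]
    [ChartedSpace (EuclideanSpace ℝ (Fin n)) M] [IsManifold (𝓡 n) ∞ M]
    (𝒢 : LieGroupoid p n G M) (hconn : 𝒢.IsSourceConnected)
    (H : TangentDistribution p G) (hH : 𝒢.IsMultiplicative H) :
    ∃ D : VField n M → 𝒢.AlgSection → 𝒢.QuotSection H,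
      𝒢.IsSpencerOperator H D ∧ (∀ D', 𝒢.IsSpencerOperator H D' → D' = D) ∧
      (𝒢.SymbolVanishes H D → ∃! nab, 𝒢.IsInduced H D nab) ∧
      (∀ nab, 𝒢.IsInduced H D nab → 𝒢.IsConnection H nab) ∧
      (H.IsInvolutive ↔
        𝒢.SymbolVanishes H D ∧ ∀ nab, 𝒢.IsInduced H D nab → 𝒢.IsFlat H nab) := by
  have hD := LieGroupoid.isSpencerOperator_spencerOperator hH
  refine ⟨LieGroupoid.spencerOperator hH, hD, fun D' hD' => hD.eq hH hD',
    hD.existsUnique_isInduced hH, fun nab h => hD.isConnection hH h, fun hinv =>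
    ⟨hD.symbolVanishes_of_isInvolutive hH hinv, fun nab h => hD.isFlat_of_isInvolutive hH hinv h⟩,
    fun ⟨hs, hflat⟩ => ?_⟩
  -- Flatness is assumed for all induced operators; vanishing of the symbol supplies one, so the
  -- assumption is not vacuous.
  obtain ⟨nab, hnab, -⟩ := hD.existsUnique_isInduced hH hs
  exact hD.isInvolutive hconn hH hs hnab (hflat nab hnab)
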